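/- There is an $\in$-sentence $\phi$ that is not plainly OTM-realizable, but is almost surely OTM-realizable (as-OTM-realizable): $\not\Vdash_{\mathrm{OTM}}\phi$ and $\Vdash_{\mathrm{as\text{-}OTM}}\phi$. Here OTMs are Koepke's (parameter-free) ordinal Turing machines, with an oracle tape and an input tape. Sets are given to programs by codes, which are sets of ordinals. An OTM-program $P$ is safe if it halts for every oracle and every input that is a set of ordinals, and coding-stable if whether it halts, and the set coded by its output, do not depend on the codes by which the given sets are presented; $P^{\vec{a}}(y)$ denotes the set coded by the output of $P$ with $\vec{a}$ on the oracle tape and $y$ on the input tape. Let $\mathcal{B}$ be the family of Lebesgue measurable sets $\mathcal{O}\subseteq\mathfrak{P}(\omega)$ of measure $1$. A pair $(P,\vec{p})$ of a safe and coding-stable program and a finite tuple of real numbers (subsets of $\omega$) as-OTM-realizes a formula $\phi(\vec{a})$ with parameters $\vec{a}$ from the set $H_{\omega_1}$ of hereditarily countable sets under the following conditions. All quantifiers in formulas range over $H_{\omega_1}$. - $\phi$ atomic: $\phi(\vec{a})$ is true. - $\psi_0\wedge\psi_1$: there is $\mathcal{O}\in\mathcal{B}$ such that for all $x\in\mathcal{O}$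 and $i\in\{0,1\}$, $P^{\vec{p},\vec{a},x}(i)$ realizes $\psi_i(\vec{a})$. - $\psi_0\vee\psi_1$: there is $\mathcal{O}\in\mathcal{B}$ such that for all $x\in\mathcal{O}$, $P^{\vec{p},\vec{a},x}(0)=i\in\{0,1\}$ and $P^{\vec{p},\vec{a},x}(1)$ realizes $\psi_i(\vec{a})$. - $\psi_0\rightarrow\psi_1$: for every realizer $s$ of $\psi_0(\vec{a})$ there is $\mathcal{O}\in\mathcal{B}$ such that for all $x\in\mathcal{O}$, $P^{\vec{p},\vec{a},x}(s)$ realizes $\psi_1(\vec{a})$; and $\neg\psi$ is treated as $\psi\rightarrow(1=0)$. - $\exists y\,\psi(y)$: there is $\mathcal{O}\in\mathcal{B}$ such that for all $x\in\mathcal{O}$, $P^{\vec{p},\vec{a},x}(0)$ realizes $\psi(P^{\vec{p},\vec{a},x}(1),\vec{a})$. - $\forall y\,\psi(y)$: for every $b\in H_{\omega_1}$ there is $\mathcal{O}\in\mathcal{B}$ such that for all $x\in\mathcal{O}$, $P^{\vec{p},\vec{a},b,x}$ realizes $\psi(b,\vec{a})$. Plain OTM-realizability is defined by the same clauses with all mentions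 of $\mathcal{O}$ and of the oracle $x$ dropped. A sentence is as-OTM-realizable (plainly OTM-realizable) if it is realized in the respective sense by $(P,())$, for some OTM-program $P$, with the empty tuple of parameters. -/

import Mathlib

open Set MeasureTheory

/-! # Ordinal Turing machines, and almost sure and plain OTM-realizability -/

namespace OTM

/-! ## Machines -/

/-- The possible motions of a head. -/
inductive Move : Type
  | left
  | stay
  | right

/-- A numbering of the motions. -/
def Move.toNat : Move → ℕ
  | .left => 0
  | .stay => 1
  | .right => 2

/-- The inverse of `Move.toNat`. -/
def Move.ofNat : ℕ → Move
  | 0 => .left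
  | 1 => .stay
  | _ => .right

instance : Encodable Move :=
  Encodable.ofLeftInverse Move.toNat Move.ofNat (fun m => by cases m <;> rfl)

/-- A command of an ordinal Turing machine with a read-only oracle tape, a read-only input tape and
a work tape (which is also the output tape), each with a head of its own:
"in state `state`, if the heads read `onOracle`, `onInput` and `onWork`, then write `write` on the
work tape, move the three heads as indicated and go to state `next`". -/
structure Command : Type where
  state : ℕ
  onOracle : Bool
  onInput : Bool
  onWork : Bool
  write : Bool
  moveOracle : Move
  moveInput : Move
  moveWork : Move
  next : ℕ

instance : Encodable Command :=
  Encodable.ofLeftInverse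
    (α := ℕ × Bool × Bool × Bool × Bool × Move × Move × Move × ℕ)
    (fun c => (c.state, c.onOracle, c.onInput, c.onWork, c.write,
      c.moveOracle, c.moveInput, c.moveWork, c.next))
    (fun t => ⟨t.1, t.2.1, t.2.2.1, t.2.2.2.1, t.2.2.2.2.1, t.2.2.2.2.2.1, t.2.2.2.2.2.2.1,
      t.2.2.2.2.2.2.2.1, t.2.2.2.2.2.2.2.2⟩)
    (fun _ => rfl)

/-- A program is a finite list of commands. The first applicable command is executed; the machine
halts when no command is applicable. -/
abbrev Program : Type := List Command

/-- The enumeration `P₀, P₁, …` of all programs. -/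
def program (e : ℕ) : Program := (Encodable.decode e).getD []

/-- A configuration of the machine. Tape cells are indexed by ordinals; a tape content is identified
with the set of the cells that contain a `1`. -/
@[ext]
structure Config : Type 1 where
  state : ℕ
  oracleHead : Ordinal.{0}
  inputHead : Ordinal.{0}
  workHead : Ordinal.{0}
  work : Set Ordinal.{0}

/-- Moving a head: a left move from `0` or from a limit ordinal leads to `0`. -/
noncomputable def Move.apply (m : Move) (α : Ordinal.{0}) : Ordinal.{0} :=
  match m with
  | .left => open Classical in if h : ∃ β, α = β + 1 then h.choose else 0
  | .stay => α
  | .right => α + 1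

/-- `c` is applicable in configuration `C`, for the oracle `o` and the input `i`. -/
def Command.Applies (c : Command) (o i : Set Ordinal.{0}) (C : Config) : Prop :=
  c.state = C.state ∧ (c.onOracle = true ↔ C.oracleHead ∈ o) ∧
    (c.onInput = true ↔ C.inputHead ∈ i) ∧ (c.onWork = true ↔ C.workHead ∈ C.work)

open Classical in
/-- The command of `P` that is to be executed in configuration `C`, if there is one. -/
noncomputable def Program.command (P : Program) (o i : Set Ordinal.{0}) (C : Config) :
    Option Command :=
  P.find? (fun c => decide (c.Applies o i C))

/-- The execution of a single command. -/
noncomputable def Command.exec (c : Command) (C : Config) : Config where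
  state := c.next
  oracleHead := c.moveOracle.apply C.oracleHead
  inputHead := c.moveInput.apply C.inputHead
  workHead := c.moveWork.apply C.workHead
  work := {ξ | if ξ = C.workHead then c.write = true else ξ ∈ C.work}

/-- One step of `P`; a configuration in which the machine has halted does not change any more. -/
noncomputable def Program.step (P : Program) (o i : Set Ordinal.{0}) (C : Config) : Config :=
  match P.command o i C with
  | none => C
  | some c => c.exec C

/-- The inferior limit of `f s` for `s → t` along those `s < t` with `p s`. -/
noncomputable def liminfBelow {β : Type*} [LE β] [SupSet β] (t : Ordinal.{0})
    (p : Ordinal.{0} → Prop) (f : Ordinal.{0} → β) : β :=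
  sSup {b | ∃ r < t, ∀ s, r ≤ s → s < t → p s → b ≤ f s}

/-- The configuration at a limit time `t`, when `C s` is the configuration at time `s < t`: the
state and each cell are the inferior limits of their former values, and the position of each head
is the inferior limit of its former positions at the times at which the machine was in the
state of time `t`. -/
noncomputable def limitConfig (t : Ordinal.{0}) (C : Ordinal.{0} → Config) : Config :=
  let q : ℕ := liminfBelow t (fun _ => True) (fun s => (C s).state)
  { state := q
    oracleHead := liminfBelow t (fun s => (C s).state = q) (fun s => (C s).oracleHead)
    inputHead := liminfBelow t (fun s => (C s).state = q) (fun s => (C s).inputHead)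
    workHead := liminfBelow t (fun s => (C s).state = q) (fun s => (C s).workHead)
    work := {ξ | ∃ r < t, ∀ s, r ≤ s → s < t → ξ ∈ (C s).work} }

/-- The initial configuration: state `0`, all heads on cell `0`, empty work tape. -/
def initConfig : Config := ⟨0, 0, 0, 0, ∅⟩

open Classical in
/-- The configuration of `P` at time `t`, with oracle `o` and input `i`. -/
noncomputable def Program.config (P : Program) (o i : Set Ordinal.{0}) (t : Ordinal.{0}) : Config :=
  Ordinal.limitRecOn (motive := fun _ => Config) t initConfig
    (fun _ C => P.step o i C)
    (fun t _ C => limitConfig t (fun s => if h : s < t then C s h else initConfig))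

/-- `P`, with oracle `o` and input `i`, halts with output `z`. -/
def Program.HaltsWith (P : Program) (o i z : Set Ordinal.{0}) : Prop :=
  ∃ t, P.command o i (P.config o i t) = none ∧ (P.config o i t).work = z

/-- `P`, with oracle `o` and input `i`, halts. -/
def Program.Halts (P : Program) (o i : Set Ordinal.{0}) : Prop :=
  ∃ z, P.HaltsWith o i z

/-! ## Codes of sets -/

/-- The transitive closure of `{x}`. -/
def tcSingleton (x : ZFSet.{0}) : Set ZFSet.{0} :=
  {z | Relation.ReflTransGen (fun u v => u ∈ v) z x}

/-- `x` is hereditarily countable, that is, an element of `H_{ω₁}`. -/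
def IsHC (x : ZFSet.{0}) : Prop := (tcSingleton x).Countable

/-- The set of ordinals `c` codes the set `x`: there are an ordinal `κ` and a bijection `d` of `κ`
with the transitive closure of `{x}`, with `d 0 = x`, such that `c` is the adjacency matrix
of `∈` along `d`. The matrix is a `0`-`1`-string of length `κ * κ`, with the entry for
`d α ∈ d β` at place `κ * β + α`. The entry at place `δ` is stored in cell `2 * δ + 1`, and the cells
`2 * δ` with a `1` mark the places that belong to the string, so that the end of a code
can be recognized. -/
def Codes (c : Set Ordinal.{0}) (x : ZFSet.{0}) : Prop :=
  ∃ (κ : Ordinal.{0}) (d : Ordinal.{0} → ZFSet.{0}),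
    BijOn d (Iio κ) (tcSingleton x) ∧ d 0 = x ∧
    c = {γ | ∃ δ < κ * κ, γ = 2 * δ} ∪
      {γ | ∃ α < κ, ∃ β < κ, d α ∈ d β ∧ γ = 2 * (κ * β + α) + 1}

/-- A finite list of sets of ordinals as a single set of ordinals. Cell `0` tells whether the
list is non-empty; the remaining cells hold alternatingly the head and the (coded) tail. -/
noncomputable def joinTape : List (Set Ordinal.{0}) → Set Ordinal.{0}
  | [] => ∅
  | c :: cs => {0} ∪ {γ | ∃ α ∈ c, γ = 1 + 2 * α} ∪ {γ | ∃ α ∈ joinTape cs, γ = 1 + (2 * α + 1)}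

/-- The possible contents of the input tape: it is empty if there is no input, and otherwise
holds a code of the input. -/
def InputCodes (c : Set Ordinal.{0}) : Option ZFSet.{0} → Prop
  | none => c = ∅
  | some y => Codes c y

/-- `P` is safe: it halts on all sets of ordinals. -/
def Program.Safe (P : Program) : Prop :=
  ∀ o i : Set Ordinal.{0}, BddAbove o → BddAbove i → P.Halts o i

/-- `P` is coding-stable: whether it halts, and which set its output codes, depends only
on the sets that are given to it and not on the codes by which they are given. -/
def Program.CodingStable (P : Program) : Prop :=
  ∀ (a : List ZFSet.{0}) (y : Option ZFSet.{0}) (c₀ c₁ : List (Set Ordinal.{0}))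
    (i₀ i₁ : Set Ordinal.{0}),
    List.Forall₂ Codes c₀ a → List.Forall₂ Codes c₁ a → InputCodes i₀ y → InputCodes i₁ y →
      (P.Halts (joinTape c₀) i₀ ↔ P.Halts (joinTape c₁) i₁) ∧
      ∀ z₀ z₁, P.HaltsWith (joinTape c₀) i₀ z₀ → P.HaltsWith (joinTape c₁) i₁ z₁ →
        ∃ z, Codes z₀ z ∧ Codes z₁ z

/-- `P^{a}(y)` halts and its output codes the set `z`, where the list of sets `a` is given in
the oracle and `y` is the optional input. -/
def Program.Computes (P : Program) (a : List ZFSet.{0}) (y : Option ZFSet.{0}) (z : ZFSet.{0}) :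
    Prop :=
  ∃ (c : List (Set Ordinal.{0})) (i w : Set Ordinal.{0}),
    List.Forall₂ Codes c a ∧ InputCodes i y ∧ P.HaltsWith (joinTape c) i w ∧ Codes w z

/-! ## Formulas and realizers -/

/-- `∈`-formulas with free variables among `v₀, …, vₙ₋₁`; a quantifier in a
formula with `n` free variables binds `vₙ`. -/
inductive Formula : ℕ → Type
  | mem {n : ℕ} (i j : Fin n) : Formula n
  | eq {n : ℕ} (i j : Fin n) : Formula n
  | and {n : ℕ} (φ ψ : Formula n) : Formula n
  | or {n : ℕ} (φ ψ : Formula n) : Formula n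
  | imp {n : ℕ} (φ ψ : Formula n) : Formula n
  | neg {n : ℕ} (φ : Formula n) : Formula n
  | ex {n : ℕ} (φ : Formula (n + 1)) : Formula n
  | all {n : ℕ} (φ : Formula (n + 1)) : Formula n

/-- The von Neumann numeral `n`. -/
def natSet : ℕ → ZFSet.{0}
  | 0 => ∅
  | n + 1 => insert (natSet n) (natSet n)

/-- A real number, that is, a subset of `ω`, as a set. -/
noncomputable def realSet (x : Set ℕ) : ZFSet.{0} := ZFSet.range (fun n : x => natSet n)

/-- A finite list of sets as a set. -/
noncomputable def tupleSet : List ZFSet.{0} → ZFSet.{0}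
  | [] => ∅
  | x :: l => ZFSet.pair x (tupleSet l)

/-- A potential realizer `(P, p⃗)`: (the index of) a program and finitely many real numbers. -/
structure Realizer : Type where
  index : ℕ
  params : List (Set ℕ)

/-- A potential realizer as a set. -/
noncomputable def Realizer.toZFSet (r : Realizer) : ZFSet.{0} :=
  ZFSet.pair (natSet r.index) (tupleSet (r.params.map realSet))

/-- The program of a realizer has to be safe and coding-stable. -/
def Realizer.Admissible (r : Realizer) : Prop :=
  (program r.index).Safe ∧ (program r.index).CodingStable

/-- `P^{p⃗, a⃗, x⃗}(y)` computes `z`, for the realizer `(P, p⃗)`. -/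
def Realizer.Yields (r : Realizer) {n : ℕ} (a : Fin n → ZFSet.{0}) (x : List ZFSet.{0})
    (y : Option ZFSet.{0}) (z : ZFSet.{0}) : Prop :=
  (program r.index).Computes (r.params.map realSet ++ List.ofFn a ++ x) y z

/-- Lebesgue measure on `𝔓(ω)`: the fair coin-tossing measure. -/
noncomputable def lebesgue : Measure (Set ℕ) :=
  ProbabilityTheory.setBernoulli Set.univ ⟨1 / 2, by norm_num, by norm_num⟩

/-- The sets of real numbers that are Lebesgue measurable with measure `1`. -/
def fullSets : Set (Set (Set ℕ)) := {𝒪 | NullMeasurableSet 𝒪 lebesgue ∧ lebesgue 𝒪 = 1}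

/-- The mode "with a random oracle": `Q` holds for the oracle `x`, for all `x` in a set of
measure `1`. -/
def AlmostSurely (Q : List ZFSet.{0} → Prop) : Prop :=
  ∃ 𝒪 ∈ fullSets, ∀ x ∈ 𝒪, Q [realSet x]

/-- The mode "without oracle". -/
def Plainly (Q : List ZFSet.{0} → Prop) : Prop := Q []

/-- `Realizes R φ a r`: `r` realizes `φ(a⃗)`. For `R = AlmostSurely` this is
as-OTM-realizability; for `R = Plainly`, where all mentions of random oracles disappear, it is plain
OTM-realizability. Quantifiers range over `H_{ω₁}`. -/
def Realizes (R : (List ZFSet.{0} → Prop) → Prop) :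
    {n : ℕ} → Formula n → (Fin n → ZFSet.{0}) → Realizer → Prop
  | _, .mem i j, a, r => r.Admissible ∧ a i ∈ a j
  | _, .eq i j, a, r => r.Admissible ∧ a i = a j
  | _, .and φ ψ, a, r => r.Admissible ∧ R fun x =>
      (∃ s : Realizer, r.Yields a x (some (natSet 0)) s.toZFSet ∧ Realizes R φ a s) ∧
      (∃ s : Realizer, r.Yields a x (some (natSet 1)) s.toZFSet ∧ Realizes R ψ a s)
  | _, .or φ ψ, a, r => r.Admissible ∧ R fun x =>
      (r.Yields a x (some (natSet 0)) (natSet 0) ∧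
        ∃ s : Realizer, r.Yields a x (some (natSet 1)) s.toZFSet ∧ Realizes R φ a s) ∨
      (r.Yields a x (some (natSet 0)) (natSet 1) ∧
        ∃ s : Realizer, r.Yields a x (some (natSet 1)) s.toZFSet ∧ Realizes R ψ a s)
  | _, .imp φ ψ, a, r => r.Admissible ∧ ∀ s : Realizer, Realizes R φ a s → R fun x =>
      ∃ s' : Realizer, r.Yields a x (some s.toZFSet) s'.toZFSet ∧ Realizes R ψ a s'
  -- `¬φ` is `φ → (1 = 0)`, and the false atomic statement `1 = 0` has no realizers
  | _, .neg φ, a, r => r.Admissible ∧ ∀ s : Realizer, Realizes R φ a s → R fun x =>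
      ∃ s' : Realizer, r.Yields a x (some s.toZFSet) s'.toZFSet ∧ (s'.Admissible ∧ False)
  | _, .ex φ, a, r => r.Admissible ∧ R fun x =>
      ∃ b : ZFSet.{0}, IsHC b ∧ r.Yields a x (some (natSet 1)) b ∧
        ∃ s : Realizer, r.Yields a x (some (natSet 0)) s.toZFSet ∧
          Realizes R φ (Fin.snoc a b : Fin (_ + 1) → ZFSet.{0}) s
  | _, .all φ, a, r => r.Admissible ∧ ∀ b : ZFSet.{0}, IsHC b → R fun x =>
      ∃ s : Realizer, r.Yields (Fin.snoc a b : Fin (_ + 1) → ZFSet.{0}) x none s.toZFSet ∧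
        Realizes R φ (Fin.snoc a b : Fin (_ + 1) → ZFSet.{0}) s

/-- The `∈`-sentence `φ` is as-OTM-realizable: some program (without parameters) realizes it. -/
def AsRealizable (φ : Formula 0) : Prop := ∃ e : ℕ, Realizes AlmostSurely φ Fin.elim0 ⟨e, []⟩

/-- The `∈`-sentence `φ` is plainly OTM-realizable. -/
def PlainlyRealizable (φ : Formula 0) : Prop := ∃ e : ℕ, Realizes Plainly φ Fin.elim0 ⟨e, []⟩

end OTM

/-!
The separating sentence says: there is a set `y` that is not the output of any program on the empty
oracle and the input `1`.

With a random oracle it is realized by a program that copies its oracle to the output. There are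
only countably many outputs of programs without an oracle (`countable_computationRel`), so a real
number almost surely is not one of them. Without an oracle, a realizer would have to output, on
the input `1`, a set that is not the output of any program on the input `1`, which is absurd. Here
`1` is the input on which a realizer of an existential statement delivers the witness. As the
set `1` has only one code (`eq_of_codes_natSet_one`), this is a single computation.

What needs work is that the property of `y` has to be an `∈`-formula whose realizability, in both
senses, is its truth.

* For formulas without conjunction, disjunction and existential quantifier, both notions of
  realizability coincide with truth in `H_{ω₁}`, because a realizer carries no information
  (`Formula.IsNegative.exists_realizer`). So it suffices to find such a negative formula.
* The formula is `∀ c, ¬ D(y, c)`, where `D` expresses that `c` contains a record of a halting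
  computation of some program, with an output that codes `y` (`ComputationRel`). All quantifiers of
  `D` are bounded, and up to classical equivalence `D` is negative (`delta0_computationRel`). A
  record that satisfies `D` describes an actual computation (`ComputationRel.exists_haltsWith`),
  and each halting computation has a record (`exists_computationRel`).
* Computations may have uncountable length, while the quantifier `∀ c` ranges over `H_{ω₁}`. By
  the Löwenheim–Skolem theorem and the Mostowski collapse, if `y` is hereditarily countable and
  `D(y, c)` holds for any set `c` at all, then `D(y, c')` holds for a hereditarily countable `c'`
  (`Delta0.exists_isHC`). So every hereditarily countable output of a program has a record
  in `H_{ω₁}`.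
-/

namespace OTM

/-! ### Runs of machines -/

/-- The bound `B` on cofinally many values keeps the set of eventual lower bounds bounded, so
that its `sSup` is a proper supremum. -/
theorem lt_liminfBelow_iff {β : Type*} [ConditionallyCompleteLinearOrderBot β] [SuccOrder β]
    [NoMaxOrder β] {t : Ordinal.{0}} {p : Ordinal.{0} → Prop} {f : Ordinal.{0} → β} {B : β}
    (hB : ∀ r < t, ∃ s, r ≤ s ∧ s < t ∧ p s ∧ f s ≤ B) (ξ : β) :
    ξ < liminfBelow t p f ↔ ∃ r < t, ∀ s, r ≤ s → s < t → p s → ξ < f s := by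
  constructor
  · intro h
    obtain ⟨b, ⟨r, hr, H⟩, hb⟩ := exists_lt_of_lt_csSup' h
    exact ⟨r, hr, fun s h1 h2 h3 => hb.trans_le (H s h1 h2 h3)⟩
  · rintro ⟨r, hr, H⟩
    refine (Order.lt_succ ξ).trans_le (le_csSup ⟨B, ?_⟩
      ⟨r, hr, fun s h1 h2 h3 => Order.succ_le_of_lt (H s h1 h2 h3)⟩)
    rintro b ⟨r', hr', H'⟩
    obtain ⟨s, h1, h2, h3, h4⟩ := hB r' hr'
    exact (H' s h1 h2 h3).trans h4

theorem liminfBelow_congr {β : Type*} [LE β] [SupSet β] {t : Ordinal.{0}}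
    {p p' : Ordinal.{0} → Prop} {f f' : Ordinal.{0} → β} (hp : ∀ s < t, (p s ↔ p' s))
    (hf : ∀ s < t, f s = f' s) : liminfBelow t p f = liminfBelow t p' f' := by
  unfold liminfBelow
  congr 1
  ext b
  refine exists_congr fun r => and_congr_right fun _ => forall_congr' fun s => imp_congr_right
    fun _ => forall_congr' fun hs => ?_
  rw [hp s hs, hf s hs]

theorem limitConfig_congr {t : Ordinal.{0}} {C C' : Ordinal.{0} → Config}
    (h : ∀ s < t, C s = C' s) : limitConfig t C = limitConfig t C' := by
  have hq : liminfBelow t (fun _ => True) (fun s => (C s).state) =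
      liminfBelow t (fun _ => True) (fun s => (C' s).state) :=
    liminfBelow_congr (fun _ _ => Iff.rfl) (fun s hs => by rw [h s hs])
  unfold limitConfig
  ext ξ
  · exact hq
  iterate 3
    exact liminfBelow_congr (fun s hs => by rw [h s hs, hq])
      (fun s hs => by rw [h s hs])
  · refine exists_congr fun r => and_congr_right fun _ => forall_congr' fun s => imp_congr_right
      fun _ => forall_congr' fun hs => ?_
    rw [h s hs]

namespace Program

variable (P : Program) (o i : Set Ordinal.{0})

theorem config_zero : P.config o i 0 = initConfig := by
  simp [Program.config]

theorem config_add_one (t : Ordinal.{0}) :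
    P.config o i (t + 1) = P.step o i (P.config o i t) := by
  simp [Program.config]

theorem config_limit {t : Ordinal.{0}} (ht : Order.IsSuccLimit t) :
    P.config o i t = limitConfig t (P.config o i) := by
  have : P.config o i t =
      limitConfig t (fun s => if s < t then P.config o i s else initConfig) := by
    conv_lhs => rw [Program.config, Ordinal.limitRecOn_limit _ _ _ _ ht]
    rfl
  rw [this]
  exact limitConfig_congr fun s hs => if_pos hs

theorem exists_state_le : ∃ N, ∀ o i t, (P.config o i t).state ≤ N := by
  obtain ⟨N, hN⟩ : ∃ N, ∀ c ∈ P, c.next ≤ N :=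
    ⟨(P.map Command.next).sum, fun c hc => List.single_le_sum (by simp) _ (List.mem_map_of_mem hc)⟩
  refine ⟨N, fun o i t => ?_⟩
  induction t using Ordinal.limitRecOn with
  | zero => rw [config_zero]; exact Nat.zero_le _
  | add_one t ih =>
    rw [config_add_one, Program.step]
    split
    · exact ih
    · rename_i c hc
      exact hN c (List.mem_of_find?_eq_some hc)
  | limit t ht ih =>
    rw [config_limit _ _ _ ht]
    refine csSup_le' ?_
    rintro b ⟨r, hr, H⟩
    exact (H r le_rfl hr trivial).trans (ih r hr)

theorem lt_state_limit_iff {t : Ordinal.{0}} (ht : Order.IsSuccLimit t)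
    (b : ℕ) : b < (P.config o i t).state ↔
    ∃ r < t, ∀ s, r ≤ s → s < t → b < (P.config o i s).state := by
  obtain ⟨N, hN⟩ := P.exists_state_le
  rw [config_limit _ _ _ ht]
  refine (lt_liminfBelow_iff (B := N) (fun r hr => ⟨r, le_rfl, hr, trivial, hN _ _ _⟩) b).trans ?_
  simp

/-- The state of a limit time is attained cofinally often, since there are finitely many states. -/
theorem exists_state_eq_limit {t : Ordinal.{0}} (ht : Order.IsSuccLimit t)
    {r : Ordinal.{0}} (hr : r < t) :
    ∃ s, r ≤ s ∧ s < t ∧ (P.config o i s).state = (P.config o i t).state := by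
  have h1 := (P.lt_state_limit_iff o i ht (P.config o i t).state).not.1 (lt_irrefl _)
  push Not at h1
  obtain ⟨r', hr', H⟩ : ∃ r' < t, ∀ s, r' ≤ s → s < t →
      (P.config o i t).state ≤ (P.config o i s).state := by
    rcases Nat.eq_zero_or_pos (P.config o i t).state with h0 | h0
    · exact ⟨r, hr, fun s _ _ => by rw [h0]; exact Nat.zero_le _⟩
    · obtain ⟨r', hr', H⟩ := (P.lt_state_limit_iff o i ht ((P.config o i t).state - 1)).1 (by omega)
      exact ⟨r', hr', fun s h1 h2 => by have := H s h1 h2; omega⟩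
  obtain ⟨s, h2, h3, h4⟩ := h1 (max r r') (max_lt hr hr')
  exact ⟨s, (le_max_left _ _).trans h2, h3, h4.antisymm (H s ((le_max_right _ _).trans h2) h3)⟩

theorem lt_head_limit_iff {t : Ordinal.{0}} (ht : Order.IsSuccLimit t)
    (head : Config → Ordinal.{0})
    (h : head (P.config o i t) = liminfBelow t
      (fun s => (P.config o i s).state = (P.config o i t).state) (fun s => head (P.config o i s)))
    (ξ : Ordinal.{0}) : ξ < head (P.config o i t) ↔ ∃ r < t, ∀ s, r ≤ s → s < t →
      (P.config o i s).state = (P.config o i t).state → ξ < head (P.config o i s) := by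
  have hbdd : BddAbove ((fun s => head (P.config o i s)) '' Iio t) :=
    Ordinal.bddAbove_of_small
  obtain ⟨B, hB⟩ := hbdd
  rw [h]
  refine lt_liminfBelow_iff (B := B) (fun r hr => ?_) ξ
  obtain ⟨s, h1, h2, h3⟩ := P.exists_state_eq_limit o i ht hr
  exact ⟨s, h1, h2, h3, hB ⟨s, h2, rfl⟩⟩

theorem lt_oracleHead_limit_iff {t : Ordinal.{0}} (ht : Order.IsSuccLimit t)
    (ξ : Ordinal.{0}) :
    ξ < (P.config o i t).oracleHead ↔ ∃ r < t, ∀ s, r ≤ s → s < t →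
      (P.config o i s).state = (P.config o i t).state → ξ < (P.config o i s).oracleHead :=
  P.lt_head_limit_iff o i ht Config.oracleHead (by conv_lhs => rw [config_limit _ _ _ ht]
                                                   simp only [config_limit _ _ _ ht]; rfl) ξ

theorem lt_inputHead_limit_iff {t : Ordinal.{0}} (ht : Order.IsSuccLimit t)
    (ξ : Ordinal.{0}) :
    ξ < (P.config o i t).inputHead ↔ ∃ r < t, ∀ s, r ≤ s → s < t →
      (P.config o i s).state = (P.config o i t).state → ξ < (P.config o i s).inputHead :=
  P.lt_head_limit_iff o i ht Config.inputHead (by conv_lhs => rw [config_limit _ _ _ ht]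
                                                  simp only [config_limit _ _ _ ht]; rfl) ξ

theorem lt_workHead_limit_iff {t : Ordinal.{0}} (ht : Order.IsSuccLimit t)
    (ξ : Ordinal.{0}) :
    ξ < (P.config o i t).workHead ↔ ∃ r < t, ∀ s, r ≤ s → s < t →
      (P.config o i s).state = (P.config o i t).state → ξ < (P.config o i s).workHead :=
  P.lt_head_limit_iff o i ht Config.workHead (by conv_lhs => rw [config_limit _ _ _ ht]
                                                 simp only [config_limit _ _ _ ht]; rfl) ξ

theorem mem_work_limit_iff {t : Ordinal.{0}} (ht : Order.IsSuccLimit t)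
    (ξ : Ordinal.{0}) : ξ ∈ (P.config o i t).work ↔
    ∃ r < t, ∀ s, r ≤ s → s < t → ξ ∈ (P.config o i s).work := by
  rw [config_limit _ _ _ ht]; rfl

/-- The configuration at a limit time is determined by its comparisons with ordinals. -/
theorem config_limit_eq {t : Ordinal.{0}} (ht : Order.IsSuccLimit t)
    {K : Config}
    (hstate : ∀ b, b < K.state ↔ ∃ r < t, ∀ s, r ≤ s → s < t → b < (P.config o i s).state)
    (horacle : ∀ ξ, ξ < K.oracleHead ↔ ∃ r < t, ∀ s, r ≤ s → s < t →
      (P.config o i s).state = K.state → ξ < (P.config o i s).oracleHead)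
    (hinput : ∀ ξ, ξ < K.inputHead ↔ ∃ r < t, ∀ s, r ≤ s → s < t →
      (P.config o i s).state = K.state → ξ < (P.config o i s).inputHead)
    (hworkHead : ∀ ξ, ξ < K.workHead ↔ ∃ r < t, ∀ s, r ≤ s → s < t →
      (P.config o i s).state = K.state → ξ < (P.config o i s).workHead)
    (hwork : ∀ ξ, ξ ∈ K.work ↔ ∃ r < t, ∀ s, r ≤ s → s < t → ξ ∈ (P.config o i s).work) :
    P.config o i t = K := by
  have hq : (P.config o i t).state = K.state :=
    eq_of_forall_lt_iff fun b => (P.lt_state_limit_iff o i ht b).trans (hstate b).symm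
  ext ξ
  · exact hq
  · exact eq_of_forall_lt_iff fun ξ =>
      (P.lt_oracleHead_limit_iff o i ht ξ).trans (by rw [horacle, hq])
  · exact eq_of_forall_lt_iff fun ξ =>
      (P.lt_inputHead_limit_iff o i ht ξ).trans (by rw [hinput, hq])
  · exact eq_of_forall_lt_iff fun ξ =>
      (P.lt_workHead_limit_iff o i ht ξ).trans (by rw [hworkHead, hq])
  · rw [hwork, P.mem_work_limit_iff o i ht]

theorem config_eq_of_command_eq_none {t : Ordinal.{0}}
    (h : P.command o i (P.config o i t) = none) {s : Ordinal.{0}} (hs : t ≤ s) :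
    P.config o i s = P.config o i t := by
  induction s using Ordinal.limitRecOn with
  | zero => rw [nonpos_iff_eq_zero.1 hs]
  | add_one s ih =>
    rcases hs.lt_or_eq with hlt | rfl
    · rw [config_add_one, ih (Order.lt_add_one_iff.1 hlt), Program.step, h]
    · rfl
  | limit s hs' ih =>
    rcases hs.lt_or_eq with hlt | rfl
    · have key : ∀ (p : Config → Prop), p (P.config o i t) ↔
          ∃ r < s, ∀ u, r ≤ u → u < s → p (P.config o i u) := by
        intro p
        constructor
        · exact fun hp => ⟨t, hlt, fun u h1 h2 => by rwa [ih u h2 h1]⟩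
        · rintro ⟨r, hr, H⟩
          have := H _ (le_max_right t r) (max_lt hlt hr)
          rwa [ih _ (max_lt hlt hr) (le_max_left _ _)] at this
      have key' : ∀ (p : Config → Prop), p (P.config o i t) ↔
          ∃ r < s, ∀ u, r ≤ u → u < s → (P.config o i u).state = (P.config o i t).state →
            p (P.config o i u) := by
        intro p
        rw [← key fun C => C.state = (P.config o i t).state → p C]
        simp
      exact P.config_limit_eq o i hs' (fun b => key (b < ·.state))
        (fun ξ => key' (ξ < ·.oracleHead)) (fun ξ => key' (ξ < ·.inputHead))
        (fun ξ => key' (ξ < ·.workHead))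
        (fun ξ => key (ξ ∈ ·.work))
    · rfl

variable {P o i}

theorem HaltsWith.unique {z z' : Set Ordinal.{0}} (h : P.HaltsWith o i z)
    (h' : P.HaltsWith o i z') : z = z' := by
  obtain ⟨t, ht, rfl⟩ := h
  obtain ⟨t', ht', rfl⟩ := h'
  rcases le_total t t' with hle | hle
  · rw [P.config_eq_of_command_eq_none o i ht hle]
  · rw [P.config_eq_of_command_eq_none o i ht' hle]

end Program

/-! ### Programs given by transition tables -/

/-- What a machine does in a step: the bit written, the motions of the oracle head, the input head
and the work head, and the next state. -/
abbrev Action : Type := Bool × Move × Move × Move × ℕ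

/-- The program with states below `n` that follows the transition table `δ`, which takes the state
and the bits read on the oracle, input and work tape. -/
def ofTable (n : ℕ) (δ : ℕ → Bool → Bool → Bool → Option Action) : Program :=
  (List.range n).flatMap fun q => [false, true].flatMap fun a => [false, true].flatMap fun b =>
    [false, true].flatMap fun c => ((δ q a b c).map fun r =>
      (⟨q, a, b, c, r.1, r.2.1, r.2.2.1, r.2.2.2.1, r.2.2.2.2⟩ : Command)).toList

theorem mem_ofTable {n : ℕ} {δ : ℕ → Bool → Bool → Bool → Option Action} {c : Command} :
    c ∈ ofTable n δ ↔ c.state < n ∧ δ c.state c.onOracle c.onInput c.onWork =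
      some (c.write, c.moveOracle, c.moveInput, c.moveWork, c.next) := by
  obtain ⟨q, a, b, d, w, m₁, m₂, m₃, q'⟩ := c
  simp only [ofTable, List.mem_flatMap, List.mem_range, Option.mem_toList, Option.map_eq_some_iff,
    Command.mk.injEq]
  constructor
  · rintro ⟨q₀, h, a₀, -, b₀, -, d₀, -, ⟨w₀, m₁', m₂', m₃', q₁⟩, h', rfl, rfl, rfl, rfl, rfl, rfl,
      rfl, rfl, rfl⟩
    exact ⟨h, h'⟩
  · rintro ⟨h, h'⟩
    refine ⟨q, h, a, ?_, b, ?_, d, ?_, _, h', rfl, rfl, rfl, rfl, rfl, rfl, rfl, rfl, rfl⟩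
    · cases a <;> simp
    · cases b <;> simp
    · cases d <;> simp

open Classical in
theorem command_ofTable_eq_some {n : ℕ} {δ : ℕ → Bool → Bool → Bool → Option Action}
    {o i : Set Ordinal.{0}} {C : Config} {c : Command} :
    (ofTable n δ).command o i C = some c ↔ c ∈ ofTable n δ ∧ c.Applies o i C := by
  constructor
  · intro h
    exact ⟨List.mem_of_find?_eq_some h, by simpa using List.find?_some h⟩
  · rintro ⟨hc, hc'⟩
    obtain ⟨d, hd⟩ : ∃ d, (ofTable n δ).command o i C = some d :=
      Option.isSome_iff_exists.1 (List.find?_isSome.2 ⟨c, hc, by simpa using hc'⟩)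
    have hd1 := List.mem_of_find?_eq_some hd
    have hd2 : d.Applies o i C := by simpa using List.find?_some hd
    rw [hd]
    obtain ⟨q, a, b, e, w, m₁, m₂, m₃, q'⟩ := c
    obtain ⟨q₀, a₀, b₀, e₀, w₀, m₁', m₂', m₃', q₀'⟩ := d
    rw [mem_ofTable] at hc hd1
    obtain ⟨h1, h2, h3, h4⟩ := hc'
    obtain ⟨g1, g2, g3, g4⟩ := hd2
    dsimp only at *
    obtain rfl : q = q₀ := h1.trans g1.symm
    obtain rfl : a = a₀ := Bool.eq_iff_iff.2 (h2.trans g2.symm)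
    obtain rfl : b = b₀ := Bool.eq_iff_iff.2 (h3.trans g3.symm)
    obtain rfl : e = e₀ := Bool.eq_iff_iff.2 (h4.trans g4.symm)
    have := hd1.2.symm.trans hc.2
    simp only [Option.some.injEq, Prod.mk.injEq] at this
    obtain ⟨rfl, rfl, rfl, rfl, rfl⟩ := this
    rfl

open Classical in
theorem command_ofTable_eq_none {n : ℕ} {δ : ℕ → Bool → Bool → Bool → Option Action}
    {o i : Set Ordinal.{0}} {C : Config}
    (h : C.state < n → δ C.state (decide (C.oracleHead ∈ o)) (decide (C.inputHead ∈ i))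
      (decide (C.workHead ∈ C.work)) = none) :
    (ofTable n δ).command o i C = none := by
  rw [Option.eq_none_iff_forall_ne_some]
  intro c hc
  obtain ⟨h1, h2, h3, h4, h5⟩ := command_ofTable_eq_some.1 hc
  obtain ⟨h6, h7⟩ := mem_ofTable.1 h1
  rw [h2] at h6 h7
  have e1 : c.onOracle = decide (C.oracleHead ∈ o) := Bool.eq_iff_iff.2 (by simpa using h3)
  have e2 : c.onInput = decide (C.inputHead ∈ i) := Bool.eq_iff_iff.2 (by simpa using h4)
  have e3 : c.onWork = decide (C.workHead ∈ C.work) := Bool.eq_iff_iff.2 (by simpa using h5)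
  rw [e1, e2, e3, h h6] at h7
  cases h7

open Classical in
theorem step_ofTable {n : ℕ} {δ : ℕ → Bool → Bool → Bool → Option Action}
    {o i : Set Ordinal.{0}} {C : Config} {w : Bool} {m₁ m₂ m₃ : Move} {q : ℕ} (hn : C.state < n)
    (h : δ C.state (decide (C.oracleHead ∈ o)) (decide (C.inputHead ∈ i))
      (decide (C.workHead ∈ C.work)) = some (w, m₁, m₂, m₃, q)) :
    (ofTable n δ).step o i C = ⟨q, m₁.apply C.oracleHead, m₂.apply C.inputHead,
      m₃.apply C.workHead, {ξ | if ξ = C.workHead then w = true else ξ ∈ C.work}⟩ := by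
  have : (ofTable n δ).command o i C = some ⟨C.state, decide (C.oracleHead ∈ o),
      decide (C.inputHead ∈ i), decide (C.workHead ∈ C.work), w, m₁, m₂, m₃, q⟩ :=
    command_ofTable_eq_some.2 ⟨mem_ofTable.2 ⟨hn, h⟩, rfl, by simp, by simp, by simp⟩
  rw [Program.step, this]
  rfl

/-- The tape that starts with the bits in `L` and is empty afterwards. -/
def finiteTape (L : List Bool) : Set Ordinal.{0} := {ξ | ∃ k : ℕ, L[k]? = some true ∧ ξ = k}

theorem exists_finiteTape_eq {c : Set Ordinal.{0}} {N : ℕ} (hc : ∀ ξ ∈ c, ξ < N) :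
    ∃ L, finiteTape L = c := by
  classical
  refine ⟨(List.range N).map fun k : ℕ => decide ((k : Ordinal.{0}) ∈ c), ?_⟩
  ext ξ
  simp only [finiteTape, mem_ofPred_eq, List.getElem?_map, Option.map_eq_some_iff,
    decide_eq_true_eq]
  constructor
  · rintro ⟨k, ⟨a, h, h'⟩, rfl⟩
    rw [List.getElem?_eq_some_iff] at h
    obtain ⟨h1, h2⟩ := h
    simp at h2
    rwa [h2]
  · intro h
    obtain ⟨k, rfl⟩ := Ordinal.lt_omega0.1 ((hc ξ h).trans (Ordinal.natCast_lt_omega0 N))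
    refine ⟨k, ⟨k, ?_, h⟩, rfl⟩
    have := hc _ h
    rw [List.getElem?_range (by exact_mod_cast this)]

theorem config_write {n : ℕ} {δ : ℕ → Bool → Bool → Bool → Option Action}
    {o i : Set Ordinal.{0}} {L : List Bool} {q : ℕ} (hn : q + L.length ≤ n)
    (hδ : ∀ j a b c, ∀ w ∈ L[j]?, δ (q + j) a b c = some (w, .stay, .stay, .right, q + j + 1))
    {t a b : Ordinal.{0}} (h : (ofTable n δ).config o i t = ⟨q, a, b, 0, ∅⟩) {j : ℕ}
    (hj : j ≤ L.length) :
    (ofTable n δ).config o i (t + j) = ⟨q + j, a, b, j, finiteTape (L.take j)⟩ := by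
  induction j with
  | zero => simp [h, finiteTape]
  | succ j ih =>
    have hj' : j < L.length := hj
    rw [Nat.cast_succ, ← add_assoc, Program.config_add_one, ih hj'.le,
      step_ofTable (by dsimp only; omega) (hδ j _ _ _ L[j] (by simp))]
    ext ξ
    · rfl
    · rfl
    · rfl
    · rfl
    · simp only [finiteTape, mem_ofPred_eq, List.getElem?_take]
      split_ifs with hξ
      · subst hξ
        constructor
        · intro hw
          exact ⟨j, by simp [List.getElem?_eq_getElem hj', hw], rfl⟩
        · rintro ⟨k, hk, hjk⟩
          obtain rfl : j = k := by exact_mod_cast hjk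
          simpa [List.getElem?_eq_getElem hj'] using hk
      · refine exists_congr fun k => ?_
        constructor
        · rintro ⟨h1, rfl⟩
          split_ifs at h1 with h2
          exact ⟨by rw [if_pos (by omega), h1], rfl⟩
        · rintro ⟨h1, rfl⟩
          split_ifs at h1 with h2
          have : k ≠ j := fun hh => hξ (by rw [hh])
          exact ⟨by rw [if_pos (by omega), h1], rfl⟩

theorem haltsWith_write {n : ℕ} {δ : ℕ → Bool → Bool → Bool → Option Action}
    {o i : Set Ordinal.{0}} {L : List Bool} {q : ℕ} (hn : q + L.length = n)
    (hδ : ∀ j a b c, ∀ w ∈ L[j]?, δ (q + j) a b c = some (w, .stay, .stay, .right, q + j + 1))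
    {t a b : Ordinal.{0}} (h : (ofTable n δ).config o i t = ⟨q, a, b, 0, ∅⟩) :
    (ofTable n δ).HaltsWith o i (finiteTape L) := by
  have := config_write hn.le hδ h le_rfl
  refine ⟨_, ?_, by rw [this]; simp⟩
  rw [this]
  exact command_ofTable_eq_none fun h => absurd h (by dsimp only; omega)

/-- The program that writes the bits in `L` and halts. -/
def writeProgram (L : List Bool) : Program :=
  ofTable L.length fun q _ _ _ => L[q]?.map fun w => (w, .stay, .stay, .right, q + 1)

theorem haltsWith_writeProgram (L : List Bool) (o i : Set Ordinal.{0}) :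
    (writeProgram L).HaltsWith o i (finiteTape L) := by
  refine haltsWith_write (q := 0) (t := 0) (a := 0) (b := 0) (by simp) ?_ ?_
  · intro j _ _ _ w hw
    rw [Nat.zero_add, Option.mem_def.1 hw]
    rfl
  · rw [Program.config_zero]; rfl

theorem exists_program_eq (P : Program) : ∃ e, program e = P :=
  ⟨Encodable.encode P, by simp [program]⟩

/-! ### Codes of sets -/

theorem self_mem_tcSingleton (x : ZFSet.{0}) : x ∈ tcSingleton x := Relation.ReflTransGen.refl

theorem mem_tcSingleton_of_mem {x y z : ZFSet.{0}} (h : y ∈ tcSingleton x) (hz : z ∈ y) :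
    z ∈ tcSingleton x := Relation.ReflTransGen.head hz h

theorem tcSingleton_subset {x y : ZFSet.{0}} (h : y ∈ tcSingleton x) :
    tcSingleton y ⊆ tcSingleton x := fun _ hz => Relation.ReflTransGen.trans hz h

theorem tcSingleton_eq (x : ZFSet.{0}) :
    tcSingleton x = insert x (⋃ z : {z // z ∈ x}, tcSingleton z.1) := by
  ext z
  simp only [mem_insert_iff, mem_iUnion, Subtype.exists, exists_prop]
  constructor
  · intro h
    rcases Relation.ReflTransGen.cases_tail h with h | ⟨y, h1, h2⟩
    · exact Or.inl h.symm
    · exact Or.inr ⟨y, h2, h1⟩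
  · rintro (rfl | ⟨y, h1, h2⟩)
    · exact self_mem_tcSingleton _
    · exact Relation.ReflTransGen.tail h2 h1

theorem rank_le_of_mem_tcSingleton {x z : ZFSet.{0}} (h : z ∈ tcSingleton x) :
    z.rank ≤ x.rank := by
  induction h with
  | refl => exact le_rfl
  | tail _ h ih => exact ih.trans (ZFSet.rank_lt_of_mem h).le

instance small_tcSingleton (x : ZFSet.{0}) : Small.{0} (tcSingleton x) := by
  have hsub : ∀ z ∈ tcSingleton x, z ∈ ZFSet.vonNeumann (x.rank + 1) :=
    fun z hz => ZFSet.mem_vonNeumann.2 (Order.lt_add_one_iff.2 (rank_le_of_mem_tcSingleton hz))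
  refine small_of_injective (β := {z // z ∈ ZFSet.vonNeumann (x.rank + 1)})
    (f := fun z : tcSingleton x => ⟨z.1, hsub z.1 z.2⟩) fun a b h => ?_
  exact Subtype.ext (congrArg (fun u => u.1) h)

/-- The tape that holds the adjacency matrix of the relation `r` on the ordinals below `κ`. -/
def codeTape (κ : Ordinal.{0}) (r : Ordinal.{0} → Ordinal.{0} → Prop) : Set Ordinal.{0} :=
  {γ | ∃ δ < κ * κ, γ = 2 * δ} ∪
    {γ | ∃ α < κ, ∃ β < κ, r α β ∧ γ = 2 * (κ * β + α) + 1}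

theorem two_mul_ne_two_mul_add_one (a b : Ordinal.{0}) : 2 * a ≠ 2 * b + 1 := by
  intro h
  have := congrArg (· % 2) h
  simp only [Ordinal.mul_add_mod_self, Ordinal.mul_mod] at this
  rw [Ordinal.mod_eq_of_lt (by norm_num)] at this
  exact zero_ne_one this

theorem two_mul_inj {a b : Ordinal.{0}} : (2 : Ordinal.{0}) * a = 2 * b ↔ a = b :=
  (Ordinal.isNormal_mul_right two_pos).strictMono.injective.eq_iff

theorem two_mul_lt {a b : Ordinal.{0}} : (2 : Ordinal.{0}) * a < 2 * b ↔ a < b :=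
  (Ordinal.isNormal_mul_right two_pos).strictMono.lt_iff_lt

theorem two_mul_add_one_lt {a b : Ordinal.{0}} : (2 : Ordinal.{0}) * a + 1 < 2 * b ↔ a < b := by
  constructor
  · intro h
    exact two_mul_lt.1 ((lt_add_one _).trans h)
  · intro h
    have : (2 : Ordinal.{0}) * (a + 1) ≤ 2 * b := mul_le_mul_right (Order.add_one_le_of_lt h) 2
    refine lt_of_lt_of_le ?_ this
    rw [mul_add, mul_one, ← one_add_one_eq_two, ← add_assoc]
    exact lt_add_one _

theorem two_mul_add_one_inj {a b : Ordinal.{0}} :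
    (2 : Ordinal.{0}) * a + 1 = 2 * b + 1 ↔ a = b := by
  rw [← Order.succ_eq_add_one, ← Order.succ_eq_add_one, Order.succ_injective.eq_iff, two_mul_inj]

theorem matrix_place_inj {κ α α' β β' : Ordinal.{0}} (hα : α < κ) (hα' : α' < κ) :
    κ * β + α = κ * β' + α' ↔ β = β' ∧ α = α' := by
  constructor
  · intro h
    have hκ : κ ≠ 0 := (bot_le.trans_lt hα).ne'
    have h1 := congrArg (· / κ) h
    have h2 := congrArg (· % κ) h
    simp only [Ordinal.mul_add_div _ hκ, Ordinal.mul_add_mod_self, Ordinal.div_eq_zero_of_lt hα,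
      Ordinal.div_eq_zero_of_lt hα', Ordinal.mod_eq_of_lt hα, Ordinal.mod_eq_of_lt hα',
      add_zero] at h1 h2
    exact ⟨h1, h2⟩
  · rintro ⟨rfl, rfl⟩; rfl

theorem matrix_place_lt {κ α β : Ordinal.{0}} (hα : α < κ) (hβ : β < κ) : κ * β + α < κ * κ :=
  Ordinal.lt_mul_iff.2 ⟨β, hβ, α, hα, rfl⟩

theorem two_mul_mem_codeTape {κ δ : Ordinal.{0}} {r : Ordinal.{0} → Ordinal.{0} → Prop} :
    2 * δ ∈ codeTape κ r ↔ δ < κ * κ := by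
  simp only [codeTape, mem_union, mem_ofPred_eq, two_mul_inj, two_mul_ne_two_mul_add_one, and_false,
    exists_false, or_false]
  simp

theorem two_mul_add_one_mem_codeTape {κ α β : Ordinal.{0}}
    {r : Ordinal.{0} → Ordinal.{0} → Prop} (hα : α < κ) (hβ : β < κ) :
    2 * (κ * β + α) + 1 ∈ codeTape κ r ↔ r α β := by
  simp only [codeTape, mem_union, mem_ofPred_eq, two_mul_add_one_inj,
    (two_mul_ne_two_mul_add_one _ _).symm, and_false, exists_false, false_or]
  constructor
  · rintro ⟨α', h1, β', h2, h3, h4⟩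
    obtain ⟨rfl, rfl⟩ := (matrix_place_inj hα h1).1 h4
    exact h3
  · exact fun h => ⟨α, hα, β, hβ, h, rfl⟩

theorem lt_of_mem_codeTape {κ ξ : Ordinal.{0}} {r : Ordinal.{0} → Ordinal.{0} → Prop}
    (h : ξ ∈ codeTape κ r) : ξ < 2 * (κ * κ) := by
  rcases h with ⟨δ, hδ, rfl⟩ | ⟨α, hα, β, hβ, -, rfl⟩
  · exact two_mul_lt.2 hδ
  · exact two_mul_add_one_lt.2 (matrix_place_lt hα hβ)

/-- A weakening of `Codes`: the enumeration `d` need not be injective and its range may be any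
transitive set. Such a code still determines the coded set. -/
def WeaklyCodes (c : Set Ordinal.{0}) (x : ZFSet.{0}) : Prop :=
  ∃ (κ : Ordinal.{0}) (d : Ordinal.{0} → ZFSet.{0}), 0 < κ ∧
    (∀ β < κ, ∀ z ∈ d β, ∃ α < κ, d α = z) ∧ d 0 = x ∧ c = codeTape κ (fun α β => d α ∈ d β)

theorem pos_of_bijOn_tcSingleton {κ : Ordinal.{0}} {d : Ordinal.{0} → ZFSet.{0}} {x : ZFSet.{0}}
    (h : BijOn d (Iio κ) (tcSingleton x)) : 0 < κ := by
  obtain ⟨α, hα, -⟩ := h.surjOn (self_mem_tcSingleton x)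
  exact bot_le.trans_lt hα

theorem WeaklyCodes.unique {c : Set Ordinal.{0}} {x y : ZFSet.{0}} (hx : WeaklyCodes c x)
    (hy : WeaklyCodes c y) : x = y := by
  obtain ⟨κ, d, hκ, hd, rfl, rfl⟩ := hx
  obtain ⟨κ', d', hκ', hd', rfl, hc⟩ := hy
  have hκκ : κ * κ = κ' * κ' := eq_of_forall_lt_iff fun δ => by
    rw [← two_mul_mem_codeTape (r := fun α β => d α ∈ d β), hc, two_mul_mem_codeTape]
  obtain rfl : κ = κ' := by
    rcases lt_trichotomy κ κ' with h | h | h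
    · exact absurd hκκ (mul_lt_mul'' h h bot_le bot_le).ne
    · exact h
    · exact absurd hκκ (mul_lt_mul'' h h bot_le bot_le).ne'
  have hr : ∀ α < κ, ∀ β < κ, (d α ∈ d β ↔ d' α ∈ d' β) := fun α hα β hβ => by
    rw [← two_mul_add_one_mem_codeTape (r := fun α β => d α ∈ d β) hα hβ, hc,
      two_mul_add_one_mem_codeTape hα hβ]
  have key : ∀ u : ZFSet.{0}, ∀ α < κ, d α = u → d' α = u := by
    intro u
    induction u using ZFSet.inductionOn with
    | _ u ih =>
      rintro α hα rfl
      ext z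
      constructor
      · intro hz
        obtain ⟨β, hβ, rfl⟩ := hd' α hα z hz
        have hβα := (hr β hβ α hα).2 hz
        rwa [ih _ hβα β hβ rfl]
      · intro hz
        obtain ⟨β, hβ, rfl⟩ := hd α hα z hz
        rw [← ih _ hz β hβ rfl]
        exact (hr β hβ α hα).1 hz
  exact (key _ 0 hκ rfl).symm

theorem exists_bijOn_tcSingleton (x : ZFSet.{0}) :
    ∃ (κ : Ordinal.{0}) (d : Ordinal.{0} → ZFSet.{0}), BijOn d (Iio κ) (tcSingleton x) ∧ d 0 = x ∧
      ((tcSingleton x).Finite → κ < Ordinal.omega0) := by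
  classical
  let κ : Ordinal.{0} := (Cardinal.mk (Shrink.{0} (tcSingleton x))).ord
  obtain ⟨f⟩ : Nonempty (κ.ToType ≃ Shrink.{0} (tcSingleton x)) :=
    Cardinal.eq.1 (by rw [Cardinal.mk_toType, Cardinal.card_ord])
  let g : Iio κ ≃ tcSingleton x :=
    Ordinal.ToType.mk.toEquiv.trans (f.trans (equivShrink.{0} (tcSingleton x)).symm)
  let α₀ : Iio κ := g.symm ⟨x, self_mem_tcSingleton x⟩
  have h0 : 0 < κ := bot_le.trans_lt (mem_Iio.1 α₀.2)
  let g' : Iio κ ≃ tcSingleton x := (Equiv.swap ⟨0, h0⟩ α₀).trans g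
  refine ⟨κ, fun α => if h : α < κ then (g' ⟨α, h⟩).1 else ∅, ⟨?_, ?_, ?_⟩, ?_, ?_⟩
  · intro α hα
    simp only [mem_Iio.1 hα, dif_pos]
    exact (g' _).2
  · intro α hα β hβ h
    simp only [mem_Iio.1 hα, mem_Iio.1 hβ, dif_pos] at h
    exact congrArg Subtype.val (g'.injective (Subtype.ext h))
  · intro z hz
    refine ⟨(g'.symm ⟨z, hz⟩).1, (g'.symm ⟨z, hz⟩).2, ?_⟩
    have := (g'.symm ⟨z, hz⟩).2
    simp only [mem_Iio.1 this, dif_pos]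
    exact congrArg Subtype.val (g'.apply_symm_apply ⟨z, hz⟩)
  · simp [h0, g', α₀]
  · intro hfin
    have : Finite (Shrink.{0} (tcSingleton x)) :=
      haveI := hfin.to_subtype
      Finite.of_equiv _ (equivShrink.{0} (tcSingleton x))
    exact Cardinal.ord_lt_omega0.2 (Cardinal.lt_aleph0_of_finite _)

theorem exists_codes (x : ZFSet.{0}) : ∃ c, Codes c x := by
  obtain ⟨κ, d, h1, h2, -⟩ := exists_bijOn_tcSingleton x
  exact ⟨_, κ, d, h1, h2, rfl⟩

/-- A hereditarily finite set has a code that a machine can write in finitely many steps. -/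
theorem exists_finiteTape_codes {x : ZFSet.{0}} (h : (tcSingleton x).Finite) :
    ∃ L, Codes (finiteTape L) x := by
  obtain ⟨κ, d, h1, h2, h3⟩ := exists_bijOn_tcSingleton x
  obtain ⟨k, rfl⟩ := Ordinal.lt_omega0.1 (h3 h)
  obtain ⟨L, hL⟩ := exists_finiteTape_eq (c := codeTape k fun α β => d α ∈ d β) (N := 2 * (k * k))
    (fun ξ hξ => by push_cast; exact lt_of_mem_codeTape hξ)
  exact ⟨L, k, d, h1, h2, hL⟩

theorem tcSingleton_finite_of_forall {x : ZFSet.{0}} (hx : (x : Set ZFSet.{0}).Finite)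
    (h : ∀ z ∈ x, (tcSingleton z).Finite) : (tcSingleton x).Finite := by
  rw [tcSingleton_eq]
  have : Finite {z // z ∈ x} := hx
  exact (finite_iUnion fun z : {z // z ∈ x} => h z.1 z.2).insert x

theorem tcSingleton_empty : tcSingleton ∅ = {∅} := by
  rw [tcSingleton_eq]
  ext
  simp

theorem tcSingleton_insert_finite {x y : ZFSet.{0}} (hx : (tcSingleton x).Finite)
    (hy : (tcSingleton y).Finite) : (tcSingleton (insert x y)).Finite := by
  refine tcSingleton_finite_of_forall ?_ ?_
  · have hy' : (y : Set ZFSet.{0}) ⊆ tcSingleton y := fun z hz =>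
      mem_tcSingleton_of_mem (self_mem_tcSingleton y) hz
    refine ((hy.subset hy').insert x).subset ?_
    intro z hz
    simpa using hz
  · intro z hz
    rcases ZFSet.mem_insert_iff.1 hz with rfl | hz
    · exact hx
    · exact hy.subset (tcSingleton_subset (mem_tcSingleton_of_mem (self_mem_tcSingleton y) hz))

theorem tcSingleton_natSet_finite (n : ℕ) : (tcSingleton (natSet n)).Finite := by
  induction n with
  | zero => rw [natSet, tcSingleton_empty]; exact finite_singleton _
  | succ n ih => exact tcSingleton_insert_finite ih ih

theorem tcSingleton_pair_finite {x y : ZFSet.{0}} (hx : (tcSingleton x).Finite)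
    (hy : (tcSingleton y).Finite) : (tcSingleton (ZFSet.pair x y)).Finite := by
  have he := tcSingleton_natSet_finite 0
  have hs : ∀ {u : ZFSet.{0}}, (tcSingleton u).Finite → (tcSingleton {u}).Finite := fun {u} hu => by
    rw [← LawfulSingleton.insert_empty_eq]
    exact tcSingleton_insert_finite hu he
  exact tcSingleton_insert_finite (hs hx) (hs (tcSingleton_insert_finite hx (hs hy)))

theorem tcSingleton_realizer_finite (e : ℕ) :
    (tcSingleton (Realizer.toZFSet ⟨e, []⟩)).Finite :=
  tcSingleton_pair_finite (tcSingleton_natSet_finite e) (tcSingleton_natSet_finite 0)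

theorem Codes.exists_length {c : Set Ordinal.{0}} {x : ZFSet.{0}} (h : Codes c x) :
    ∃ μ > 0, (∀ δ, 2 * δ ∈ c ↔ δ < μ) ∧ ∀ ξ ∈ c, ξ < 2 * μ := by
  obtain ⟨κ, d, hd, h0, rfl⟩ := h
  exact ⟨κ * κ, mul_pos (pos_of_bijOn_tcSingleton hd) (pos_of_bijOn_tcSingleton hd),
    fun δ => two_mul_mem_codeTape, fun ξ hξ => lt_of_mem_codeTape hξ⟩

/-- Cell `2` of a code tells whether the coded set is empty. -/
theorem Codes.two_mem_iff {c : Set Ordinal.{0}} {x : ZFSet.{0}} (h : Codes c x) :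
    2 ∈ c ↔ x ≠ ∅ := by
  obtain ⟨κ, d, hd, h0, rfl⟩ := h
  have h2 : (2 : Ordinal.{0}) ∈ codeTape κ (fun α β => d α ∈ d β) ↔ 1 < κ := by
    rw [← mul_one (2 : Ordinal.{0}), two_mul_mem_codeTape]
    constructor
    · intro h
      by_contra h'
      exact absurd (h.trans_le (mul_le_mul' (not_lt.1 h') (not_lt.1 h'))) (by simp)
    · exact fun h => one_lt_mul'' h h
  refine h2.trans ⟨?_, ?_⟩
  · rintro h rfl
    have := hd.mapsTo (mem_Iio.2 h)
    rw [tcSingleton_empty, mem_singleton_iff, ← h0] at this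
    exact one_ne_zero (hd.injOn (mem_Iio.2 h) (mem_Iio.2 (zero_lt_one.trans h)) this)
  · intro h
    obtain ⟨z, hz⟩ := ZFSet.nonempty_def _ |>.1 ((ZFSet.eq_empty_or_nonempty x).resolve_left h)
    obtain ⟨α, hα, rfl⟩ := hd.surjOn (mem_tcSingleton_of_mem (self_mem_tcSingleton x) hz)
    refine lt_of_le_of_lt (Order.one_le_iff_pos.2 (pos_iff_ne_zero.2 ?_)) hα
    rintro rfl
    rw [h0] at hz
    exact ZFSet.mem_irrefl _ hz

/-- The only code of the numeral `1`. -/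
theorem eq_of_codes_natSet_one {c : Set Ordinal.{0}} (h : Codes c (natSet 1)) :
    c = {0, 2, 3, 4, 6} := by
  obtain ⟨κ, d, hd, h0, rfl⟩ := h
  have h1 : natSet 1 = {∅} := by
    simp [natSet]
  have htc : tcSingleton (natSet 1) = {{∅}, ∅} := by
    rw [h1, tcSingleton_eq]
    ext z
    simp [tcSingleton_empty]
  rw [htc] at hd
  rw [h1] at h0
  have hpos : 0 < κ := by
    obtain ⟨α, hα, -⟩ := hd.surjOn (mem_insert _ _)
    exact bot_le.trans_lt hα
  obtain ⟨β, hβ, hβ'⟩ := hd.surjOn (mem_insert_of_mem _ (mem_singleton (∅ : ZFSet.{0})))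
  have hall : ∀ γ < κ, γ = 0 ∨ γ = β := by
    intro γ hγ
    rcases hd.mapsTo (mem_Iio.2 hγ) with h | h
    · exact Or.inl (hd.injOn (mem_Iio.2 hγ) (mem_Iio.2 hpos) (h.trans h0.symm))
    · exact Or.inr (hd.injOn (mem_Iio.2 hγ) hβ (h.trans hβ'.symm))
  have hβ0 : β ≠ 0 := by
    rintro rfl
    have he : (∅ : ZFSet.{0}) ∈ ({∅} : ZFSet.{0}) := ZFSet.mem_singleton.2 rfl
    rw [← h0, hβ'] at he
    exact ZFSet.notMem_empty _ he
  have h1κ : 1 < κ := (Order.one_le_iff_pos.2 (pos_iff_ne_zero.2 hβ0)).trans_lt hβ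
  obtain rfl : 1 = β := (hall 1 h1κ).resolve_left one_ne_zero
  obtain rfl : κ = 2 := by
    refine le_antisymm (not_lt.1 fun h => ?_) ?_
    · rcases hall 2 h with h | h
      · exact two_ne_zero h
      · exact absurd h (by norm_num)
    · rw [← one_add_one_eq_two]; exact Order.add_one_le_of_lt h1κ
  have lt2 : ∀ a : Ordinal.{0}, a < 2 ↔ a = 0 ∨ a = 1 := by
    intro a
    constructor
    · exact hall a
    · rintro (rfl | rfl) <;> norm_num
  have lt4 : ∀ a : Ordinal.{0}, a < 2 * 2 ↔ a = 0 ∨ a = 1 ∨ a = 2 ∨ a = 3 := by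
    intro a
    constructor
    · intro h
      have h4 : a < ((4 : ℕ) : Ordinal.{0}) := h.trans_eq (by norm_num)
      obtain ⟨n, rfl⟩ := Ordinal.lt_omega0.1 (h4.trans (Ordinal.natCast_lt_omega0 4))
      have : n < 4 := by exact_mod_cast h4
      interval_cases n <;> simp
    · rintro (rfl | rfl | rfl | rfl) <;> norm_num
  ext γ
  simp only [mem_union, mem_ofPred_eq, lt4, lt2, mem_insert_iff, mem_singleton_iff]
  have n4 : (2 : Ordinal.{0}) * 2 = 4 := by norm_num
  have n6 : (2 : Ordinal.{0}) * 3 = 6 := by norm_num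
  have n3 : (2 : Ordinal.{0}) + 1 = 3 := by norm_num
  have e1 : ∅ ∉ (∅ : ZFSet.{0}) := ZFSet.notMem_empty _
  have e2 : ({∅} : ZFSet.{0}) ∉ (∅ : ZFSet.{0}) := ZFSet.notMem_empty _
  have e3 : ({∅} : ZFSet.{0}) ∉ ({∅} : ZFSet.{0}) := ZFSet.mem_irrefl _
  have e4 : (∅ : ZFSet.{0}) ∈ ({∅} : ZFSet.{0}) := ZFSet.mem_singleton.2 rfl
  simp only [exists_eq_left, or_and_right, exists_or, h0, hβ', e1, e2, e3, e4,
    false_and, true_and, false_or, or_false, mul_zero, zero_add, mul_one, n4, n6, n3]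
  tauto

/-! ### The copying program -/

/-- The transition table of a program that reads cell `2` of the input tape. If it is empty, then
the bits in `L` are written (states from `7` on). Otherwise the code in the cells `1 + 2 * ξ` of the
oracle tape is copied (states `3` to `6`), two cells in each round: in state `3` the machine reads
whether the code continues. Since `3` is the least of the states of the loop, it is the state at
limit times. -/
def copyTable (L : List Bool) : ℕ → Bool → Bool → Bool → Option Action
  | 0, _, _, _ => some (false, .right, .right, .stay, 1)
  | 1, _, _, _ => some (false, .stay, .right, .stay, 2)
  | 2, _, false, _ => some (false, .stay, .stay, .stay, 7)
  | 2, _, true, _ => some (true, .stay, .stay, .stay, 3)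
  | 3, false, _, _ => none
  | 3, true, _, _ => some (true, .right, .stay, .right, 4)
  | 4, _, _, w => some (w, .right, .stay, .stay, 5)
  | 5, a, _, _ => some (a, .right, .stay, .right, 6)
  | 6, _, _, w => some (w, .right, .stay, .stay, 3)
  | j + 7, _, _, _ => L[j]?.map fun w => (w, .stay, .stay, .right, 7 + j + 1)

/-- The program with the table `copyTable L`, which copies the first set in the oracle if the
input is a non-empty set, and outputs `L` otherwise. -/
def copyProgram (L : List Bool) : Program := ofTable (7 + L.length) (copyTable L)

section CopyProgram

variable {L : List Bool} {o i : Set Ordinal.{0}}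

theorem copyProgram_config_two :
    (copyProgram L).config o i 2 = ⟨2, 1, 2, 0, ∅⟩ := by
  have h1 : (copyProgram L).config o i (0 + 1) = ⟨1, 1, 1, 0, ∅⟩ := by
    rw [Program.config_add_one, Program.config_zero]
    refine (step_ofTable (by simp [initConfig]) rfl).trans ?_
    ext ξ <;> simp [initConfig, Move.apply]
  have h2 : (2 : Ordinal.{0}) = 0 + 1 + 1 := by norm_num
  rw [h2, Program.config_add_one, h1]
  refine (step_ofTable (by dsimp only; omega) rfl).trans ?_
  ext ξ <;> simp [Move.apply, one_add_one_eq_two]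

theorem copyProgram_config_three_of_notMem (hi : 2 ∉ i) :
    (copyProgram L).config o i 3 = ⟨7, 1, 2, 0, ∅⟩ := by
  have h3 : (3 : Ordinal.{0}) = 2 + 1 := by norm_num
  rw [h3, Program.config_add_one, copyProgram_config_two]
  refine (step_ofTable (w := false) (m₁ := .stay) (m₂ := .stay) (m₃ := .stay) (q := 7)
    (by dsimp only; omega) (by simp only [hi, decide_false]; rfl)).trans ?_
  ext ξ <;> simp [Move.apply]

theorem copyProgram_config_three_of_mem (hi : 2 ∈ i) :
    (copyProgram L).config o i 3 = ⟨3, 1, 2, 0, {0}⟩ := by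
  have h3 : (3 : Ordinal.{0}) = 2 + 1 := by norm_num
  rw [h3, Program.config_add_one, copyProgram_config_two]
  refine (step_ofTable (w := true) (m₁ := .stay) (m₂ := .stay) (m₃ := .stay) (q := 3)
    (by dsimp only; omega) (by simp only [hi, decide_true]; rfl)).trans ?_
  ext ξ <;> simp [Move.apply]

theorem copyProgram_haltsWith_of_notMem (hi : 2 ∉ i) :
    (copyProgram L).HaltsWith o i (finiteTape L) := by
  refine haltsWith_write (q := 7) rfl ?_ (copyProgram_config_three_of_notMem hi)
  intro j _ _ _ w hw
  rw [add_comm 7 j]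
  show L[j]?.map _ = _
  rw [Option.mem_def.1 hw, add_comm 7 j]
  rfl

/-- The part of the output that has been written before round `δ`. Cell `0` is filled before the
rounds begin, so that the output is a code of `∅` even if the oracle is empty. -/
def copied (o : Set Ordinal.{0}) (δ : Ordinal.{0}) : Set Ordinal.{0} :=
  {0} ∪ {ξ | 1 + 2 * ξ ∈ o ∧ ξ < 2 * δ}

theorem copied_mono {δ δ' : Ordinal.{0}} (h : δ ≤ δ') : copied o δ ⊆ copied o δ' := by
  refine union_subset_union_right _ ?_
  exact fun ξ hξ => ⟨hξ.1, hξ.2.trans_le (mul_le_mul_right h 2)⟩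

/-- The configuration at the beginning of round `δ`. -/
def roundConfig (o : Set Ordinal.{0}) (δ : Ordinal.{0}) : Config :=
  ⟨3, 1 + 2 * (2 * δ), 2, 2 * δ, copied o δ⟩

/-- A round takes four steps, which pass through the states `3` to `6`. The state and the position
of the input head in between, and the monotonicity of the output, determine the limits. -/
theorem copyProgram_round {δ : Ordinal.{0}} (hδ : 1 + 2 * (2 * δ) ∈ o)
    (h : (copyProgram L).config o i (3 + 4 * δ) = roundConfig o δ) :
    (∀ j < 4, ((copyProgram L).config o i (3 + 4 * δ + (j : ℕ))).state = 3 + j ∧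
      ((copyProgram L).config o i (3 + 4 * δ + (j : ℕ))).inputHead = 2 ∧
      copied o δ ⊆ ((copyProgram L).config o i (3 + 4 * δ + (j : ℕ))).work) ∧
    (copyProgram L).config o i (3 + 4 * (δ + 1)) = roundConfig o (δ + 1) := by
  classical
  have e2 : ∀ a : Ordinal.{0}, a + 1 + 1 = a + 2 := fun a => by rw [add_assoc, one_add_one_eq_two]
  have hodd : (1 : Ordinal.{0}) + 2 * (2 * δ) + 1 + 1 = 1 + 2 * (2 * δ + 1) := by
    rw [mul_add, mul_one, e2, add_assoc]
  have hlt : ∀ ξ : Ordinal.{0}, ξ < 2 * (δ + 1) ↔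
      ξ < 2 * δ ∨ ξ = 2 * δ ∨ ξ = 2 * δ + 1 := fun ξ => by
    rw [mul_add, mul_one, ← e2, Order.lt_add_one_iff, le_iff_lt_or_eq, Order.lt_add_one_iff,
      le_iff_lt_or_eq, or_assoc]
  have h1 : (copyProgram L).config o i (3 + 4 * δ + 1) =
      ⟨4, 1 + 2 * (2 * δ) + 1, 2, 2 * δ + 1, insert (2 * δ) (copied o δ)⟩ := by
    rw [Program.config_add_one, h]
    refine (step_ofTable (w := true) (m₁ := .right) (m₂ := .stay) (m₃ := .right) (q := 4)
      (by simp only [roundConfig]; omega)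
      (by simp only [roundConfig, hδ, decide_true]; rfl)).trans ?_
    ext ξ <;> simp [Move.apply, roundConfig]
    tauto
  have h2 : (copyProgram L).config o i (3 + 4 * δ + 1 + 1) =
      ⟨5, 1 + 2 * (2 * δ) + 1 + 1, 2, 2 * δ + 1, insert (2 * δ) (copied o δ)⟩ := by
    rw [Program.config_add_one, h1]
    refine (step_ofTable (by dsimp only; omega) rfl).trans ?_
    ext ξ <;> simp [Move.apply]
    rintro rfl
    simp
  have h3 : (copyProgram L).config o i (3 + 4 * δ + 1 + 1 + 1) =
      ⟨6, 1 + 2 * (2 * δ) + 1 + 1 + 1, 2, 2 * δ + 1 + 1, copied o (δ + 1)⟩ := by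
    rw [Program.config_add_one, h2]
    refine (step_ofTable (by dsimp only; omega) rfl).trans ?_
    ext ξ
    · rfl
    · rfl
    · rfl
    · rfl
    · simp only [copied, hlt, decide_eq_true_eq, hodd, mem_ofPred_eq, mem_insert_iff, mem_union,
        mem_singleton_iff]
      split_ifs with hξ
      · subst hξ
        simp
      · constructor
        · rintro (rfl | h | h)
          · exact Or.inr ⟨hδ, Or.inr (Or.inl rfl)⟩
          · exact Or.inl h
          · exact Or.inr ⟨h.1, Or.inl h.2⟩
        · rintro (h | ⟨h, h' | h' | h'⟩)
          · exact Or.inr (Or.inl h)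
          · exact Or.inr (Or.inr ⟨h, h'⟩)
          · exact Or.inl h'
          · exact absurd h' hξ
  have h4 : (copyProgram L).config o i (3 + 4 * (δ + 1)) = roundConfig o (δ + 1) := by
    have e4 : (4 : Ordinal.{0}) = 1 + 1 + 1 + 1 := by norm_num
    have : 3 + 4 * (δ + 1) = 3 + 4 * δ + 1 + 1 + 1 + 1 := by
      rw [mul_add, mul_one, ← add_assoc]; nth_rw 2 [e4]; simp only [add_assoc]
    rw [this, Program.config_add_one, h3]
    refine (step_ofTable (by dsimp only; omega) rfl).trans ?_
    ext ξ
    · rfl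
    · simp only [Move.apply, roundConfig, mul_add, mul_one, add_assoc, one_add_one_eq_two]
      norm_num
    · rfl
    · simp [Move.apply, roundConfig, mul_add, e2]
    · simp [roundConfig]
      rintro rfl
      simp
  refine ⟨fun j hj => ?_, h4⟩
  have c2 : ((2 : ℕ) : Ordinal.{0}) = 1 + 1 := by norm_num
  have c3 : ((3 : ℕ) : Ordinal.{0}) = 1 + 1 + 1 := by norm_num
  interval_cases j
  · rw [Nat.cast_zero, add_zero, h]; exact ⟨rfl, rfl, subset_rfl⟩
  · rw [Nat.cast_one, h1]; exact ⟨rfl, rfl, subset_insert _ _⟩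
  · rw [c2, ← add_assoc, h2]; exact ⟨rfl, rfl, subset_insert _ _⟩
  · rw [c3, ← add_assoc, ← add_assoc, h3]
    exact ⟨rfl, rfl, copied_mono le_self_add⟩

theorem exists_nat_of_lt_four {a : Ordinal.{0}} (h : a < 4) : ∃ j : ℕ, j < 4 ∧ a = j := by
  have h4 : a < ((4 : ℕ) : Ordinal.{0}) := h.trans_eq (by norm_num)
  obtain ⟨n, rfl⟩ := Ordinal.lt_omega0.1 (h4.trans (Ordinal.natCast_lt_omega0 4))
  exact ⟨n, by exact_mod_cast h4, rfl⟩

theorem copyProgram_config_round (hi : 2 ∈ i) {δ : Ordinal.{0}}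
    (hδ : ∀ δ' < δ, 1 + 2 * (2 * δ') ∈ o) :
    (copyProgram L).config o i (3 + 4 * δ) = roundConfig o δ := by
  induction δ using Ordinal.limitRecOn with
  | zero =>
    rw [mul_zero, add_zero, copyProgram_config_three_of_mem hi]
    ext ξ <;> simp [roundConfig, copied]
  | add_one δ ih =>
    exact (copyProgram_round (hδ δ (lt_add_one δ))
      (ih fun δ' h => hδ δ' (h.trans (lt_add_one δ)))).2
  | limit δ hlim ih =>
    have n4 : Order.IsNormal (fun δ : Ordinal.{0} => 3 + 4 * δ) :=
      (Ordinal.isNormal_add_right 3).comp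
        (Ordinal.isNormal_mul_right (by norm_num : (0 : Ordinal.{0}) < 4))
    have n2 : Order.IsNormal (fun δ : Ordinal.{0} => 2 * δ) := Ordinal.isNormal_mul_right two_pos
    have n5 : Order.IsNormal (fun δ : Ordinal.{0} => 1 + 2 * (2 * δ)) :=
      (Ordinal.isNormal_add_right 1).comp (n2.comp n2)
    have hround : ∀ δ' < δ, _ := fun δ' h =>
      copyProgram_round (L := L) (hδ δ' h) (ih δ' h fun δ'' h' => hδ δ'' (h'.trans h))
    have hround0 : ∀ δ' < δ, _ := fun δ' h => ih δ' h fun δ'' h' => hδ δ'' (h'.trans h)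
    -- every time before the limit lies in one of the rounds
    have F1 : ∀ s, 3 ≤ s → s < 3 + 4 * δ → ∃ δ' < δ, ∃ j : ℕ, j < 4 ∧ s = 3 + 4 * δ' + j := by
      intro s h3 hs
      obtain ⟨u, rfl⟩ := exists_add_of_le h3
      obtain ⟨δ', h1, v, h2, rfl⟩ := Ordinal.lt_mul_iff.1 ((add_lt_add_iff_left 3).1 hs)
      obtain ⟨j, hj, rfl⟩ := exists_nat_of_lt_four h2
      exact ⟨δ', h1, j, hj, (add_assoc _ _ _).symm⟩
    -- the beginnings of the rounds are cofinal in the limit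
    have F2 : ∀ r < 3 + 4 * δ, ∃ δ' < δ, r ≤ 3 + 4 * δ' := fun r hr =>
      let ⟨δ', h1, h2⟩ := (n4.lt_iff_exists_lt hlim).1 hr
      ⟨δ', h1, h2.le⟩
    -- from the beginning of a round on, only later rounds occur
    have F3 : ∀ δ' < δ, ∀ s, 3 + 4 * δ' ≤ s → s < 3 + 4 * δ → ∃ δ'' < δ, δ' ≤ δ'' ∧
        ∃ j : ℕ, j < 4 ∧ s = 3 + 4 * δ'' + j := by
      intro δ' h s h1 h2
      obtain ⟨δ'', h3, j, h4, rfl⟩ := F1 s (le_self_add.trans h1) h2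
      refine ⟨δ'', h3, not_lt.1 fun h5 => ?_, j, h4, rfl⟩
      refine absurd h1 (not_le.2 ?_)
      have h6 : (3 : Ordinal.{0}) + 4 * (δ'' + 1) ≤ 3 + 4 * δ' :=
        n4.monotone (Order.add_one_le_of_lt h5)
      refine lt_of_lt_of_le ?_ h6
      rw [mul_add, mul_one, ← add_assoc]
      have : ((j : ℕ) : Ordinal.{0}) < ((4 : ℕ) : Ordinal.{0}) := by exact_mod_cast h4
      simpa using this
    have hpos : (3 : Ordinal.{0}) < 3 + 4 * δ := by
      have := n4.strictMono hlim.bot_lt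
      simpa using this
    -- A head position that is normal as a function of the round is continuous at the limit, since
    -- only the times in state `3`, which are the beginnings of rounds, enter the inferior limit.
    have head : ∀ (f : Config → Ordinal.{0}) (g : Ordinal.{0} → Ordinal.{0}), Order.IsNormal g →
        (∀ δ, f (roundConfig o δ) = g δ) → ∀ ξ, ξ < g δ ↔ ∃ r < 3 + 4 * δ, ∀ s, r ≤ s →
          s < 3 + 4 * δ → ((copyProgram L).config o i s).state = 3 →
          ξ < f ((copyProgram L).config o i s) := by
      intro f g hg hfg ξ
      rw [hg.lt_iff_exists_lt hlim]
      constructor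
      · rintro ⟨δ', h1, h2⟩
        refine ⟨3 + 4 * δ', n4.strictMono h1, fun s h3 h4 h5 => ?_⟩
        obtain ⟨δ'', h6, h7, j, h8, rfl⟩ := F3 δ' h1 s h3 h4
        rw [((hround δ'' h6).1 j h8).1] at h5
        obtain rfl : j = 0 := by omega
        rw [Nat.cast_zero, add_zero, hround0 δ'' h6, hfg]
        exact h2.trans_le (hg.monotone h7)
      · rintro ⟨r, hr, H⟩
        obtain ⟨δ', h1, h2⟩ := F2 r hr
        have := H _ h2 (n4.strictMono h1) (by rw [hround0 δ' h1]; rfl)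
        rw [hround0 δ' h1, hfg] at this
        exact ⟨δ', h1, this⟩
    refine Program.config_limit_eq _ _ _ (n4.map_isSuccLimit hlim) ?_
      (head (·.oracleHead) _ n5 fun _ => rfl) ?_ (head (·.workHead) _ n2 fun _ => rfl) ?_
    · intro b
      constructor
      · intro hb
        refine ⟨3, hpos, fun s h1 h2 => ?_⟩
        obtain ⟨δ', h3, j, h4, rfl⟩ := F1 s h1 h2
        rw [((hround δ' h3).1 j h4).1]
        exact lt_of_lt_of_le hb (Nat.le_add_right 3 j)
      · rintro ⟨r, hr, H⟩
        obtain ⟨δ', h1, h2⟩ := F2 r hr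
        have := H _ h2 (n4.strictMono h1)
        rwa [hround0 δ' h1] at this
    · intro ξ
      constructor
      · intro hξ
        refine ⟨3, hpos, fun s h1 h2 _ => ?_⟩
        obtain ⟨δ', h3, j, h4, rfl⟩ := F1 s h1 h2
        rw [((hround δ' h3).1 j h4).2.1]
        exact hξ
      · rintro ⟨r, hr, H⟩
        obtain ⟨δ', h1, h2⟩ := F2 r hr
        have := H _ h2 (n4.strictMono h1) (by rw [hround0 δ' h1]; rfl)
        rwa [hround0 δ' h1] at this
    · intro ξ
      constructor
      · intro hξ
        obtain ⟨δ', h1, h2⟩ : ∃ δ' < δ, ξ ∈ copied o δ' := by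
          rcases hξ with hξ | ⟨h1, h2⟩
          · exact ⟨0, hlim.bot_lt, Or.inl hξ⟩
          · obtain ⟨δ', h3, h4⟩ := (n2.lt_iff_exists_lt hlim).1 h2
            exact ⟨δ', h3, Or.inr ⟨h1, h4⟩⟩
        refine ⟨3 + 4 * δ', n4.strictMono h1, fun s h3 h4 => ?_⟩
        obtain ⟨δ'', h6, h7, j, h8, rfl⟩ := F3 δ' h1 s h3 h4
        exact ((hround δ'' h6).1 j h8).2.2 (copied_mono h7 h2)
      · rintro ⟨r, hr, H⟩
        obtain ⟨δ', h1, h2⟩ := F2 r hr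
        have := H _ h2 (n4.strictMono h1)
        rw [hround0 δ' h1] at this
        exact copied_mono h1.le this

theorem copyProgram_haltsWith_of_mem (hi : 2 ∈ i) {μ : Ordinal.{0}}
    (hμ : ∀ δ < μ, 1 + 2 * (2 * δ) ∈ o) (hμ' : 1 + 2 * (2 * μ) ∉ o) :
    (copyProgram L).HaltsWith o i (copied o μ) := by
  classical
  have := copyProgram_config_round (L := L) hi hμ
  refine ⟨_, ?_, by rw [this]; rfl⟩
  rw [this]
  refine command_ofTable_eq_none fun _ => ?_
  simp only [roundConfig, hμ', decide_false]
  rfl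

theorem copyProgram_safe (L : List Bool) : (copyProgram L).Safe := by
  intro o i ⟨B, hB⟩ _
  by_cases hi : 2 ∈ i
  · have hle : ∀ a : Ordinal.{0}, a ≤ 2 * a := fun a =>
      (Ordinal.isNormal_mul_right two_pos).strictMono.le_apply
    obtain ⟨μ, h1, h2⟩ := WellFounded.has_min Ordinal.lt_wf {δ : Ordinal.{0} | 1 + 2 * (2 * δ) ∉ o}
      ⟨B + 1, fun h => absurd (hB h) (not_le.2 ((lt_add_one B).trans_le
        ((hle _).trans ((hle _).trans le_add_self))))⟩
    exact ⟨_, copyProgram_haltsWith_of_mem hi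
      (fun δ hδ => by_contra fun h => h2 δ h hδ) h1⟩
  · exact ⟨_, copyProgram_haltsWith_of_notMem hi⟩

theorem InputCodes.two_mem_iff {c : Set Ordinal.{0}} {y : Option ZFSet.{0}} (h : InputCodes c y) :
    2 ∈ c ↔ ∃ z ≠ ∅, y = some z := by
  cases y with
  | none => rw [show c = ∅ from h]; simp
  | some z => simpa using Codes.two_mem_iff h

theorem mem_joinTape_cons {c : Set Ordinal.{0}} {cs : List (Set Ordinal.{0})} {ξ : Ordinal.{0}} :
    1 + 2 * ξ ∈ joinTape (c :: cs) ↔ ξ ∈ c := by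
  simp only [joinTape, mem_union, mem_singleton_iff, mem_ofPred_eq, add_right_inj, two_mul_inj,
    two_mul_ne_two_mul_add_one, and_false, exists_false, or_false]
  simp

/-- If the input is non-empty, the copying program outputs the first set in the oracle. -/
theorem copyProgram_haltsWith_cons {c : Set Ordinal.{0}} {cs : List (Set Ordinal.{0})}
    {x : ZFSet.{0}} (hc : Codes c x) (hi : 2 ∈ i) :
    (copyProgram L).HaltsWith (joinTape (c :: cs)) i c := by
  obtain ⟨μ, hpos, h1, h2⟩ := hc.exists_length
  have := copyProgram_haltsWith_of_mem (L := L) (o := joinTape (c :: cs)) hi (μ := μ)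
    (fun δ hδ => mem_joinTape_cons.2 ((h1 δ).2 hδ))
    (fun h => lt_irrefl μ ((h1 μ).1 (mem_joinTape_cons.1 h)))
  convert this using 1
  ext ξ
  simp only [copied, mem_joinTape_cons, mem_union, mem_singleton_iff, mem_ofPred_eq]
  constructor
  · exact fun h => Or.inr ⟨h, h2 ξ h⟩
  · rintro (rfl | h)
    · simpa using (h1 0).2 hpos
    · exact h.1

theorem copyProgram_haltsWith_nil (hi : 2 ∈ i) :
    (copyProgram L).HaltsWith (joinTape []) i {0} := by
  have := copyProgram_haltsWith_of_mem (L := L) (o := joinTape []) hi (μ := 0) (by simp)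
    (by simp [joinTape])
  simpa [copied, joinTape] using this

theorem codes_empty : Codes {0} ∅ := by
  refine ⟨1, fun _ => ∅, ?_, rfl, ?_⟩
  · rw [tcSingleton_empty]
    refine ⟨fun _ _ => rfl, fun a ha b hb _ => ?_, fun z hz => ⟨0, by simp, hz.symm⟩⟩
    simp only [mem_Iio, Order.lt_one_iff] at ha hb
    rw [ha, hb]
  · ext ξ
    simp

theorem copyProgram_codingStable {x : ZFSet.{0}} (hL : Codes (finiteTape L) x) :
    (copyProgram L).CodingStable := by
  -- the output codes `∅`, the first set in the oracle, or `x`, depending on the sets only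
  have key : ∀ (a : List ZFSet.{0}) (y : Option ZFSet.{0}), ∃ z : ZFSet.{0},
      ∀ c i, List.Forall₂ Codes c a → InputCodes i y →
        ∃ w, (copyProgram L).HaltsWith (joinTape c) i w ∧ Codes w z := by
    intro a y
    by_cases hy : ∃ z ≠ ∅, y = some z
    · cases a with
      | nil =>
        refine ⟨∅, fun c i hc hi => ?_⟩
        obtain rfl := List.forall₂_nil_right_iff.1 hc
        exact ⟨_, copyProgram_haltsWith_nil (hi.two_mem_iff.2 hy), codes_empty⟩
      | cons b a =>
        refine ⟨b, fun c i hc hi => ?_⟩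
        obtain ⟨c₀, c', h1, h2, rfl⟩ := List.forall₂_cons_right_iff.1 hc
        exact ⟨_, copyProgram_haltsWith_cons h1 (hi.two_mem_iff.2 hy), h1⟩
    · exact ⟨x, fun c i hc hi => ⟨_, copyProgram_haltsWith_of_notMem (mt hi.two_mem_iff.1 hy), hL⟩⟩
  intro a y c₀ c₁ i₀ i₁ h0 h1 hi0 hi1
  obtain ⟨z, hz⟩ := key a y
  obtain ⟨w₀, hw0, hz0⟩ := hz c₀ i₀ h0 hi0
  obtain ⟨w₁, hw1, hz1⟩ := hz c₁ i₁ h1 hi1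
  refine ⟨⟨fun _ => ⟨_, hw1⟩, fun _ => ⟨_, hw0⟩⟩, fun z₀ z₁ g0 g1 => ⟨z, ?_, ?_⟩⟩
  · rwa [g0.unique hw0]
  · rwa [g1.unique hw1]

end CopyProgram

theorem writeProgram_safe (L : List Bool) : (writeProgram L).Safe :=
  fun o i _ _ => ⟨_, haltsWith_writeProgram L o i⟩

theorem writeProgram_codingStable {x : ZFSet.{0}} (hL : Codes (finiteTape L) x) :
    (writeProgram L).CodingStable := by
  intro a y c₀ c₁ i₀ i₁ _ _ _ _
  refine ⟨⟨fun _ => ⟨_, haltsWith_writeProgram L _ _⟩, fun _ => ⟨_, haltsWith_writeProgram L _ _⟩⟩,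
    fun z₀ z₁ g0 g1 => ⟨x, ?_, ?_⟩⟩
  · rwa [g0.unique (haltsWith_writeProgram L _ _)]
  · rwa [g1.unique (haltsWith_writeProgram L _ _)]

/-! ### The negative fragment -/

theorem exists_forall₂_codes (l : List ZFSet.{0}) : ∃ c, List.Forall₂ Codes c l := by
  induction l with
  | nil => exact ⟨[], List.Forall₂.nil⟩
  | cons x l ih =>
    obtain ⟨c, hc⟩ := ih
    obtain ⟨d, hd⟩ := exists_codes x
    exact ⟨d :: c, List.Forall₂.cons hd hc⟩

theorem exists_inputCodes (y : Option ZFSet.{0}) : ∃ c, InputCodes c y := by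
  cases y with
  | none => exact ⟨∅, rfl⟩
  | some y => exact exists_codes y

/-- A program that outputs the same hereditarily finite set for all oracles and inputs. -/
theorem exists_constant_realizer {z : ZFSet.{0}} (hz : (tcSingleton z).Finite) :
    ∃ e : ℕ, (Realizer.mk e []).Admissible ∧
      ∀ {n : ℕ} (a : Fin n → ZFSet.{0}) (x : List ZFSet.{0}) (y : Option ZFSet.{0}),
        (Realizer.mk e []).Yields a x y z := by
  obtain ⟨L, hL⟩ := exists_finiteTape_codes hz
  obtain ⟨e, he⟩ := exists_program_eq (writeProgram L)
  refine ⟨e, ?_, fun a x y => ?_⟩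
  · rw [Realizer.Admissible, he]
    exact ⟨writeProgram_safe L, writeProgram_codingStable hL⟩
  · obtain ⟨c, hc⟩ := exists_forall₂_codes (([] : List (Set ℕ)).map realSet ++ List.ofFn a ++ x)
    obtain ⟨i, hi⟩ := exists_inputCodes y
    refine ⟨c, i, _, hc, hi, ?_, hL⟩
    rw [he]
    exact haltsWith_writeProgram L _ _

/-- Formulas without conjunctions, disjunctions and existential quantifiers. -/
inductive Formula.IsNegative : {n : ℕ} → Formula n → Prop
  | mem {n : ℕ} (i j : Fin n) : (Formula.mem i j).IsNegative
  | eq {n : ℕ} (i j : Fin n) : (Formula.eq i j).IsNegative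
  | imp {n : ℕ} {φ ψ : Formula n} : φ.IsNegative → ψ.IsNegative → (φ.imp ψ).IsNegative
  | neg {n : ℕ} {φ : Formula n} : φ.IsNegative → φ.neg.IsNegative
  | all {n : ℕ} {φ : Formula (n + 1)} : φ.IsNegative → φ.all.IsNegative

/-- Truth in the structure `(U, ∈)`. -/
def Sat (U : Set ZFSet.{0}) : {n : ℕ} → Formula n → (Fin n → ZFSet.{0}) → Prop
  | _, .mem i j, a => a i ∈ a j
  | _, .eq i j, a => a i = a j
  | _, .and φ ψ, a => Sat U φ a ∧ Sat U ψ a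
  | _, .or φ ψ, a => Sat U φ a ∨ Sat U ψ a
  | _, .imp φ ψ, a => Sat U φ a → Sat U ψ a
  | _, .neg φ, a => ¬ Sat U φ a
  | _, .ex φ, a => ∃ b ∈ U, Sat U φ (Fin.snoc a b : Fin (_ + 1) → ZFSet.{0})
  | _, .all φ, a => ∀ b ∈ U, Sat U φ (Fin.snoc a b : Fin (_ + 1) → ZFSet.{0})

/-- The set `H_{ω₁}`. -/
def HC : Set ZFSet.{0} := {x | IsHC x}

/-- For negative formulas, both notions of realizability coincide with truth in `H_{ω₁}`, and there
is a realizer without parameters that depends only on the formula. -/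
theorem Formula.IsNegative.exists_realizer {R : (List ZFSet.{0} → Prop) → Prop}
    (hR : ∀ Q, (∀ l, Q l) → R Q) (hR' : ∀ Q, R Q → ∃ l, Q l) {n : ℕ} {φ : Formula n}
    (hφ : φ.IsNegative) : ∃ e : ℕ, ∀ a : Fin n → ZFSet.{0},
      (∀ r, Realizes R φ a r → Sat HC φ a) ∧ (Sat HC φ a → Realizes R φ a ⟨e, []⟩) := by
  obtain ⟨e₀, he₀, -⟩ := exists_constant_realizer (tcSingleton_natSet_finite 0)
  induction hφ with
  | mem i j => exact ⟨e₀, fun a => ⟨fun r h => h.2, fun h => ⟨he₀, h⟩⟩⟩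
  | eq i j => exact ⟨e₀, fun a => ⟨fun r h => h.2, fun h => ⟨he₀, h⟩⟩⟩
  | imp _ _ ihφ ihψ =>
    obtain ⟨e₁, h₁⟩ := ihφ
    obtain ⟨e₂, h₂⟩ := ihψ
    obtain ⟨e, he, hy⟩ := exists_constant_realizer (tcSingleton_realizer_finite e₂)
    refine ⟨e, fun a => ⟨fun r h hs => ?_, fun h => ⟨he, fun s hs => hR _ fun l => ?_⟩⟩⟩
    · obtain ⟨l, s', -, hs'⟩ := hR' _ (h.2 _ ((h₁ a).2 hs))
      exact (h₂ a).1 _ hs'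
    · exact ⟨_, hy a l _, (h₂ a).2 (h ((h₁ a).1 s hs))⟩
  | neg _ ihφ =>
    obtain ⟨e₁, h₁⟩ := ihφ
    refine ⟨e₀, fun a => ⟨fun r h hs => ?_, fun h => ⟨he₀, fun s hs => ?_⟩⟩⟩
    · obtain ⟨l, s', -, hs'⟩ := hR' _ (h.2 _ ((h₁ a).2 hs))
      exact hs'.2
    · exact absurd ((h₁ a).1 s hs) h
  | all _ ih =>
    obtain ⟨e₁, h₁⟩ := ih
    obtain ⟨e, he, hy⟩ := exists_constant_realizer (tcSingleton_realizer_finite e₁)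
    refine ⟨e, fun a => ⟨fun r h b hb => ?_, fun h => ⟨he, fun b hb => hR _ fun l => ?_⟩⟩⟩
    · obtain ⟨l, s, -, hs⟩ := hR' _ (h.2 b hb)
      exact (h₁ _).1 s hs
    · exact ⟨_, hy _ l _, (h₁ _).2 (h b hb)⟩

theorem exists_of_plainly {Q : List ZFSet.{0} → Prop} (h : Plainly Q) : ∃ l, Q l := ⟨[], h⟩

theorem exists_of_almostSurely {Q : List ZFSet.{0} → Prop} (h : AlmostSurely Q) : ∃ l, Q l := by
  obtain ⟨𝒪, h𝒪, hQ⟩ := h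
  obtain ⟨x, hx⟩ : 𝒪.Nonempty := by
    rw [nonempty_iff_ne_empty]
    rintro rfl
    simpa using h𝒪.2
  exact ⟨_, hQ x hx⟩

instance : IsProbabilityMeasure lebesgue := by
  unfold lebesgue; infer_instance

theorem almostSurely_of_forall {Q : List ZFSet.{0} → Prop} (h : ∀ l, Q l) : AlmostSurely Q :=
  ⟨univ, ⟨nullMeasurableSet_univ, measure_univ⟩, fun _ _ => h _⟩

/-- A real number is almost surely not in a given countable set. -/
theorem almostSurely_of_countable {Q : List ZFSet.{0} → Prop} {S : Set (Set ℕ)} (hS : S.Countable)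
    (h : ∀ x ∉ S, Q [realSet x]) : AlmostSurely Q := by
  -- the measure of `{x}` is at most `(1 / 2) ^ n`, as its elements agree with `x` below `n`
  have hsing : ∀ x : Set ℕ, lebesgue {x} = 0 := by
    intro x
    refine le_antisymm (ge_of_tendsto' (ENNReal.tendsto_pow_atTop_nhds_zero_of_lt_one
      ENNReal.one_half_lt_one) fun n => ?_) zero_le
    rw [lebesgue, ProbabilityTheory.setBernoulli_apply, image_singleton]
    refine (measure_mono (t := Set.pi (Finset.range n) fun i => {i ∈ x}) ?_).trans ?_
    · rintro _ rfl i -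
      rfl
    · rw [Measure.infinitePi_pi _ (fun _ _ => MeasurableSet.of_discrete)]
      refine (Finset.prod_le_pow_card _ _ (1 / 2 : ENNReal) fun i _ => ?_).trans_eq (by simp)
      have h1 : unitInterval.toNNReal ⟨1 / 2, by norm_num, by norm_num⟩ = 1 / 2 := by
        ext; simp
      have h2 : unitInterval.toNNReal (unitInterval.symm ⟨1 / 2, by norm_num, by norm_num⟩) =
          1 / 2 := by
        ext; simp; norm_num
      rw [h1, h2]
      by_cases hi : i ∈ x <;> simp [hi, ENNReal.smul_def]
  have hnull : lebesgue S = 0 := by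
    rw [← biUnion_of_singleton S]
    exact (measure_biUnion_null_iff hS).2 fun x _ => hsing x
  refine ⟨Sᶜ, ⟨(NullMeasurableSet.of_null hnull).compl, ?_⟩, fun x hx => h x hx⟩
  rw [prob_compl_eq_one_iff₀ (NullMeasurableSet.of_null hnull)]
  exact hnull

/-! ### Absolute formulas -/

/-- `U` is a transitive class. -/
def IsTransClass (U : Set ZFSet.{0}) : Prop := ∀ x ∈ U, ∀ y ∈ x, y ∈ U

/-- The predicate `S` is defined by a negative formula that has the same meaning in all transitive
classes. All that is used of formulas with bounded quantifiers is this absoluteness. -/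
def Delta0 (n : ℕ) (S : (Fin n → ZFSet.{0}) → Prop) : Prop :=
  ∃ φ : Formula n, φ.IsNegative ∧ ∀ U, IsTransClass U → ∀ a : Fin n → ZFSet.{0}, (∀ i, a i ∈ U) →
    (Sat U φ a ↔ S a)

/-- `f` is a projection, that is, the interpretation of a variable. -/
def IsVar {n : ℕ} (f : (Fin n → ZFSet.{0}) → ZFSet.{0}) : Prop := ∃ i, f = fun a => a i

namespace Delta0

variable {n : ℕ} {f g : (Fin n → ZFSet.{0}) → ZFSet.{0}} {S T : (Fin n → ZFSet.{0}) → Prop}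

theorem congr (hS : Delta0 n S) (h : ∀ a, S a ↔ T a) : Delta0 n T := by
  obtain ⟨φ, h1, h2⟩ := hS
  exact ⟨φ, h1, fun U hU a ha => (h2 U hU a ha).trans (h a)⟩

theorem mem (hf : IsVar f) (hg : IsVar g) : Delta0 n (fun a => f a ∈ g a) := by
  obtain ⟨i, rfl⟩ := hf
  obtain ⟨j, rfl⟩ := hg
  exact ⟨.mem i j, .mem i j, fun U hU a ha => Iff.rfl⟩

theorem eq (hf : IsVar f) (hg : IsVar g) : Delta0 n (fun a => f a = g a) := by
  obtain ⟨i, rfl⟩ := hf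
  obtain ⟨j, rfl⟩ := hg
  exact ⟨.eq i j, .eq i j, fun U hU a ha => Iff.rfl⟩

theorem imp (hS : Delta0 n S) (hT : Delta0 n T) : Delta0 n (fun a => S a → T a) := by
  obtain ⟨φ, h1, h2⟩ := hS
  obtain ⟨ψ, h3, h4⟩ := hT
  exact ⟨.imp φ ψ, .imp h1 h3, fun U hU a ha => imp_congr (h2 U hU a ha) (h4 U hU a ha)⟩

theorem not (hS : Delta0 n S) : Delta0 n (fun a => ¬ S a) := by
  obtain ⟨φ, h1, h2⟩ := hS
  exact ⟨.neg φ, .neg h1, fun U hU a ha => not_congr (h2 U hU a ha)⟩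

theorem and (hS : Delta0 n S) (hT : Delta0 n T) : Delta0 n (fun a => S a ∧ T a) :=
  (hS.imp hT.not).not.congr fun a => by tauto

theorem or (hS : Delta0 n S) (hT : Delta0 n T) : Delta0 n (fun a => S a ∨ T a) :=
  (hS.not.imp hT).congr fun a => by tauto

theorem iff (hS : Delta0 n S) (hT : Delta0 n T) : Delta0 n (fun a => (S a ↔ T a)) :=
  ((hS.imp hT).and (hT.imp hS)).congr fun a => by tauto

/-- There are no propositional constants; truth is expressed by `∀ x, x = x`. -/
theorem const (p : Prop) : Delta0 n (fun _ => p) := by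
  have htrue : Delta0 n (fun _ => True) :=
    ⟨.all (.eq (Fin.last n) (Fin.last n)), .all (.eq _ _), fun U _ a _ => by simp [Sat]⟩
  by_cases h : p
  · exact htrue.congr fun _ => by simp [h]
  · exact htrue.not.congr fun _ => by simp [h]

theorem ball {S : (Fin n → ZFSet.{0}) → ZFSet.{0} → Prop} (hf : IsVar f)
    (hS : Delta0 (n + 1) (fun a => S (Fin.init a) (a (Fin.last n)))) :
    Delta0 n (fun a => ∀ x ∈ f a, S a x) := by
  obtain ⟨i, rfl⟩ := hf
  obtain ⟨φ, h1, h2⟩ := hS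
  refine ⟨.all (.imp (.mem (Fin.last n) i.castSucc) φ), .all (.imp (.mem _ _) h1),
    fun U hU a ha => ?_⟩
  simp only [Sat, Fin.snoc_last, Fin.snoc_castSucc]
  refine ⟨fun h x hx => ?_, fun h x hxU hx => ?_⟩
  · have hxU := hU _ (ha i) x hx
    have := (h2 U hU (Fin.snoc a x) (fun j => ?_)).1 (h x hxU hx)
    · simpa using this
    · refine Fin.lastCases ?_ (fun j => ?_) j
      · simpa using hxU
      · simpa using ha j
  · refine (h2 U hU (Fin.snoc a x) (fun j => ?_)).2 (by simpa using h x hx)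
    refine Fin.lastCases ?_ (fun j => ?_) j
    · simpa using hxU
    · simpa using ha j

theorem bex {S : (Fin n → ZFSet.{0}) → ZFSet.{0} → Prop} (hf : IsVar f)
    (hS : Delta0 (n + 1) (fun a => S (Fin.init a) (a (Fin.last n)))) :
    Delta0 n (fun a => ∃ x ∈ f a, S a x) :=
  (ball (S := fun a x => ¬ S a x) hf hS.not).not.congr fun a => by push Not; rfl

theorem forall_finite {κ : Type} [Finite κ] {S : κ → (Fin n → ZFSet.{0}) → Prop}
    (hS : ∀ k, Delta0 n (S k)) : Delta0 n (fun a => ∀ k, S k a) := by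
  have := Fintype.ofFinite κ
  have key : ∀ l : List κ, Delta0 n (fun a => ∀ k ∈ l, S k a) := by
    intro l
    induction l with
    | nil => exact (const True).congr fun a => by simp
    | cons k l ih => exact ((hS k).and ih).congr fun a => by simp
  exact (key Finset.univ.toList).congr fun a => by simp

theorem exists_finite {κ : Type} [Finite κ] {S : κ → (Fin n → ZFSet.{0}) → Prop}
    (hS : ∀ k, Delta0 n (S k)) : Delta0 n (fun a => ∃ k, S k a) :=
  (forall_finite fun k => (hS k).not).not.congr fun a => by push Not; rfl

end Delta0

/-! ### Reflection to hereditarily countable sets -/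

/-- `X` is closed under the functions in `F`. -/
def ClosedUnder (F : Set (List ZFSet.{0} → ZFSet.{0})) (X : Set ZFSet.{0}) : Prop :=
  ∀ f ∈ F, ∀ l : List ZFSet.{0}, (∀ x ∈ l, x ∈ X) → f l ∈ X

theorem exists_countable_closedUnder {F : Set (List ZFSet.{0} → ZFSet.{0})} (hF : F.Countable)
    {A : Set ZFSet.{0}} (hA : A.Countable) : ∃ X, A ⊆ X ∧ X.Countable ∧ ClosedUnder F X := by
  let next : Set ZFSet.{0} → Set ZFSet.{0} := fun X =>
    X ∪ ⋃ f ∈ F, f '' {l | ∀ x ∈ l, x ∈ X}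
  have hlist : ∀ X : Set ZFSet.{0}, X.Countable →
      {l : List ZFSet.{0} | ∀ x ∈ l, x ∈ X}.Countable := by
    intro X hX
    have := hX.to_subtype
    refine (countable_range (List.map (Subtype.val : X → ZFSet.{0}))).mono fun l hl => ?_
    exact ⟨l.attach.map fun x => ⟨x.1, hl x.1 x.2⟩, by simp [Function.comp_def]⟩
  have hnext : ∀ X, X.Countable → (next X).Countable := fun X hX =>
    hX.union (hF.biUnion fun f _ => (hlist X hX).image f)
  let Y : ℕ → Set ZFSet.{0} := fun k => next^[k] A
  have hYs : ∀ k, Y (k + 1) = next (Y k) := fun k => Function.iterate_succ_apply' next k A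
  have hmono : Monotone Y := monotone_nat_of_le_succ fun k => by
    rw [hYs]; exact subset_union_left
  refine ⟨⋃ k, Y k, subset_iUnion Y 0, countable_iUnion fun k => ?_, fun f hf l hl => ?_⟩
  · induction k with
    | zero => exact hA
    | succ k ih => rw [hYs]; exact hnext _ ih
  · obtain ⟨k, hk⟩ : ∃ k, ∀ x ∈ l, x ∈ Y k := by
      clear hf
      induction l with
      | nil => exact ⟨0, by simp⟩
      | cons x l ih =>
        obtain ⟨k, hk⟩ := ih fun y hy => hl y (List.mem_cons_of_mem _ hy)
        obtain ⟨k', hk'⟩ := mem_iUnion.1 (hl x List.mem_cons_self)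
        refine ⟨max k k', fun y hy => ?_⟩
        rcases List.mem_cons.1 hy with rfl | hy
        · exact hmono (le_max_right _ _) hk'
        · exact hmono (le_max_left _ _) (hk y hy)
    refine mem_iUnion.2 ⟨k + 1, ?_⟩
    rw [hYs]
    exact Or.inr (mem_biUnion hf ⟨l, hk, rfl⟩)

/-- The Tarski–Vaught argument: a formula has countably many Skolem functions, and it is absolute
for each class that is closed under them. -/
theorem Formula.IsNegative.exists_skolem {n : ℕ} {φ : Formula n} (hφ : φ.IsNegative) :
    ∃ F : Set (List ZFSet.{0} → ZFSet.{0}), F.Countable ∧ ∀ X, ClosedUnder F X →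
      ∀ a : Fin n → ZFSet.{0}, (∀ i, a i ∈ X) → (Sat X φ a ↔ Sat univ φ a) := by
  classical
  induction hφ with
  | mem i j => exact ⟨∅, countable_empty, fun X _ a _ => Iff.rfl⟩
  | eq i j => exact ⟨∅, countable_empty, fun X _ a _ => Iff.rfl⟩
  | imp _ _ ihφ ihψ =>
    obtain ⟨F, h1, h2⟩ := ihφ
    obtain ⟨G, h3, h4⟩ := ihψ
    exact ⟨F ∪ G, h1.union h3, fun X hX a ha => imp_congr
      (h2 X (fun f hf => hX f (Or.inl hf)) a ha) (h4 X (fun f hf => hX f (Or.inr hf)) a ha)⟩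
  | neg _ ih =>
    obtain ⟨F, h1, h2⟩ := ih
    exact ⟨F, h1, fun X hX a ha => not_congr (h2 X hX a ha)⟩
  | @all n φ _ ih =>
    obtain ⟨F, h1, h2⟩ := ih
    let sk : List ZFSet.{0} → ZFSet.{0} := fun l =>
      if h : ∃ b, ¬ Sat univ φ (Fin.snoc (fun i : Fin n => l.getD i ∅) b : Fin (n + 1) → ZFSet.{0})
      then h.choose else ∅
    refine ⟨insert sk F, h1.insert _, fun X hX a ha => ?_⟩
    have hX' : ClosedUnder F X := fun f hf => hX f (Or.inr hf)
    have hsnoc : ∀ b ∈ X, ∀ i, (Fin.snoc a b : Fin (n + 1) → ZFSet.{0}) i ∈ X := fun b hb i => by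
      refine Fin.lastCases ?_ (fun j => ?_) i
      · simpa using hb
      · simpa using ha j
    refine ⟨fun h b _ => ?_, fun h b hb => (h2 X hX' _ (hsnoc b hb)).2 (h b trivial)⟩
    by_contra hb
    have hget : (fun i : Fin n => (List.ofFn a).getD i ∅) = a := by
      ext1 i; simp
    have hex : ∃ b, ¬ Sat univ φ (Fin.snoc (fun i : Fin n => (List.ofFn a).getD i ∅) b :
        Fin (n + 1) → ZFSet.{0}) := ⟨b, by rwa [hget]⟩
    have hsk : sk (List.ofFn a) = hex.choose := dif_pos hex
    have hmem : sk (List.ofFn a) ∈ X := hX sk (Or.inl rfl) _ fun x hx => by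
      obtain ⟨i, rfl⟩ := (List.mem_ofFn' a x).1 hx
      exact ha i
    have hspec := hex.choose_spec
    rw [← hsk, hget] at hspec
    exact hspec ((h2 X hX' _ (hsnoc _ hmem)).1 (h _ hmem))

/-- The Mostowski collapse of `X`, which maps `x` to the set of the values at the elements of `x`
that belong to `X`. -/
noncomputable def collapse (X : Set ZFSet.{0}) : ZFSet.{0} → ZFSet.{0} :=
  ZFSet.mem_wf.fix fun x ih =>
    ZFSet.range (fun z : Shrink.{0} {z // z ∈ x} => open Classical in
      if ((equivShrink _).symm z).1 ∈ X then {ih _ ((equivShrink _).symm z).2} else (∅ : ZFSet.{0}))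
      |>.sUnion

section Collapse

variable {X : Set ZFSet.{0}}

theorem mem_collapse {x z : ZFSet.{0}} :
    z ∈ collapse X x ↔ ∃ u ∈ x, u ∈ X ∧ z = collapse X u := by
  rw [collapse, WellFounded.fix_eq, ← collapse]
  simp only [ZFSet.mem_sUnion, ZFSet.mem_range]
  constructor
  · rintro ⟨y, ⟨w, rfl⟩, hz⟩
    split_ifs at hz with h
    · exact ⟨_, ((equivShrink _).symm w).2, h, ZFSet.mem_singleton.1 hz⟩
    · exact absurd hz (ZFSet.notMem_empty _)
  · rintro ⟨u, hu, huX, rfl⟩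
    refine ⟨_, ⟨equivShrink _ ⟨u, hu⟩, rfl⟩, ?_⟩
    simp [huX]

theorem isTransClass_collapse (X : Set ZFSet.{0}) : IsTransClass (collapse X '' X) := by
  rintro _ ⟨x, hx, rfl⟩ z hz
  obtain ⟨u, -, hu, rfl⟩ := mem_collapse.1 hz
  exact ⟨u, hu, rfl⟩

/-- Different elements of `X` have different elements in `X`. -/
def IsExtensional (X : Set ZFSet.{0}) : Prop :=
  ∀ x ∈ X, ∀ y ∈ X, (∀ z ∈ X, z ∈ x ↔ z ∈ y) → x = y

theorem collapse_injOn (hX : IsExtensional X) : InjOn (collapse X) X := by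
  have key : ∀ x, x ∈ X → ∀ y ∈ X, collapse X x = collapse X y → x = y := by
    intro x
    induction x using ZFSet.inductionOn with
    | _ x ih =>
      intro hx y hy h
      refine hX x hx y hy fun z hz => ⟨fun hzx => ?_, fun hzy => ?_⟩
      · have : collapse X z ∈ collapse X y := h ▸ mem_collapse.2 ⟨z, hzx, hz, rfl⟩
        obtain ⟨u, hu, huX, hzu⟩ := mem_collapse.1 this
        rwa [ih z hzx hz u huX hzu]
      · have : collapse X z ∈ collapse X x := h ▸ mem_collapse.2 ⟨z, hzy, hz, rfl⟩
        obtain ⟨u, hu, huX, hzu⟩ := mem_collapse.1 this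
        rwa [← ih u hu huX z hz hzu.symm]
  exact fun x hx y hy h => key x hx y hy h

theorem collapse_mem_collapse (hX : IsExtensional X) {x y : ZFSet.{0}} (hx : x ∈ X) :
    collapse X x ∈ collapse X y ↔ x ∈ y := by
  rw [mem_collapse]
  constructor
  · rintro ⟨u, hu, huX, h⟩
    rwa [collapse_injOn hX hx huX h]
  · exact fun h => ⟨x, h, hx, rfl⟩

theorem collapse_eq_self {y : ZFSet.{0}} (h : tcSingleton y ⊆ X) : collapse X y = y := by
  induction y using ZFSet.inductionOn with
  | _ y ih =>
    have hsub : ∀ u ∈ y, u ∈ X ∧ collapse X u = u := fun u hu =>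
      have := mem_tcSingleton_of_mem (self_mem_tcSingleton y) hu
      ⟨h this, ih u hu ((tcSingleton_subset this).trans h)⟩
    ext z
    rw [mem_collapse]
    constructor
    · rintro ⟨u, hu, -, rfl⟩
      rwa [(hsub u hu).2]
    · exact fun hz => ⟨z, hz, (hsub z hz).1, (hsub z hz).2.symm⟩

theorem Formula.IsNegative.sat_collapse (hX : IsExtensional X) {n : ℕ} {φ : Formula n}
    (hφ : φ.IsNegative) (a : Fin n → ZFSet.{0}) (ha : ∀ i, a i ∈ X) :
    Sat (collapse X '' X) φ (collapse X ∘ a) ↔ Sat X φ a := by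
  induction hφ with
  | mem i j => exact collapse_mem_collapse hX (ha i)
  | eq i j => exact (collapse_injOn hX).eq_iff (ha i) (ha j)
  | imp _ _ ihφ ihψ => exact imp_congr (ihφ a ha) (ihψ a ha)
  | neg _ ih => exact not_congr (ih a ha)
  | @all n φ _ ih =>
    simp only [Sat, forall_mem_image]
    refine forall₂_congr fun b hb => ?_
    have hsnoc : ∀ i, (Fin.snoc a b : Fin (n + 1) → ZFSet.{0}) i ∈ X := fun i => by
      refine Fin.lastCases ?_ (fun j => ?_) i
      · simpa using hb
      · simpa using ha j
    rw [← ih _ hsnoc, Fin.comp_snoc]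

end Collapse

/-- If a hereditarily countable set stands in an absolute relation to some set, then it stands in
this relation to some hereditarily countable set: by the Löwenheim–Skolem theorem, there is such a
set in the collapse of a countable class. -/
theorem Delta0.exists_isHC {S : (Fin 2 → ZFSet.{0}) → Prop} (hS : Delta0 2 S) {y c : ZFSet.{0}}
    (hy : IsHC y) (h : S ![y, c]) : ∃ c', IsHC c' ∧ S ![y, c'] := by
  classical
  obtain ⟨φ, hφ, hφS⟩ := hS
  obtain ⟨F, hF, hFX⟩ := hφ.exists_skolem
  -- closure under this function, which finds a difference of two sets, makes `X` extensional
  let ext : List ZFSet.{0} → ZFSet.{0} := fun l =>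
    if h : ∃ z, ¬ (z ∈ l.getD 0 ∅ ↔ z ∈ l.getD 1 ∅) then h.choose else ∅
  obtain ⟨X, hAX, hXc, hX⟩ := exists_countable_closedUnder (hF.insert ext)
    (A := insert c (tcSingleton y)) (Set.Countable.insert c hy)
  have hext : IsExtensional X := by
    intro x hx y hy hxy
    by_contra hne
    have hex : ∃ z, ¬ (z ∈ ([x, y] : List ZFSet.{0}).getD 0 ∅ ↔
        z ∈ ([x, y] : List ZFSet.{0}).getD 1 ∅) := by
      by_contra hcon
      push Not at hcon
      exact hne (ZFSet.ext hcon)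
    have hmem : ext [x, y] ∈ X := hX ext (Or.inl rfl) _ (by simp [hx, hy])
    have hspec := hex.choose_spec
    have hch : ext [x, y] = hex.choose := dif_pos hex
    rw [← hch] at hspec
    exact hspec (hxy _ hmem)
  have hcX : c ∈ X := hAX (Or.inl rfl)
  have hyX : tcSingleton y ⊆ X := fun z hz => hAX (Or.inr hz)
  -- `y` is not moved by the collapse, since its transitive closure is a part of `X`
  have hyy := collapse_eq_self hyX
  have ha : ∀ i, (![y, c] : Fin 2 → ZFSet.{0}) i ∈ X := fun i => by
    fin_cases i
    · exact hyX (self_mem_tcSingleton y)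
    · exact hcX
  have h1 : Sat univ φ ![y, c] :=
    (hφS univ (fun _ _ _ _ => trivial) _ fun _ => trivial).2 h
  have h2 := (hφ.sat_collapse hext _ ha).2
    ((hFX X (fun f hf => hX f (Or.inr hf)) _ ha).2 h1)
  have h3 : S (collapse X ∘ ![y, c]) :=
    (hφS _ (isTransClass_collapse X) _ fun i => ⟨_, ha i, rfl⟩).1 h2
  refine ⟨collapse X c, ?_, ?_⟩
  · refine (hXc.image (collapse X)).mono fun z hz => ?_
    induction hz using Relation.ReflTransGen.head_induction_on with
    | refl => exact ⟨c, hcX, rfl⟩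
    | head h _ ih => exact isTransClass_collapse X _ ih _ h
  · have : collapse X ∘ ![y, c] = ![y, collapse X c] := by
      ext1 i
      fin_cases i
      · exact hyy
      · rfl
    rwa [this] at h3

/-! ### Absoluteness of the computation relation -/

namespace Delta0

variable {n : ℕ} {f g h r : (Fin n → ZFSet.{0}) → ZFSet.{0}}

theorem eqSucc (hf : IsVar f) (hg : IsVar g) : Delta0 n (fun a => f a = insert (g a) (g a)) := by
  obtain ⟨i, rfl⟩ := hf
  obtain ⟨j, rfl⟩ := hg
  have : Delta0 n fun a => a j ∈ a i ∧ (∀ z ∈ a j, z ∈ a i) ∧ ∀ z ∈ a i, z ∈ a j ∨ z = a j := by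
    refine (mem ⟨_, rfl⟩ ⟨_, rfl⟩).and ((ball ⟨_, rfl⟩ (mem ⟨_, rfl⟩ ⟨_, rfl⟩)).and
      (ball ⟨_, rfl⟩ ((mem ⟨_, rfl⟩ ⟨_, rfl⟩).or (eq ⟨_, rfl⟩ ⟨_, rfl⟩))))
  refine this.congr fun a => ⟨?_, ?_⟩
  · rintro ⟨h1, h2, h3⟩
    ext z
    rw [ZFSet.mem_insert_iff]
    exact ⟨fun h => (h3 z h).symm, by rintro (rfl | h); exacts [h1, h2 z h]⟩
  · intro h
    simp only [h, ZFSet.mem_insert_iff]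
    exact ⟨Or.inl trivial, fun z hz => Or.inr hz, fun z hz => hz.symm⟩

theorem eqNat (hf : IsVar f) (k : ℕ) : Delta0 n (fun a => f a = natSet k) := by
  induction k generalizing n with
  | zero =>
    refine (ball (S := fun _ _ => False) hf (const False)).congr fun a => ?_
    rw [natSet, ZFSet.eq_empty]
  | succ k ih =>
    obtain ⟨i, rfl⟩ := hf
    refine (bex (S := fun a u => u = natSet k ∧ a i = insert u u) ⟨i, rfl⟩
      ((ih ⟨_, rfl⟩).and (eqSucc ⟨_, rfl⟩ ⟨_, rfl⟩))).congr fun a => ⟨?_, fun h => ?_⟩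
    · rintro ⟨u, -, rfl, h⟩
      exact h
    · exact ⟨natSet k, by dsimp only at h; rw [h, natSet]; exact ZFSet.mem_insert _ _, rfl, h⟩

theorem eqPair (hf : IsVar f) (hg : IsVar g) (hh : IsVar h) :
    Delta0 n (fun a => f a = ZFSet.pair (g a) (h a)) := by
  obtain ⟨i, rfl⟩ := hf
  obtain ⟨j, rfl⟩ := hg
  obtain ⟨k, rfl⟩ := hh
  have h1 : ∀ {n : ℕ} (i j k : Fin n), Delta0 n fun a => a i = {a j, a k} := fun i j k => by
    refine (((mem ⟨j, rfl⟩ ⟨i, rfl⟩).and (mem ⟨k, rfl⟩ ⟨i, rfl⟩)).and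
      (ball (S := fun a z => z = a j ∨ z = a k) ⟨i, rfl⟩
      ((eq ⟨_, rfl⟩ ⟨_, rfl⟩).or (eq ⟨_, rfl⟩ ⟨_, rfl⟩)))).congr fun a => ⟨?_, fun h => ?_⟩
    · rintro ⟨⟨h1, h2⟩, h3⟩
      ext z
      rw [ZFSet.mem_pair]
      exact ⟨h3 z, by rintro (rfl | rfl); exacts [h1, h2]⟩
    · simp only [h, ZFSet.mem_pair, or_true, true_or, and_self, true_and]
      exact fun z hz => hz
  refine (((bex (S := fun a z => z = {a j, a j}) ⟨i, rfl⟩ (h1 _ _ _)).and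
    (bex (S := fun a z => z = {a j, a k}) ⟨i, rfl⟩ (h1 _ _ _))).and
    (ball (S := fun a z => z = {a j, a j} ∨ z = {a j, a k}) ⟨i, rfl⟩
      ((h1 _ _ _).or (h1 _ _ _)))).congr fun a => ?_
  have hs : ({a j, a j} : ZFSet.{0}) = {a j} := by ext z; simp
  rw [hs, ZFSet.pair]
  constructor
  · rintro ⟨⟨⟨u, h1, rfl⟩, v, h2, rfl⟩, h3⟩
    ext z
    rw [ZFSet.mem_pair]
    exact ⟨h3 z, by rintro (rfl | rfl); exacts [h1, h2]⟩
  · intro h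
    dsimp only at h
    rw [h]
    exact ⟨⟨⟨_, ZFSet.mem_pair.2 (Or.inl rfl), rfl⟩, _, ZFSet.mem_pair.2 (Or.inr rfl), rfl⟩,
      fun z hz => ZFSet.mem_pair.1 hz⟩

theorem pairMem (hf : IsVar f) (hg : IsVar g) (hr : IsVar r) :
    Delta0 n (fun a => ZFSet.pair (f a) (g a) ∈ r a) := by
  obtain ⟨i, rfl⟩ := hf
  obtain ⟨j, rfl⟩ := hg
  refine (bex (S := fun a p => p = ZFSet.pair (a i) (a j)) hr
    (eqPair ⟨_, rfl⟩ ⟨_, rfl⟩ ⟨_, rfl⟩)).congr fun a => ?_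
  exact ⟨by rintro ⟨p, h, rfl⟩; exact h, fun h => ⟨_, h, rfl⟩⟩

theorem tripleMem (hf : IsVar f) (hg : IsVar g) (hh : IsVar h) (hr : IsVar r) :
    Delta0 n (fun a => ZFSet.pair (f a) (ZFSet.pair (g a) (h a)) ∈ r a) := by
  obtain ⟨i, rfl⟩ := hf
  obtain ⟨j, rfl⟩ := hg
  obtain ⟨k, rfl⟩ := hh
  obtain ⟨l, rfl⟩ := hr
  have : Delta0 n fun a => ∃ p ∈ a l, ∃ u ∈ p, ∃ v ∈ u, v = ZFSet.pair (a j) (a k) ∧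
      p = ZFSet.pair (a i) v := by
    refine bex ⟨_, rfl⟩ (bex ⟨_, rfl⟩ (bex ⟨_, rfl⟩ ?_))
    exact (eqPair ⟨_, rfl⟩ ⟨_, rfl⟩ ⟨_, rfl⟩).and (eqPair ⟨_, rfl⟩ ⟨_, rfl⟩ ⟨_, rfl⟩)
  refine this.congr fun a => ⟨?_, fun h => ?_⟩
  · rintro ⟨p, h, u, -, v, -, rfl, rfl⟩
    exact h
  · exact ⟨_, h, {a i, ZFSet.pair (a j) (a k)}, ZFSet.mem_pair.2 (Or.inr rfl), _,
      ZFSet.mem_pair.2 (Or.inr rfl), rfl, rfl⟩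

end Delta0

/-- `β` is the position of a head after the motion `m` from `α`, for von Neumann ordinals. -/
def MoveRel : Move → ZFSet.{0} → ZFSet.{0} → Prop
  | .left, α, β => (∃ γ ∈ α, α = insert γ γ ∧ β = γ) ∨
      ((∀ γ ∈ α, ¬ α = insert γ γ) ∧ β = natSet 0)
  | .stay, α, β => β = α
  | .right, α, β => β = insert α α

/-- The part of an instruction that does not concern states: the bits read on the input and the
work tape, the bit written, and the motions of the input head and the work head. -/
abbrev Instr : Type := Bool × Bool × Bool × Move × Move

instance : Finite Instr :=
  have : Finite Move := Finite.of_surjective (fun i : Fin 3 => Move.ofNat i) fun m => by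
    cases m
    exacts [⟨0, rfl⟩, ⟨1, rfl⟩, ⟨2, rfl⟩]
  inferInstance

/-- `α` belongs to the code of the numeral `1`. -/
def IsInputCell (α : ZFSet.{0}) : Prop :=
  α = natSet 0 ∨ α = natSet 2 ∨ α = natSet 3 ∨ α = natSet 4 ∨ α = natSet 6

/-- The instruction `k` applies if the input head is at `α`, the work head is at `β` and the
time is `t`. -/
def InstrApplies (k : Instr) (W t α β : ZFSet.{0}) : Prop :=
  (k.1 = true ↔ IsInputCell α) ∧ (k.2.1 = true ↔ ZFSet.pair t β ∈ W)

/-- The table `Δ` contains the instruction `k` for the state `q`, with the next state `q'`. -/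
def HasRow (L Δ : ZFSet.{0}) (k : Instr) (q q' : ZFSet.{0}) : Prop :=
  ∃ m ∈ L, m = natSet (Encodable.encode k) ∧ ZFSet.pair q (ZFSet.pair m q') ∈ Δ

/-- At time `t`, the state is `q`, the input head is at `α` and the work head is at `β`. States and
positions are von Neumann ordinals, and `Q`, `I`, `H` consist of the pairs of a time and an element
of the state, of the position of the input head, and of the position of the work head. -/
def HasConfig (L Q I H t q α β : ZFSet.{0}) : Prop :=
  ∀ ξ ∈ L, (ZFSet.pair t ξ ∈ Q ↔ ξ ∈ q) ∧ (ZFSet.pair t ξ ∈ I ↔ ξ ∈ α) ∧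
    (ZFSet.pair t ξ ∈ H ↔ ξ ∈ β)

/-- Between the times `t` and `s`, the machine with the table `Δ` executes the instruction `k`. -/
def StepRel (k : Instr) (L n Δ Q I H W t s : ZFSet.{0}) : Prop :=
  ∃ q ∈ n, ∃ q' ∈ n, HasRow L Δ k q q' ∧ ∃ α ∈ L, ∃ β ∈ L, ∃ α' ∈ L, ∃ β' ∈ L,
    HasConfig L Q I H t q α β ∧ HasConfig L Q I H s q' α' β' ∧
    MoveRel k.2.2.2.1 α α' ∧ MoveRel k.2.2.2.2 β β' ∧ InstrApplies k W t α β ∧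
    ∀ ξ ∈ L, (ZFSet.pair s ξ ∈ W ↔
      (ξ = β ∧ k.2.2.1 = true) ∨ (¬ ξ = β ∧ ZFSet.pair t ξ ∈ W))

/-- At time `t`, the section of `R` is the inferior limit of its former sections. -/
def LiminfRel (R t ξ : ZFSet.{0}) : Prop :=
  ZFSet.pair t ξ ∈ R ↔ ∃ r ∈ t, ∀ s ∈ t, (r ∈ s ∨ r = s) → ZFSet.pair s ξ ∈ R

/-- At time `t`, the section of `R` is the inferior limit of its sections at former times at which
the section of `Q` was the same. -/
def LiminfRelAlong (L Q R t ξ : ZFSet.{0}) : Prop :=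
  ZFSet.pair t ξ ∈ R ↔ ∃ r ∈ t, ∀ s ∈ t, (r ∈ s ∨ r = s) →
    (∀ b ∈ L, (ZFSet.pair s b ∈ Q ↔ ZFSet.pair t b ∈ Q)) → ZFSet.pair s ξ ∈ R

/-- `L` is a limit ordinal, `T ∈ L`, and `n ∈ L` is a natural number. -/
def BoundRel (L T n : ZFSet.{0}) : Prop :=
  (∀ x ∈ L, ∀ y ∈ x, y ∈ L) ∧ (∀ x ∈ L, ∀ y ∈ x, ∀ z ∈ y, z ∈ x) ∧
    (∀ x ∈ L, ∃ y ∈ L, y = insert x x) ∧ T ∈ L ∧ n ∈ L ∧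
    ∀ m ∈ L, (m ∈ n ∨ m = n) → (m = natSet 0 ∨ ∃ u ∈ m, m = insert u u)

/-- `Δ` assigns at most one instruction to a state and the bits read. -/
def TableRel (L n Δ : ZFSet.{0}) : Prop :=
  ∀ k k' : Instr, k.1 = k'.1 → k.2.1 = k'.2.1 → ∀ q ∈ n, ∀ q₁ ∈ n, ∀ q₂ ∈ n,
    HasRow L Δ k q q₁ → HasRow L Δ k' q q₂ → k = k' ∧ q₁ = q₂

/-- `Q`, `I`, `H` and `W` describe the run of the machine with the table `Δ` and the empty oracle up
to time `T`, at which the machine halts. The oracle head always reads `0` and is left out. -/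
def RunRel (L T n Δ Q I H W : ZFSet.{0}) : Prop :=
  (∀ z ∈ L, z = natSet 0 → HasConfig L Q I H z z z z ∧ ∀ ξ ∈ L, ¬ ZFSet.pair z ξ ∈ W) ∧
  (∀ t ∈ T, ∀ s ∈ L, s = insert t t → ∃ k : Instr, StepRel k L n Δ Q I H W t s) ∧
  (∀ t ∈ L, (t ∈ T ∨ t = T) → ¬ t = natSet 0 → (∀ u ∈ t, ¬ t = insert u u) → ∀ ξ ∈ L,
    LiminfRel Q t ξ ∧ LiminfRelAlong L Q I t ξ ∧ LiminfRelAlong L Q H t ξ ∧ LiminfRel W t ξ) ∧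
  ∃ q ∈ L, ∃ α ∈ L, ∃ β ∈ L, HasConfig L Q I H T q α β ∧
    ∀ k : Instr, ∀ q' ∈ n, q ∈ n → HasRow L Δ k q q' → ¬ InstrApplies k W T α β

/-- `F` is the function `(β, α) ↦ 2 * (κ * β + α)` for `α, β < κ`, given by its recursion along the
lexicographic order. -/
def PlaceRel (L κ F : ZFSet.{0}) : Prop :=
  κ ∈ L ∧ (∀ β ∈ κ, ∀ α ∈ κ, ∃ γ ∈ L, ZFSet.pair β (ZFSet.pair α γ) ∈ F) ∧
  ∀ β ∈ κ, ∀ α ∈ κ, ∀ γ ∈ L, ZFSet.pair β (ZFSet.pair α γ) ∈ F →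
    ∀ ξ ∈ L, (ξ ∈ γ ↔ ∃ β' ∈ κ, ∃ α' ∈ κ, ∃ γ' ∈ L, ZFSet.pair β' (ZFSet.pair α' γ') ∈ F ∧
      (β' ∈ β ∨ (β' = β ∧ α' ∈ α)) ∧ (ξ ∈ γ' ∨ ξ = γ' ∨ ξ = insert γ' γ'))

/-- `d` is a function from `κ` onto the transitive set `Y` with `d 0 = y`. -/
def EnumRel (κ d Y y : ZFSet.{0}) : Prop :=
  (∀ x ∈ Y, ∀ z ∈ x, z ∈ Y) ∧ (∀ x ∈ Y, ∃ α ∈ κ, ZFSet.pair α x ∈ d) ∧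
  (∀ α ∈ κ, ∃ x ∈ Y, ZFSet.pair α x ∈ d) ∧
  (∀ α ∈ κ, ∀ x ∈ Y, ∀ x' ∈ Y, ZFSet.pair α x ∈ d → ZFSet.pair α x' ∈ d → x = x') ∧
  y ∈ Y ∧ ∃ z ∈ κ, z = natSet 0 ∧ ZFSet.pair z y ∈ d

/-- The work tape at time `T` holds the adjacency matrix of `∈` along `d`. -/
def OutputRel (L T W κ F d Y : ZFSet.{0}) : Prop :=
  ∀ ξ ∈ L, (ZFSet.pair T ξ ∈ W ↔ ∃ β ∈ κ, ∃ α ∈ κ, ∃ γ ∈ L, ZFSet.pair β (ZFSet.pair α γ) ∈ F ∧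
    (ξ = γ ∨ (ξ = insert γ γ ∧
      ∃ x ∈ Y, ∃ x' ∈ Y, ZFSet.pair α x ∈ d ∧ ZFSet.pair β x' ∈ d ∧ x ∈ x')))

/-- The elements of `c` witness that some machine, with the empty oracle and the code of `1` as its
input, halts with an output that codes `y`. -/
def ComputationRel (y c : ZFSet.{0}) : Prop :=
  ∃ L ∈ c, ∃ T ∈ c, ∃ n ∈ c, ∃ Δ ∈ c, ∃ Q ∈ c, ∃ I ∈ c, ∃ H ∈ c, ∃ W ∈ c, ∃ κ ∈ c, ∃ F ∈ c,
    ∃ d ∈ c, ∃ Y ∈ c, BoundRel L T n ∧ TableRel L n Δ ∧ RunRel L T n Δ Q I H W ∧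
      PlaceRel L κ F ∧ EnumRel κ d Y y ∧ OutputRel L T W κ F d Y

theorem delta0_moveRel {n : ℕ} {f g : (Fin n → ZFSet.{0}) → ZFSet.{0}} (hf : IsVar f)
    (hg : IsVar g) (m : Move) : Delta0 n fun a => MoveRel m (f a) (g a) := by
  obtain ⟨i, rfl⟩ := hf
  obtain ⟨j, rfl⟩ := hg
  cases m
  · refine Delta0.or (Delta0.bex ⟨_, rfl⟩ (Delta0.and (Delta0.eqSucc ⟨_, rfl⟩ ⟨_, rfl⟩)
      (Delta0.eq ⟨_, rfl⟩ ⟨_, rfl⟩))) (Delta0.and (Delta0.ball ⟨_, rfl⟩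
      (Delta0.not (Delta0.eqSucc ⟨_, rfl⟩ ⟨_, rfl⟩))) (Delta0.eqNat ⟨_, rfl⟩ 0))
  · exact Delta0.eq ⟨_, rfl⟩ ⟨_, rfl⟩
  · exact Delta0.eqSucc ⟨_, rfl⟩ ⟨_, rfl⟩

/-- The proof follows the syntax of the definitions. -/
theorem delta0_computationRel : Delta0 2 fun a => ComputationRel (a 0) (a 1) := by
  unfold ComputationRel BoundRel TableRel RunRel PlaceRel EnumRel OutputRel LiminfRel LiminfRelAlong
    StepRel HasConfig HasRow InstrApplies IsInputCell
  repeat' first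
    | exact Delta0.mem ⟨_, rfl⟩ ⟨_, rfl⟩
    | exact Delta0.eq ⟨_, rfl⟩ ⟨_, rfl⟩
    | exact Delta0.eqNat ⟨_, rfl⟩ _
    | exact Delta0.eqSucc ⟨_, rfl⟩ ⟨_, rfl⟩
    | exact Delta0.pairMem ⟨_, rfl⟩ ⟨_, rfl⟩ ⟨_, rfl⟩
    | exact Delta0.tripleMem ⟨_, rfl⟩ ⟨_, rfl⟩ ⟨_, rfl⟩ ⟨_, rfl⟩
    | exact delta0_moveRel ⟨_, rfl⟩ ⟨_, rfl⟩ _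
    | exact Delta0.const _
    | refine Delta0.bex ⟨_, rfl⟩ ?_
    | refine Delta0.ball ⟨_, rfl⟩ ?_
    | refine Delta0.and ?_ ?_
    | refine Delta0.or ?_ ?_
    | refine Delta0.iff ?_ ?_
    | refine Delta0.not ?_
    | refine Delta0.imp ?_ ?_
    | refine Delta0.forall_finite fun _ => ?_
    | refine Delta0.exists_finite fun _ => ?_

/-! ### Translation between ordinals and von Neumann ordinals -/

theorem forall_mem_toZFSet {ℓ : Ordinal.{0}} {p : ZFSet.{0} → Prop} :
    (∀ x ∈ ℓ.toZFSet, p x) ↔ ∀ ξ < ℓ, p ξ.toZFSet := by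
  simp [Ordinal.mem_toZFSet_iff]

theorem exists_mem_toZFSet {ℓ : Ordinal.{0}} {p : ZFSet.{0} → Prop} :
    (∃ x ∈ ℓ.toZFSet, p x) ↔ ∃ ξ < ℓ, p ξ.toZFSet := by
  simp [Ordinal.mem_toZFSet_iff]

theorem toZFSet_inj {a b : Ordinal.{0}} : a.toZFSet = b.toZFSet ↔ a = b :=
  Ordinal.toZFSet_injective.eq_iff

theorem toZFSet_eq_insert {a b : Ordinal.{0}} :
    a.toZFSet = insert b.toZFSet b.toZFSet ↔ a = b + 1 := by
  rw [← Ordinal.toZFSet_add_one, toZFSet_inj]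

theorem natSet_eq_toZFSet (k : ℕ) : natSet k = (k : Ordinal.{0}).toZFSet := by
  induction k with
  | zero => simp [natSet]
  | succ k ih => rw [natSet, ih, Nat.cast_succ, Ordinal.toZFSet_add_one]

theorem toZFSet_eq_natSet {a : Ordinal.{0}} {k : ℕ} : a.toZFSet = natSet k ↔ a = k := by
  rw [natSet_eq_toZFSet, toZFSet_inj]

theorem moveRel_toZFSet {m : Move} {α β : Ordinal.{0}} :
    MoveRel m α.toZFSet β.toZFSet ↔ β = m.apply α := by
  cases m
  · simp only [MoveRel, exists_mem_toZFSet, forall_mem_toZFSet, toZFSet_eq_insert, toZFSet_inj,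
      toZFSet_eq_natSet, Nat.cast_zero, Move.apply]
    split_ifs with h
    · have hc := h.choose_spec
      constructor
      · rintro (⟨γ, -, h1, rfl⟩ | ⟨h1, -⟩)
        · refine Order.succ_injective ?_
          rw [Order.succ_eq_add_one, Order.succ_eq_add_one]
          exact h1.symm.trans hc
        · exact absurd hc (h1 _ ((lt_add_one _).trans_eq hc.symm))
      · intro h'
        exact Or.inl ⟨_, (lt_add_one _).trans_eq hc.symm, hc, h'⟩
    · constructor
      · rintro (⟨γ, -, h1, rfl⟩ | ⟨-, h1⟩)
        · exact absurd ⟨_, h1⟩ h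
        · exact h1
      · exact fun h1 => Or.inr ⟨fun γ _ hγ => h ⟨γ, hγ⟩, h1⟩
  · simp only [MoveRel, toZFSet_inj, Move.apply]
  · simp only [MoveRel, toZFSet_eq_insert, Move.apply]

/-- The code of the numeral `1`, see `eq_of_codes_natSet_one`. -/
def inputTape : Set Ordinal.{0} := {0, 2, 3, 4, 6}

theorem isInputCell_toZFSet {α : Ordinal.{0}} : IsInputCell α.toZFSet ↔ α ∈ inputTape := by
  simp [IsInputCell, toZFSet_eq_natSet, inputTape]

theorem hasConfig_toZFSet {ℓ q α β : Ordinal.{0}} {Q I H t : ZFSet.{0}} :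
    HasConfig ℓ.toZFSet Q I H t q.toZFSet α.toZFSet β.toZFSet ↔ ∀ ξ < ℓ,
      (ZFSet.pair t ξ.toZFSet ∈ Q ↔ ξ < q) ∧ (ZFSet.pair t ξ.toZFSet ∈ I ↔ ξ < α) ∧
      (ZFSet.pair t ξ.toZFSet ∈ H ↔ ξ < β) := by
  simp only [HasConfig, forall_mem_toZFSet, Ordinal.toZFSet_mem_toZFSet_iff]

/-- Ordinals that are coded by sections of subsets of `ℓ × ℓ` are compared below `ℓ` only. -/
theorem eq_of_forall_lt_iff_below {ℓ a b : Ordinal.{0}} (ha : a < ℓ)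
    (h : ∀ ξ < ℓ, (ξ < a ↔ ξ < b)) : a = b := by
  refine le_antisymm (not_lt.1 fun hb => ?_) (not_lt.1 fun hb => ?_)
  · exact lt_irrefl _ ((h b (hb.trans ha)).1 hb)
  · exact lt_irrefl _ ((h a ha).2 hb)

theorem HasConfig.unique {ℓ q α β q' α' β' : Ordinal.{0}} {Q I H t : ZFSet.{0}}
    (h : HasConfig ℓ.toZFSet Q I H t q.toZFSet α.toZFSet β.toZFSet) (hq : q < ℓ) (hα : α < ℓ)
    (hβ : β < ℓ) (h' : HasConfig ℓ.toZFSet Q I H t q'.toZFSet α'.toZFSet β'.toZFSet) :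
    q = q' ∧ α = α' ∧ β = β' := by
  rw [hasConfig_toZFSet] at h h'
  exact ⟨eq_of_forall_lt_iff_below hq fun ξ hξ => (h ξ hξ).1.symm.trans (h' ξ hξ).1,
    eq_of_forall_lt_iff_below hα fun ξ hξ => (h ξ hξ).2.1.symm.trans (h' ξ hξ).2.1,
    eq_of_forall_lt_iff_below hβ fun ξ hξ => (h ξ hξ).2.2.symm.trans (h' ξ hξ).2.2⟩

theorem Program.lt_state_limit_iff_ordinal (P : Program) (o i : Set Ordinal.{0}) {t : Ordinal.{0}}
    (ht : Order.IsSuccLimit t) (ξ : Ordinal.{0}) : ξ < ((P.config o i t).state : Ordinal.{0}) ↔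
      ∃ r < t, ∀ s, r ≤ s → s < t → ξ < ((P.config o i s).state : Ordinal.{0}) := by
  rcases lt_or_ge ξ Ordinal.omega0 with h | h
  · obtain ⟨b, rfl⟩ := Ordinal.lt_omega0.1 h
    simpa using P.lt_state_limit_iff o i ht b
  · refine iff_of_false (not_lt.2 ((Ordinal.natCast_lt_omega0 _).le.trans h)) ?_
    rintro ⟨r, hr, H⟩
    exact absurd (H r le_rfl hr) (not_lt.2 ((Ordinal.natCast_lt_omega0 _).le.trans h))

theorem boundRel_toZFSet {ℓ T : Ordinal.{0}} {n : ℕ} (hℓ : Order.IsSuccLimit ℓ) (hT : T < ℓ) :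
    BoundRel ℓ.toZFSet T.toZFSet (n : Ordinal.{0}).toZFSet := by
  have hn : ((n : ℕ) : Ordinal.{0}) < ℓ :=
    (Ordinal.natCast_lt_omega0 n).trans_le (Ordinal.omega0_le_of_isSuccLimit hℓ)
  simp only [BoundRel, forall_mem_toZFSet, exists_mem_toZFSet, Ordinal.toZFSet_mem_toZFSet_iff,
    toZFSet_eq_insert, toZFSet_inj, toZFSet_eq_natSet]
  refine ⟨fun x hx y hy => hy.trans hx, fun x _ y hy z hz => hz.trans hy,
    fun x hx => ⟨x + 1, hℓ.add_one_lt hx, rfl⟩, hT, hn, fun m _ h => ?_⟩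
  obtain ⟨k, rfl⟩ := Ordinal.lt_omega0.1
    ((le_iff_lt_or_eq.2 h).trans_lt (Ordinal.natCast_lt_omega0 n))
  cases k with
  | zero => exact Or.inl rfl
  | succ k => exact Or.inr ⟨k, by exact_mod_cast k.lt_succ_self, by push_cast; rfl⟩

theorem BoundRel.exists_ordinal {L T n : ZFSet.{0}} (h : BoundRel L T n) :
    ∃ (ℓ τ : Ordinal.{0}) (k : ℕ), L = ℓ.toZFSet ∧ T = τ.toZFSet ∧
      n = (k : Ordinal.{0}).toZFSet ∧ Order.IsSuccLimit ℓ ∧ τ < ℓ := by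
  obtain ⟨h1, h2, h3, h4, h5, h6⟩ := h
  have hL : L.IsOrdinal := ZFSet.isOrdinal_iff_forall_mem_isTransitive.2
    ⟨fun x hx y hy => h1 x hx y hy, fun x hx y hy z hz => h2 x hx y hy z hz⟩
  obtain ⟨ℓ, rfl⟩ : ∃ ℓ : Ordinal.{0}, L = ℓ.toZFSet := ⟨_, hL.toZFSet_rank_eq.symm⟩
  obtain ⟨τ, hτ, rfl⟩ := Ordinal.mem_toZFSet_iff.1 h4
  obtain ⟨ν, hν, rfl⟩ := Ordinal.mem_toZFSet_iff.1 h5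
  simp only [forall_mem_toZFSet, exists_mem_toZFSet, Ordinal.toZFSet_mem_toZFSet_iff,
    toZFSet_eq_insert, toZFSet_inj, toZFSet_eq_natSet] at h3 h6
  have hℓ : Order.IsSuccLimit ℓ := by
    refine ⟨fun hmin => ?_, fun a ha => ?_⟩
    · exact absurd hτ (by rw [hmin.eq_bot]; exact not_lt_bot)
    · obtain ⟨b, hb, hab⟩ := h3 a ha.lt
      exact ha.2 ((lt_add_one a).trans_eq hab.symm) hb
  have hνω : ν < Ordinal.omega0 := by
    by_contra hω
    have hω := not_lt.1 hω
    rcases h6 Ordinal.omega0 (hω.trans_lt hν) (le_iff_lt_or_eq.1 hω) with h | ⟨u, hu, h⟩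
    · simp at h
    · exact absurd (Ordinal.isSuccLimit_omega0.add_one_lt hu) (by rw [← h]; exact lt_irrefl _)
  obtain ⟨k, rfl⟩ := Ordinal.lt_omega0.1 hνω
  exact ⟨ℓ, τ, k, rfl, rfl, rfl, hℓ, hτ⟩

/-! ### Decoding the output -/

theorem matrix_place_lt_iff {κ α α' β β' : Ordinal.{0}} (hα : α < κ) (hα' : α' < κ) :
    κ * β' + α' < κ * β + α ↔ β' < β ∨ (β' = β ∧ α' < α) := by
  have key : ∀ {β β' α α' : Ordinal.{0}}, α' < κ → β' < β → κ * β' + α' < κ * β + α := by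
    intro β β' α α' hα' h
    refine lt_of_lt_of_le ?_ le_self_add
    refine lt_of_lt_of_le (add_lt_add_right hα' _) ?_
    rw [← mul_add_one]
    exact mul_le_mul_right (Order.add_one_le_of_lt h) κ
  constructor
  · intro h
    rcases lt_trichotomy β' β with h1 | rfl | h1
    · exact Or.inl h1
    · exact Or.inr ⟨rfl, (add_lt_add_iff_left _).1 h⟩
    · exact absurd h (key hα h1).not_gt
  · rintro (h | ⟨rfl, h⟩)
    · exact key hα' h
    · exact (add_lt_add_iff_left _).2 h

theorem lt_two_mul_iff {ξ δ : Ordinal.{0}} :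
    ξ < 2 * δ ↔ ∃ δ' < δ, ξ < 2 * δ' ∨ ξ = 2 * δ' ∨ ξ = 2 * δ' + 1 := by
  constructor
  · intro h
    obtain ⟨q, hq, r, hr, rfl⟩ := Ordinal.lt_mul_iff.1 h
    refine ⟨q, hq, Or.inr ?_⟩
    rw [← one_add_one_eq_two, Order.lt_add_one_iff, Order.le_one_iff] at hr
    rcases hr with rfl | rfl
    · exact Or.inl (add_zero _)
    · exact Or.inr rfl
  · rintro ⟨δ', h, h1 | rfl | rfl⟩
    · exact h1.trans (two_mul_lt.2 h)
    · exact two_mul_lt.2 h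
    · exact two_mul_add_one_lt.2 h

theorem PlaceRel.eq_of_mem {ℓ κ : Ordinal.{0}} {F : ZFSet.{0}}
    (h : PlaceRel ℓ.toZFSet κ.toZFSet F) {α β : Ordinal.{0}} (hα : α < κ) (hβ : β < κ)
    {γ : Ordinal.{0}} (hγ : γ < ℓ)
    (hF : ZFSet.pair β.toZFSet (ZFSet.pair α.toZFSet γ.toZFSet) ∈ F) :
    γ = 2 * (κ * β + α) := by
  obtain ⟨-, h1, h2⟩ := h
  simp only [forall_mem_toZFSet, exists_mem_toZFSet, Ordinal.toZFSet_mem_toZFSet_iff,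
    toZFSet_eq_insert, toZFSet_inj] at h1 h2
  generalize hδ : κ * β + α = δ
  induction δ using WellFoundedLT.induction generalizing α β γ with
  | _ δ ih =>
    subst hδ
    refine eq_of_forall_lt_iff_below hγ fun ξ hξ => ?_
    rw [h2 β hβ α hα γ hγ hF ξ hξ, lt_two_mul_iff]
    constructor
    · rintro ⟨β', hβ', α', hα', γ', hγ', hF', hlex, hle⟩
      have hlt := (matrix_place_lt_iff hα hα').2 hlex
      obtain rfl := ih _ hlt hα' hβ' hγ' hF' rfl
      exact ⟨_, hlt, hle⟩
    · rintro ⟨δ', hlt, hle⟩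
      obtain ⟨β', hβ', α', hα', rfl⟩ := Ordinal.lt_mul_iff.1 (hlt.trans (matrix_place_lt hα hβ))
      obtain ⟨γ', hγ', hF'⟩ := h1 β' hβ' α' hα'
      have := ih _ hlt hα' hβ' hγ' hF' rfl
      subst this
      exact ⟨β', hβ', α', hα', _, hγ', hF', (matrix_place_lt_iff hα hα').1 hlt, hle⟩

theorem weaklyCodes_of_outputRel {ℓ T κ : Ordinal.{0}} {F d Y W y : ZFSet.{0}}
    (hP : PlaceRel ℓ.toZFSet κ.toZFSet F) (hE : EnumRel κ.toZFSet d Y y)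
    (hO : OutputRel ℓ.toZFSet T.toZFSet W κ.toZFSet F d Y) (hℓ : Order.IsSuccLimit ℓ) :
    WeaklyCodes {ξ | ξ < ℓ ∧ ZFSet.pair T.toZFSet ξ.toZFSet ∈ W} y := by
  obtain ⟨e1, e2, e3, e4, e5, e6⟩ := hE
  have hplace : ∀ β < κ, ∀ α < κ, 2 * (κ * β + α) < ℓ ∧
      ZFSet.pair β.toZFSet (ZFSet.pair α.toZFSet (2 * (κ * β + α)).toZFSet) ∈ F := by
    intro β hβ α hα
    have h1 := hP.2.1
    simp only [forall_mem_toZFSet, exists_mem_toZFSet] at h1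
    obtain ⟨γ, hγ, hF⟩ := h1 β hβ α hα
    obtain rfl := hP.eq_of_mem hα hβ hγ hF
    exact ⟨hγ, hF⟩
  simp only [forall_mem_toZFSet, exists_mem_toZFSet, toZFSet_eq_natSet] at e2 e3 e4 e6
  choose! D hD hD' using e3
  have hDu : ∀ α < κ, ∀ x ∈ Y, ZFSet.pair α.toZFSet x ∈ d → D α = x := fun α hα x hx h =>
    e4 α hα _ (hD α hα) x hx (hD' α hα) h
  obtain ⟨z, hz, hz0, hzy⟩ := e6
  rw [Nat.cast_zero] at hz0
  subst hz0
  refine ⟨κ, D, hz, fun β hβ x hx => ?_, hDu 0 hz y e5 hzy, ?_⟩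
  · obtain ⟨α, hα, h⟩ := e2 x (e1 _ (hD β hβ) x hx)
    exact ⟨α, hα, hDu α hα x (e1 _ (hD β hβ) x hx) h⟩
  · simp only [OutputRel, forall_mem_toZFSet, exists_mem_toZFSet, toZFSet_eq_insert,
      toZFSet_inj] at hO
    ext ξ
    simp only [codeTape, mem_union, mem_ofPred_eq]
    constructor
    · rintro ⟨hξ, hW⟩
      obtain ⟨β, hβ, α, hα, γ, hγ, hF, h⟩ := (hO ξ hξ).1 hW
      obtain rfl := hP.eq_of_mem hα hβ hγ hF
      rcases h with rfl | ⟨rfl, x, hx, x', hx', h1, h2, h3⟩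
      · exact Or.inl ⟨_, matrix_place_lt hα hβ, rfl⟩
      · refine Or.inr ⟨α, hα, β, hβ, ?_, rfl⟩
        rwa [hDu α hα x hx h1, hDu β hβ x' hx' h2]
    · rintro (⟨δ, hδ, rfl⟩ | ⟨α, hα, β, hβ, h, rfl⟩)
      · obtain ⟨β, hβ, α, hα, rfl⟩ := Ordinal.lt_mul_iff.1 hδ
        obtain ⟨h1, h2⟩ := hplace β hβ α hα
        exact ⟨h1, (hO _ h1).2 ⟨β, hβ, α, hα, _, h1, h2, Or.inl rfl⟩⟩
      · obtain ⟨h1, h2⟩ := hplace β hβ α hα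
        exact ⟨hℓ.add_one_lt h1, (hO _ (hℓ.add_one_lt h1)).2 ⟨β, hβ, α, hα, _, h1, h2,
          Or.inr ⟨rfl, _, hD α hα, _, hD β hβ, hD' α hα, hD' β hβ, h⟩⟩⟩

/-! ### Runs as sets -/

open Classical in
/-- The transition table that is coded by the set `Δ`. It ignores the oracle, whose head does
not move. -/
noncomputable def decodeTable (L Δ : ZFSet.{0}) (n : ℕ) : ℕ → Bool → Bool → Bool → Option Action :=
  fun q _ b c =>
    if h : ∃ r : Instr × ℕ, r.1.1 = b ∧ r.1.2.1 = c ∧ r.2 < n ∧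
      HasRow L Δ r.1 (q : Ordinal.{0}).toZFSet (r.2 : Ordinal.{0}).toZFSet
    then some (h.choose.1.2.2.1, .stay, h.choose.1.2.2.2.1, h.choose.1.2.2.2.2, h.choose.2)
    else none

theorem exists_lt_nat_iff {n : ℕ} {p : Ordinal.{0} → Prop} :
    (∃ q < (n : Ordinal.{0}), p q) ↔ ∃ q < n, p (q : ℕ) := by
  constructor
  · rintro ⟨q, hq, h⟩
    obtain ⟨m, rfl⟩ := Ordinal.lt_omega0.1 (hq.trans (Ordinal.natCast_lt_omega0 n))
    exact ⟨m, by exact_mod_cast hq, h⟩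
  · rintro ⟨q, hq, h⟩
    exact ⟨q, by exact_mod_cast hq, h⟩

theorem forall_lt_nat_iff {n : ℕ} {p : Ordinal.{0} → Prop} :
    (∀ q < (n : Ordinal.{0}), p q) ↔ ∀ q < n, p (q : ℕ) := by
  have := (exists_lt_nat_iff (n := n) (p := fun q => ¬ p q)).not
  push Not at this
  exact this

theorem decodeTable_eq_some {ℓ : Ordinal.{0}} {Δ : ZFSet.{0}} {n : ℕ}
    (hΔ : TableRel ℓ.toZFSet (n : Ordinal.{0}).toZFSet Δ) {q q' : ℕ} {k : Instr} (hq : q < n)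
    (hq' : q' < n) (h : HasRow ℓ.toZFSet Δ k (q : Ordinal.{0}).toZFSet (q' : Ordinal.{0}).toZFSet)
    (a : Bool) : decodeTable ℓ.toZFSet Δ n q a k.1 k.2.1 =
      some (k.2.2.1, .stay, k.2.2.2.1, k.2.2.2.2, q') := by
  have hex : ∃ r : Instr × ℕ, r.1.1 = k.1 ∧ r.1.2.1 = k.2.1 ∧ r.2 < n ∧
      HasRow ℓ.toZFSet Δ r.1 (q : Ordinal.{0}).toZFSet (r.2 : Ordinal.{0}).toZFSet :=
    ⟨(k, q'), rfl, rfl, hq', h⟩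
  obtain ⟨h1, h2, h3, h4⟩ := hex.choose_spec
  have := hΔ hex.choose.1 k h1 h2
  simp only [forall_mem_toZFSet, forall_lt_nat_iff, toZFSet_inj, Nat.cast_inj] at this
  obtain ⟨h5, h6⟩ := this q hq _ h3 q' hq' h4 h
  rw [decodeTable, dif_pos hex, h5, h6]

/-- At time `τ`, the sets `Q`, `I`, `H` and `W` describe the configuration `C`, except for the
oracle head. -/
def Describes (ℓ : Ordinal.{0}) (Q I H W : ZFSet.{0}) (τ : Ordinal.{0}) (C : Config) : Prop :=
  HasConfig ℓ.toZFSet Q I H τ.toZFSet (C.state : Ordinal.{0}).toZFSet C.inputHead.toZFSet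
    C.workHead.toZFSet ∧ (∀ ξ < ℓ, (ZFSet.pair τ.toZFSet ξ.toZFSet ∈ W ↔ ξ ∈ C.work))

/-- Sets that satisfy `RunRel` describe the run of a machine. -/
theorem haltsWith_of_runRel {ℓ T : Ordinal.{0}} {n : ℕ} {Δ Q I H W : ZFSet.{0}}
    (hℓ : Order.IsSuccLimit ℓ) (hT : T < ℓ)
    (hΔ : TableRel ℓ.toZFSet (n : Ordinal.{0}).toZFSet Δ)
    (hR : RunRel ℓ.toZFSet T.toZFSet (n : Ordinal.{0}).toZFSet Δ Q I H W) :
    (ofTable n (decodeTable ℓ.toZFSet Δ n)).HaltsWith ∅ inputTape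
      {ξ | ξ < ℓ ∧ ZFSet.pair T.toZFSet ξ.toZFSet ∈ W} := by
  classical
  obtain ⟨hinit, hstep, hlim, hhalt⟩ := hR
  have hω := Ordinal.omega0_le_of_isSuccLimit hℓ
  simp only [forall_mem_toZFSet, exists_mem_toZFSet, Ordinal.toZFSet_mem_toZFSet_iff,
    toZFSet_eq_insert, toZFSet_inj, toZFSet_eq_natSet, Nat.cast_zero] at hinit hstep hlim hhalt
  set P := ofTable n (decodeTable ℓ.toZFSet Δ n) with hP
  have inv : ∀ τ ≤ T, Describes ℓ Q I H W τ (P.config ∅ inputTape τ) ∧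
      (P.config ∅ inputTape τ).work ⊆ Iio ℓ := by
    intro τ
    induction τ using Ordinal.limitRecOn with
    | zero =>
      intro _
      obtain ⟨h1, h2⟩ := hinit 0 (bot_le.trans_lt hT) rfl
      rw [Program.config_zero]
      refine ⟨⟨?_, fun ξ hξ => iff_of_false (h2 ξ hξ) (notMem_empty ξ)⟩, empty_subset _⟩
      simpa [initConfig] using h1
    | add_one τ ih =>
      intro hτ
      have hτT : τ < T := (lt_add_one τ).trans_le hτ
      obtain ⟨⟨hc, hw⟩, hsub⟩ := ih hτT.le
      obtain ⟨k, hk⟩ := hstep τ hτT (τ + 1) (hτ.trans_lt hT) rfl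
      simp only [StepRel, exists_mem_toZFSet, forall_mem_toZFSet, exists_lt_nat_iff,
        toZFSet_inj, moveRel_toZFSet, InstrApplies, isInputCell_toZFSet] at hk
      obtain ⟨q, hq, q', hq', hrow, α, hα, β, hβ, α', hα', β', hβ', hc1, hc2, hm1, hm2,
        ⟨hb1, hb2⟩, hw'⟩ := hk
      obtain ⟨e1, e2, e3⟩ := hc1.unique ((Ordinal.natCast_lt_omega0 q).trans_le hω) hα hβ hc
      have e1 : q = (P.config ∅ inputTape τ).state := by exact_mod_cast e1
      have hstep' := step_ofTable (n := n) (δ := decodeTable ℓ.toZFSet Δ n) (o := ∅)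
        (i := inputTape) (C := P.config ∅ inputTape τ) (w := k.2.2.1) (m₁ := .stay)
        (m₂ := k.2.2.2.1) (m₃ := k.2.2.2.2) (q := q') (by rw [← e1]; exact hq) (by
          rw [← e1, ← e2, ← e3]
          have b1 : decide (α ∈ inputTape) = k.1 := Bool.eq_iff_iff.2 (by simpa using hb1.symm)
          have b2 : decide (β ∈ (P.config ∅ inputTape τ).work) = k.2.1 :=
            Bool.eq_iff_iff.2 (by rw [decide_eq_true_eq, ← hw β hβ]; exact hb2.symm)
          rw [b1, b2]
          exact decodeTable_eq_some hΔ hq hq' hrow _)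
      rw [Program.config_add_one, hP, hstep']
      refine ⟨⟨?_, fun ξ hξ => ?_⟩, fun ξ hξ => ?_⟩
      · dsimp only
        rw [← e2, ← e3, ← hm1, ← hm2]
        exact hc2
      · rw [hw' ξ hξ, hw ξ hξ, e3]
        simp only [mem_ofPred_eq]
        split_ifs with h <;> simp [h]
      · simp only [mem_ofPred_eq] at hξ
        split_ifs at hξ with h
        · rw [h, ← e3]; exact hβ
        · exact hsub hξ
    | limit τ hτ ih =>
      intro hτT
      have hτℓ := hτT.trans_lt hT
      have ih' : ∀ s < τ, Describes ℓ Q I H W s (P.config ∅ inputTape s) ∧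
        (P.config ∅ inputTape s).work ⊆ Iio ℓ := fun s hs => ih s hs (hs.le.trans hτT)
      have hc : ∀ s < τ, _ := fun s hs => hasConfig_toZFSet.1 (ih' s hs).1.1
      have hl := hlim τ hτℓ (le_iff_lt_or_eq.1 hτT) hτ.ne_bot
        (fun u hu h => hτ.succ_ne u (by rw [Order.succ_eq_add_one]; exact h.symm))
      simp only [LiminfRel, LiminfRelAlong, exists_mem_toZFSet, forall_mem_toZFSet,
        Ordinal.toZFSet_mem_toZFSet_iff, toZFSet_inj, ← le_iff_lt_or_eq] at hl
      have hQ : ∀ ξ < ℓ, (ZFSet.pair τ.toZFSet ξ.toZFSet ∈ Q ↔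
          ξ < ((P.config ∅ inputTape τ).state : Ordinal.{0})) := fun ξ hξ => by
        rw [(hl ξ hξ).1, P.lt_state_limit_iff_ordinal _ _ hτ]
        refine exists_congr fun r => and_congr_right fun _ => ⟨fun h s h1 h2 => ?_,
          fun h s h1 h2 => ?_⟩
        · exact (hc s h2 ξ hξ).1.1 (h s h2 h1)
        · exact (hc s h1 ξ hξ).1.2 (h s h2 h1)
      have hstate : ∀ s < τ, ((∀ b < ℓ, (ZFSet.pair s.toZFSet b.toZFSet ∈ Q ↔
          ZFSet.pair τ.toZFSet b.toZFSet ∈ Q)) ↔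
          (P.config ∅ inputTape s).state = (P.config ∅ inputTape τ).state) := by
        intro s hs
        constructor
        · intro h
          have := eq_of_forall_lt_iff_below (ℓ := ℓ)
            ((Ordinal.natCast_lt_omega0 (P.config ∅ inputTape s).state).trans_le hω)
            fun b hb => (hc s hs b hb).1.symm.trans ((h b hb).trans (hQ b hb))
          exact_mod_cast this
        · intro h b hb
          rw [hQ b hb, (hc s hs b hb).1, h]
      have hW : ∀ ξ < ℓ, (ZFSet.pair τ.toZFSet ξ.toZFSet ∈ W ↔
          ξ ∈ (P.config ∅ inputTape τ).work) := fun ξ hξ => by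
        rw [(hl ξ hξ).2.2.2, P.mem_work_limit_iff _ _ hτ]
        refine exists_congr fun r => and_congr_right fun _ => ⟨fun h s h1 h2 => ?_,
          fun h s h1 h2 => ?_⟩
        · exact ((ih' s h2).1.2 ξ hξ).1 (h s h2 h1)
        · exact ((ih' s h1).1.2 ξ hξ).2 (h s h2 h1)
      refine ⟨⟨hasConfig_toZFSet.2 fun ξ hξ => ⟨hQ ξ hξ, ?_, ?_⟩, hW⟩, fun ξ hξ => ?_⟩
      · rw [(hl ξ hξ).2.1, P.lt_inputHead_limit_iff _ _ hτ]
        refine exists_congr fun r => and_congr_right fun _ => ⟨fun h s h1 h2 h3 => ?_,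
          fun h s h1 h2 h3 => ?_⟩
        · exact (hc s h2 ξ hξ).2.1.1 (h s h2 h1 ((hstate s h2).2 h3))
        · exact (hc s h1 ξ hξ).2.1.2 (h s h2 h1 ((hstate s h1).1 h3))
      · rw [(hl ξ hξ).2.2.1, P.lt_workHead_limit_iff _ _ hτ]
        refine exists_congr fun r => and_congr_right fun _ => ⟨fun h s h1 h2 h3 => ?_,
          fun h s h1 h2 h3 => ?_⟩
        · exact (hc s h2 ξ hξ).2.2.1 (h s h2 h1 ((hstate s h2).2 h3))
        · exact (hc s h1 ξ hξ).2.2.2 (h s h2 h1 ((hstate s h1).1 h3))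
      · obtain ⟨r, hr, h⟩ := (P.mem_work_limit_iff _ _ hτ ξ).1 hξ
        exact (ih' r hr).2 (h r le_rfl hr)
  obtain ⟨⟨hc, hw⟩, hsub⟩ := inv T le_rfl
  obtain ⟨q, hq, α, hα, β, hβ, hc1, hno⟩ := hhalt
  obtain ⟨rfl, rfl, rfl⟩ := hc1.unique hq hα hβ hc
  refine ⟨T, command_ofTable_eq_none fun hn => ?_, ?_⟩
  · rw [decodeTable, dif_neg]
    rintro ⟨⟨k, q'⟩, h1, h2, h3, h4⟩
    refine hno k q' (by exact_mod_cast h3) (by exact_mod_cast hn) h4 ⟨?_, ?_⟩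
    · rw [h1, isInputCell_toZFSet]; simp
    · rw [h2, hw _ hβ]; simp
  · ext ξ
    exact ⟨fun h => ⟨hsub h, (hw ξ (hsub h)).2 h⟩, fun h => (hw ξ h.1).1 h.2⟩

/-- If `ComputationRel y c` holds, then `y` is coded by the output of a machine. -/
theorem ComputationRel.exists_haltsWith {y c : ZFSet.{0}} (h : ComputationRel y c) :
    ∃ e z, (program e).HaltsWith ∅ inputTape z ∧ WeaklyCodes z y := by
  obtain ⟨L, -, T, -, n, -, Δ, -, Q, -, I, -, H, -, W, -, κ, -, F, -, d, -, Y, -, hB, hΔ, hR, hP,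
    hE, hO⟩ := h
  obtain ⟨ℓ, τ, k, rfl, rfl, rfl, hℓ, hτ⟩ := hB.exists_ordinal
  obtain ⟨κ, -, rfl⟩ := Ordinal.mem_toZFSet_iff.1 hP.1
  obtain ⟨e, he⟩ := exists_program_eq (ofTable k (decodeTable ℓ.toZFSet Δ k))
  exact ⟨e, _, he ▸ haltsWith_of_runRel hℓ hτ hΔ hR, weaklyCodes_of_outputRel hP hE hO hℓ⟩

theorem exists_pairSet (A B : ZFSet.{0}) (R : ZFSet.{0} → ZFSet.{0} → Prop) :
    ∃ X : ZFSet.{0}, ∀ x ∈ A, ∀ y ∈ B, (ZFSet.pair x y ∈ X ↔ R x y) := by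
  refine ⟨ZFSet.sep (fun p => ∃ x y, p = ZFSet.pair x y ∧ R x y) (ZFSet.prod A B),
    fun x hx y hy => ?_⟩
  rw [ZFSet.mem_sep, ZFSet.pair_mem_prod]
  constructor
  · rintro ⟨-, x', y', h, hR⟩
    obtain ⟨rfl, rfl⟩ := ZFSet.pair_inj.1 h
    exact hR
  · exact fun h => ⟨⟨hx, hy⟩, x, y, rfl, h⟩

theorem exists_relSet (ℓ : Ordinal.{0}) (R : Ordinal.{0} → Ordinal.{0} → Prop) :
    ∃ X : ZFSet.{0}, ∀ α < ℓ, ∀ β < ℓ, (ZFSet.pair α.toZFSet β.toZFSet ∈ X ↔ R α β) := by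
  obtain ⟨X, hX⟩ := exists_pairSet ℓ.toZFSet ℓ.toZFSet fun x y => R x.rank y.rank
  exact ⟨X, fun α hα β hβ => by
    simpa using hX _ (Ordinal.toZFSet_mem_toZFSet_iff.2 hα) _
      (Ordinal.toZFSet_mem_toZFSet_iff.2 hβ)⟩

theorem exists_tripleSet (ℓ : Ordinal.{0})
    (R : Ordinal.{0} → Ordinal.{0} → Ordinal.{0} → Prop) :
    ∃ X : ZFSet.{0}, ∀ α < ℓ, ∀ β < ℓ, ∀ γ < ℓ,
      (ZFSet.pair α.toZFSet (ZFSet.pair β.toZFSet γ.toZFSet) ∈ X ↔ R α β γ) := by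
  obtain ⟨X, hX⟩ := exists_pairSet ℓ.toZFSet (ZFSet.prod ℓ.toZFSet ℓ.toZFSet) fun x p =>
    ∃ β γ : Ordinal.{0}, p = ZFSet.pair β.toZFSet γ.toZFSet ∧ R x.rank β γ
  refine ⟨X, fun α hα β hβ γ hγ => ?_⟩
  rw [hX _ (Ordinal.toZFSet_mem_toZFSet_iff.2 hα) _ (ZFSet.pair_mem_prod.2
    ⟨Ordinal.toZFSet_mem_toZFSet_iff.2 hβ, Ordinal.toZFSet_mem_toZFSet_iff.2 hγ⟩)]
  constructor
  · rintro ⟨β', γ', h, hR⟩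
    obtain ⟨h1, h2⟩ := ZFSet.pair_inj.1 h
    rw [toZFSet_inj] at h1 h2
    subst h1 h2
    simpa using hR
  · exact fun h => ⟨β, γ, rfl, by simpa using h⟩

/-- The command that is executed in state `q` if the heads read `0`, `b` and `c`. -/
def Program.firstCommand (P : Program) (q : ℕ) (b c : Bool) : Option Command :=
  P.find? fun d => d.state == q && d.onOracle == false && d.onInput == b && d.onWork == c

open Classical in
theorem Program.command_empty (P : Program) (i : Set Ordinal.{0}) (C : Config) :
    P.command ∅ i C =
      P.firstCommand C.state (decide (C.inputHead ∈ i)) (decide (C.workHead ∈ C.work)) := by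
  unfold Program.command Program.firstCommand
  congr 1
  ext1 d
  rw [Bool.eq_iff_iff]
  simp only [Command.Applies, decide_eq_true_eq, Bool.and_eq_true, beq_iff_eq, mem_empty_iff_false,
    iff_false, Bool.not_eq_true, and_assoc]
  refine and_congr_right fun _ => and_congr_right fun _ => and_congr ?_ ?_
  · by_cases h : C.inputHead ∈ i <;> simp [h]
  · by_cases h : C.workHead ∈ C.work <;> simp [h]

/-- An output that codes `y` has a description by sets. -/
theorem exists_outputRel {ℓ T κ : Ordinal.{0}} {W : ZFSet.{0}} {z : Set Ordinal.{0}}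
    {D : Ordinal.{0} → ZFSet.{0}} {y : ZFSet.{0}} (hκ : κ < ℓ) (hκ' : 2 * (κ * κ) < ℓ)
    (hW : ∀ ξ < ℓ, (ZFSet.pair T.toZFSet ξ.toZFSet ∈ W ↔ ξ ∈ z))
    (hD : BijOn D (Iio κ) (tcSingleton y)) (h0 : D 0 = y)
    (hz : z = codeTape κ fun α β => D α ∈ D β) :
    ∃ F d Y, PlaceRel ℓ.toZFSet κ.toZFSet F ∧ EnumRel κ.toZFSet d Y y ∧
      OutputRel ℓ.toZFSet T.toZFSet W κ.toZFSet F d Y := by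
  obtain ⟨F, hF⟩ := exists_tripleSet ℓ fun β α γ => γ = 2 * (κ * β + α)
  let Y : ZFSet.{0} := ZFSet.sep (· ∈ tcSingleton y) (ZFSet.vonNeumann (y.rank + 1))
  have hY : ∀ x, x ∈ Y ↔ x ∈ tcSingleton y := fun x => by
    rw [ZFSet.mem_sep, ZFSet.mem_vonNeumann, Order.lt_add_one_iff]
    exact ⟨fun h => h.2, fun h => ⟨rank_le_of_mem_tcSingleton h, h⟩⟩
  obtain ⟨d, hd⟩ := exists_pairSet κ.toZFSet Y fun α x => D α.rank = x
  have hd' : ∀ α < κ, ∀ x ∈ Y, (ZFSet.pair α.toZFSet x ∈ d ↔ D α = x) := fun α hα x hx => by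
    simpa using hd _ (Ordinal.toZFSet_mem_toZFSet_iff.2 hα) x hx
  have hDY : ∀ α < κ, D α ∈ Y := fun α hα => (hY _).2 (hD.mapsTo hα)
  have hpl : ∀ β < κ, ∀ α < κ, 2 * (κ * β + α) < ℓ := fun β hβ α hα =>
    (two_mul_lt.2 (matrix_place_lt hα hβ)).trans hκ'
  have hF' : ∀ β < κ, ∀ α < κ, ∀ γ < ℓ,
      (ZFSet.pair β.toZFSet (ZFSet.pair α.toZFSet γ.toZFSet) ∈ F ↔ γ = 2 * (κ * β + α)) :=
    fun β hβ α hα γ hγ => hF β (hβ.trans hκ) α (hα.trans hκ) γ hγ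
  refine ⟨F, d, Y, ⟨Ordinal.toZFSet_mem_toZFSet_iff.2 hκ, ?_, ?_⟩, ⟨?_, ?_, ?_, ?_, ?_, ?_⟩, ?_⟩
  · simp only [forall_mem_toZFSet, exists_mem_toZFSet]
    exact fun β hβ α hα => ⟨_, hpl β hβ α hα, (hF' β hβ α hα _ (hpl β hβ α hα)).2 rfl⟩
  · simp only [forall_mem_toZFSet, exists_mem_toZFSet, Ordinal.toZFSet_mem_toZFSet_iff,
      toZFSet_eq_insert, toZFSet_inj]
    intro β hβ α hα γ hγ h ξ hξ
    rw [hF' β hβ α hα γ hγ] at h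
    rw [h, lt_two_mul_iff]
    constructor
    · rintro ⟨δ, hlt, hle⟩
      obtain ⟨β', hβ', α', hα', rfl⟩ := Ordinal.lt_mul_iff.1 (hlt.trans (matrix_place_lt hα hβ))
      exact ⟨β', hβ', α', hα', _, hpl β' hβ' α' hα',
        (hF' β' hβ' α' hα' _ (hpl β' hβ' α' hα')).2 rfl, (matrix_place_lt_iff hα hα').1 hlt, hle⟩
    · rintro ⟨β', hβ', α', hα', γ', hγ', h', hlex, hle⟩
      rw [hF' β' hβ' α' hα' γ' hγ'] at h'
      subst h'
      exact ⟨_, (matrix_place_lt_iff hα hα').2 hlex, hle⟩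
  · exact fun x hx u hu => (hY u).2 (mem_tcSingleton_of_mem ((hY x).1 hx) hu)
  · simp only [exists_mem_toZFSet]
    intro x hx
    obtain ⟨α, hα, h⟩ := hD.surjOn ((hY x).1 hx)
    exact ⟨α, hα, (hd' α hα x hx).2 h⟩
  · simp only [forall_mem_toZFSet]
    exact fun α hα => ⟨D α, hDY α hα, (hd' α hα _ (hDY α hα)).2 rfl⟩
  · simp only [forall_mem_toZFSet]
    intro α hα x hx x' hx' h h'
    rw [hd' α hα _ hx] at h
    rw [hd' α hα _ hx'] at h'
    exact h.symm.trans h'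
  · exact (hY y).2 (self_mem_tcSingleton y)
  · simp only [exists_mem_toZFSet, toZFSet_eq_natSet]
    exact ⟨0, pos_of_bijOn_tcSingleton hD, by simp, (hd' 0 (pos_of_bijOn_tcSingleton hD) y
      ((hY y).2 (self_mem_tcSingleton y))).2 h0⟩
  · simp only [OutputRel, forall_mem_toZFSet, exists_mem_toZFSet, toZFSet_eq_insert, toZFSet_inj]
    intro ξ hξ
    rw [hW ξ hξ, hz]
    constructor
    · rintro (⟨δ, hδ, rfl⟩ | ⟨α, hα, β, hβ, h, rfl⟩)
      · obtain ⟨β, hβ, α, hα, rfl⟩ := Ordinal.lt_mul_iff.1 hδ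
        exact ⟨β, hβ, α, hα, _, hξ, (hF' β hβ α hα _ hξ).2 rfl, Or.inl rfl⟩
      · exact ⟨β, hβ, α, hα, _, hpl β hβ α hα, (hF' β hβ α hα _ (hpl β hβ α hα)).2 rfl,
          Or.inr ⟨rfl, _, hDY α hα, _, hDY β hβ, (hd' α hα _ (hDY α hα)).2 rfl,
          (hd' β hβ _ (hDY β hβ)).2 rfl, h⟩⟩
    · rintro ⟨β, hβ, α, hα, γ, hγ, h, h'⟩
      rw [hF' β hβ α hα γ hγ] at h
      subst h
      rcases h' with rfl | ⟨rfl, x, hx, x', hx', h1, h2, h3⟩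
      · exact two_mul_mem_codeTape.2 (matrix_place_lt hα hβ)
      · rw [hd' α hα x hx] at h1
        rw [hd' β hβ x' hx'] at h2
        subst h1 h2
        exact (two_mul_add_one_mem_codeTape hα hβ).2 h3

/-- A halting run, in which the heads stay below `ℓ`, has a description by sets. -/
theorem exists_runRel {P : Program} {n : ℕ} (hn : ∀ c ∈ P, c.state < n ∧ c.next < n)
    {ℓ T : Ordinal.{0}} (hℓ : Order.IsSuccLimit ℓ) (hT : T < ℓ)
    (hI : ∀ τ ≤ T, (P.config ∅ inputTape τ).inputHead < ℓ)
    (hH : ∀ τ ≤ T, (P.config ∅ inputTape τ).workHead < ℓ)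
    (hrun : ∀ τ < T, P.command ∅ inputTape (P.config ∅ inputTape τ) ≠ none)
    (hhalt : P.command ∅ inputTape (P.config ∅ inputTape T) = none) :
    ∃ Δ Q I H W, TableRel ℓ.toZFSet (n : Ordinal.{0}).toZFSet Δ ∧
      RunRel ℓ.toZFSet T.toZFSet (n : Ordinal.{0}).toZFSet Δ Q I H W ∧
      ∀ ξ < ℓ, (ZFSet.pair T.toZFSet ξ.toZFSet ∈ W ↔ ξ ∈ (P.config ∅ inputTape T).work) := by
  classical
  have hω := Ordinal.omega0_le_of_isSuccLimit hℓ
  have hnat : ∀ m : ℕ, ((m : ℕ) : Ordinal.{0}) < ℓ :=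
    fun m => (Ordinal.natCast_lt_omega0 m).trans_le hω
  set K : Ordinal.{0} → Config := P.config ∅ inputTape with hK
  obtain ⟨Q, hQ⟩ := exists_relSet ℓ fun τ ξ => ξ < ((K τ).state : Ordinal.{0})
  obtain ⟨I, hI'⟩ := exists_relSet ℓ fun τ ξ => ξ < (K τ).inputHead
  obtain ⟨H, hH'⟩ := exists_relSet ℓ fun τ ξ => ξ < (K τ).workHead
  obtain ⟨W, hW⟩ := exists_relSet ℓ fun τ ξ => ξ ∈ (K τ).work
  obtain ⟨Δ, hΔ⟩ := exists_tripleSet ℓ fun q m q' => ∃ (k : Instr) (q₀ : ℕ) (c : Command),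
    P.firstCommand q₀ k.1 k.2.1 = some c ∧ k.2.2 = (c.write, c.moveInput, c.moveWork) ∧
    q = q₀ ∧ m = (Encodable.encode k : ℕ) ∧ q' = c.next
  have hrow : ∀ (k : Instr) (q q' : ℕ), HasRow ℓ.toZFSet Δ k (q : Ordinal.{0}).toZFSet
      (q' : Ordinal.{0}).toZFSet ↔ ∃ c, P.firstCommand q k.1 k.2.1 = some c ∧
        k.2.2 = (c.write, c.moveInput, c.moveWork) ∧ q' = c.next := by
    intro k q q'
    simp only [HasRow, exists_mem_toZFSet, toZFSet_eq_natSet]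
    constructor
    · rintro ⟨m, hm, rfl, h⟩
      obtain ⟨k', q₀, c, h1, h2, h3, h4, h5⟩ := (hΔ _ (hnat q) _ hm _ (hnat q')).1 h
      obtain rfl : q = q₀ := by exact_mod_cast h3
      obtain rfl : k = k' := Encodable.encode_injective (by exact_mod_cast h4)
      exact ⟨c, h1, h2, by exact_mod_cast h5⟩
    · rintro ⟨c, h1, h2, rfl⟩
      exact ⟨_, hnat _, rfl, (hΔ _ (hnat q) _ (hnat _) _ (hnat _)).2
        ⟨k, q, c, h1, h2, rfl, rfl, rfl⟩⟩
  have hc : ∀ τ < ℓ, ∀ ξ < ℓ, _ := fun τ hτ ξ hξ =>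
    (⟨hQ τ hτ ξ hξ, hI' τ hτ ξ hξ, hH' τ hτ ξ hξ⟩ : _ ∧ _ ∧ _)
  have hconf : ∀ τ ≤ T, HasConfig ℓ.toZFSet Q I H τ.toZFSet ((K τ).state : Ordinal.{0}).toZFSet
      (K τ).inputHead.toZFSet (K τ).workHead.toZFSet := fun τ hτ =>
    hasConfig_toZFSet.2 fun ξ hξ => hc τ (hτ.trans_lt hT) ξ hξ
  refine ⟨Δ, Q, I, H, W, ?_, ⟨?_, ?_, ?_, ?_⟩, fun ξ hξ => hW T hT ξ hξ⟩
  · intro k k' hk1 hk2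
    simp only [forall_mem_toZFSet, forall_lt_nat_iff, hrow, toZFSet_inj, Nat.cast_inj]
    rintro q - q₁ - q₂ - ⟨c, h1, h2, rfl⟩ ⟨c', h3, h4, rfl⟩
    rw [hk1, hk2, h3, Option.some.injEq] at h1
    subst h1
    exact ⟨Prod.ext hk1 (Prod.ext hk2 (h2.trans h4.symm)), rfl⟩
  · simp only [forall_mem_toZFSet, toZFSet_eq_natSet, Nat.cast_zero]
    rintro z hz rfl
    have h0 : K 0 = initConfig := P.config_zero _ _
    refine ⟨?_, fun ξ hξ h => ?_⟩
    · simpa [h0, initConfig] using hconf 0 bot_le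
    · rw [hW 0 hz ξ hξ, h0] at h
      exact h
  · simp only [forall_mem_toZFSet, toZFSet_eq_insert]
    rintro t ht s hs rfl
    obtain ⟨c, hcom⟩ := Option.ne_none_iff_exists'.1 (hrun t ht)
    have hnext : K (t + 1) = c.exec (K t) := by
      rw [hK, P.config_add_one, Program.step, hcom]
    have hfirst := hcom
    rw [Program.command_empty] at hfirst
    have hmem := hn c (List.mem_of_find?_eq_some hfirst)
    have hst : c.state = (K t).state := by
      have := List.find?_some hfirst
      simp only [Bool.and_eq_true, beq_iff_eq] at this
      exact this.1.1.1
    refine ⟨(decide ((K t).inputHead ∈ inputTape), decide ((K t).workHead ∈ (K t).work), c.write,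
      c.moveInput, c.moveWork), ?_⟩
    simp only [StepRel, exists_mem_toZFSet, forall_mem_toZFSet, exists_lt_nat_iff,
      toZFSet_inj, moveRel_toZFSet, InstrApplies, isInputCell_toZFSet, hrow]
    have ht1 : t + 1 ≤ T := Order.add_one_le_of_lt ht
    refine ⟨(K t).state, hst ▸ hmem.1, c.next, hmem.2, ⟨c, hfirst, rfl, rfl⟩, _, hI t ht.le, _,
      hH t ht.le, _, hI _ ht1, _, hH _ ht1, hconf t ht.le, ?_, ?_, ?_, ⟨by simp, ?_⟩,
      fun ξ hξ => ?_⟩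
    · have := hconf (t + 1) ht1
      rw [hnext] at this ⊢
      exact this
    · rw [hnext]; rfl
    · rw [hnext]; rfl
    · rw [hW t (ht.trans hT) _ (hH t ht.le)]; simp
    · rw [hW _ hs ξ hξ, hW t (ht.trans hT) ξ hξ, hnext]
      simp only [Command.exec, mem_ofPred_eq]
      split_ifs with h <;> simp [h]
  · simp only [forall_mem_toZFSet, LiminfRel, LiminfRelAlong, exists_mem_toZFSet,
      Ordinal.toZFSet_mem_toZFSet_iff, toZFSet_eq_insert, toZFSet_inj, toZFSet_eq_natSet,
      Nat.cast_zero, ← le_iff_lt_or_eq]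
    intro τ hτℓ hτT hτ0 hτs ξ hξ
    have hτ : Order.IsSuccLimit τ := by
      refine ⟨fun h => hτ0 h.eq_bot, fun a ha => ?_⟩
      exact hτs a ha.lt (by rw [← Order.succ_eq_add_one]; exact ha.succ_eq.symm)
    have hstate : ∀ s < τ, ((∀ b < ℓ, (ZFSet.pair s.toZFSet b.toZFSet ∈ Q ↔
        ZFSet.pair τ.toZFSet b.toZFSet ∈ Q)) ↔ (K s).state = (K τ).state) := by
      intro s hs
      constructor
      · intro h
        have := eq_of_forall_lt_iff_below (hnat (K s).state) fun b hb =>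
          (hQ s (hs.trans hτℓ) b hb).symm.trans ((h b hb).trans (hQ τ hτℓ b hb))
        exact_mod_cast this
      · intro h b hb
        rw [hQ s (hs.trans hτℓ) b hb, hQ τ hτℓ b hb, h]
    refine ⟨?_, ?_, ?_, ?_⟩
    · rw [hQ τ hτℓ ξ hξ, hK, P.lt_state_limit_iff_ordinal _ _ hτ]
      refine exists_congr fun r => and_congr_right fun _ => ⟨fun h s h1 h2 => ?_,
        fun h s h1 h2 => ?_⟩
      · exact (hQ s (h1.trans hτℓ) ξ hξ).2 (h s h2 h1)
      · exact (hQ s (h2.trans hτℓ) ξ hξ).1 (h s h2 h1)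
    · rw [hI' τ hτℓ ξ hξ, hK, P.lt_inputHead_limit_iff _ _ hτ]
      refine exists_congr fun r => and_congr_right fun _ => ⟨fun h s h1 h2 h3 => ?_,
        fun h s h1 h2 h3 => ?_⟩
      · exact (hI' s (h1.trans hτℓ) ξ hξ).2 (h s h2 h1 ((hstate s h1).1 h3))
      · exact (hI' s (h2.trans hτℓ) ξ hξ).1 (h s h2 h1 ((hstate s h2).2 h3))
    · rw [hH' τ hτℓ ξ hξ, hK, P.lt_workHead_limit_iff _ _ hτ]
      refine exists_congr fun r => and_congr_right fun _ => ⟨fun h s h1 h2 h3 => ?_,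
        fun h s h1 h2 h3 => ?_⟩
      · exact (hH' s (h1.trans hτℓ) ξ hξ).2 (h s h2 h1 ((hstate s h1).1 h3))
      · exact (hH' s (h2.trans hτℓ) ξ hξ).1 (h s h2 h1 ((hstate s h2).2 h3))
    · rw [hW τ hτℓ ξ hξ, hK, P.mem_work_limit_iff _ _ hτ]
      refine exists_congr fun r => and_congr_right fun _ => ⟨fun h s h1 h2 => ?_,
        fun h s h1 h2 => ?_⟩
      · exact (hW s (h1.trans hτℓ) ξ hξ).2 (h s h2 h1)
      · exact (hW s (h2.trans hτℓ) ξ hξ).1 (h s h2 h1)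
  · refine ⟨_, Ordinal.toZFSet_mem_toZFSet_iff.2 (hnat (K T).state), _,
      Ordinal.toZFSet_mem_toZFSet_iff.2 (hI T le_rfl), _,
      Ordinal.toZFSet_mem_toZFSet_iff.2 (hH T le_rfl), hconf T le_rfl, fun k => ?_⟩
    simp only [forall_mem_toZFSet, forall_lt_nat_iff, hrow, InstrApplies, isInputCell_toZFSet,
      hW T hT _ (hH T le_rfl)]
    rintro q' - - ⟨c, h1, -, -⟩ ⟨h2, h3⟩
    rw [Program.command_empty] at hhalt
    have e1 : k.1 = decide ((K T).inputHead ∈ inputTape) := Bool.eq_iff_iff.2 (by simpa using h2)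
    have e2 : k.2.1 = decide ((K T).workHead ∈ (K T).work) :=
      Bool.eq_iff_iff.2 (by simpa using h3)
    rw [e1, e2, hhalt] at h1
    cases h1

/-- Each set that is coded by the output of a machine is captured by `ComputationRel`. -/
theorem exists_computationRel {P : Program} {z : Set Ordinal.{0}} {y : ZFSet.{0}}
    (hP : P.HaltsWith ∅ inputTape z) (hz : Codes z y) : ∃ c, ComputationRel y c := by
  obtain ⟨T₀, hT₀, -⟩ := id hP
  obtain ⟨T, hT, hmin⟩ := WellFounded.has_min Ordinal.lt_wf
    {t : Ordinal.{0} | P.command ∅ inputTape (P.config ∅ inputTape t) = none} ⟨T₀, hT₀⟩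
  obtain rfl := hP.unique ⟨T, hT, rfl⟩
  obtain ⟨κ, D, hD, h0, hzD⟩ := hz
  obtain ⟨n, hn⟩ : ∃ n, ∀ c ∈ P, c.state < n ∧ c.next < n := by
    refine ⟨(P.map Command.state).sum + (P.map Command.next).sum + 1, fun c hc => ?_⟩
    have h1 := List.single_le_sum (l := P.map Command.state) (by simp) _ (List.mem_map_of_mem hc)
    have h2 := List.single_le_sum (l := P.map Command.next) (by simp) _ (List.mem_map_of_mem hc)
    omega
  obtain ⟨B₁, hB₁⟩ : BddAbove ((fun τ => (P.config ∅ inputTape τ).inputHead) '' Iic T) :=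
    Ordinal.bddAbove_of_small
  obtain ⟨B₂, hB₂⟩ : BddAbove ((fun τ => (P.config ∅ inputTape τ).workHead) '' Iic T) :=
    Ordinal.bddAbove_of_small
  obtain ⟨ℓ, hℓ, hle⟩ : ∃ ℓ : Ordinal.{0}, Order.IsSuccLimit ℓ ∧
      max T (max (max B₁ B₂) (max κ (2 * (κ * κ)))) < ℓ :=
    ⟨_ + Ordinal.omega0, Ordinal.isSuccLimit_add _ Ordinal.isSuccLimit_omega0,
      lt_add_of_pos_right _ Ordinal.omega0_pos⟩
  simp only [max_lt_iff] at hle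
  obtain ⟨hTℓ, ⟨hB₁ℓ, hB₂ℓ⟩, hκ, hκ'⟩ := hle
  obtain ⟨Δ, Q, I, H, W, h1, h2, h3⟩ := exists_runRel hn hℓ hTℓ
    (fun τ hτ => (hB₁ ⟨τ, hτ, rfl⟩).trans_lt hB₁ℓ) (fun τ hτ => (hB₂ ⟨τ, hτ, rfl⟩).trans_lt hB₂ℓ)
    (fun τ hτ h => hmin τ h hτ) hT
  obtain ⟨F, d, Y, h4, h5, h6⟩ := exists_outputRel hκ hκ' h3 hD h0 hzD
  refine ⟨{ℓ.toZFSet, T.toZFSet, (n : Ordinal.{0}).toZFSet, Δ, Q, I, H, W, κ.toZFSet, F, d, Y},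
    ℓ.toZFSet, ?_, T.toZFSet, ?_, (n : Ordinal.{0}).toZFSet, ?_, Δ, ?_, Q, ?_, I, ?_, H, ?_, W, ?_,
    κ.toZFSet, ?_, F, ?_, d, ?_, Y, ?_, boundRel_toZFSet hℓ hTℓ, h1, h2, h4, h5, h6⟩
  all_goals simp only [ZFSet.mem_insert_iff, ZFSet.mem_singleton, true_or, or_true]

/-! ### The separating sentence -/

theorem natSet_injective : Function.Injective natSet := fun j k h => by
  rw [natSet_eq_toZFSet, natSet_eq_toZFSet, toZFSet_inj] at h
  exact_mod_cast h

theorem mem_realSet {x : Set ℕ} {z : ZFSet.{0}} : z ∈ realSet x ↔ ∃ k ∈ x, natSet k = z := by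
  simp [realSet]

theorem realSet_injective : Function.Injective realSet := by
  intro x x' h
  ext k
  have := congrArg (natSet k ∈ ·) h
  simpa [mem_realSet, natSet_injective.eq_iff] using this

theorem isHC_realSet (x : Set ℕ) : IsHC (realSet x) := by
  rw [IsHC, tcSingleton_eq]
  refine Set.Countable.insert _ ((countable_iUnion fun k =>
    (tcSingleton_natSet_finite k).countable).mono (iUnion_subset fun z => ?_))
  obtain ⟨k, -, hk⟩ := mem_realSet.1 z.2
  rw [← hk]
  exact subset_iUnion (fun k => tcSingleton (natSet k)) k

theorem isTransClass_HC : IsTransClass HC := fun _ hx _ hy =>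
  Set.Countable.mono (tcSingleton_subset (mem_tcSingleton_of_mem (self_mem_tcSingleton _) hy)) hx

/-- There are only countably many programs, and each of them has at most one output. -/
theorem countable_computationRel : {y : ZFSet.{0} | ∃ c, ComputationRel y c}.Countable := by
  choose! e he using fun (y : ZFSet.{0}) (h : ∃ c, ComputationRel y c) =>
    h.choose_spec.exists_haltsWith
  refine MapsTo.countable_of_injOn (f := e) (mapsTo_univ _ _) ?_ (to_countable univ)
  intro y hy y' hy' hyy'
  obtain ⟨z, hz, hzy⟩ := he y hy
  obtain ⟨z', hz', hzy'⟩ := he y' hy'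
  rw [hyy'] at hz
  rw [hz.unique hz'] at hzy
  exact hzy.unique hzy'

/-- A negative formula saying that no element of `H_{ω₁}` witnesses that `v₀` is the output of a
program for the empty oracle and the input `1`. -/
theorem exists_negative_not_computationRel : ∃ N : Formula 1, N.IsNegative ∧
    ∀ a : Fin 1 → ZFSet.{0}, IsHC (a 0) →
      (Sat HC N a ↔ ∀ c, IsHC c → ¬ ComputationRel (a 0) c) := by
  obtain ⟨D, hD, hD'⟩ := delta0_computationRel
  refine ⟨.all (.neg D), .all (.neg hD), fun a ha => forall₂_congr fun c hc => not_congr ?_⟩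
  refine hD' HC isTransClass_HC _ fun i => ?_
  refine Fin.lastCases ?_ (fun j => ?_) i
  · rw [Fin.snoc_last]
    exact hc
  · rw [Fin.snoc_castSucc, Fin.fin_one_eq_zero j]
    exact ha

/-- The witness would be an output on the input `1`, so it would have a record in `H_{ω₁}`. -/
theorem not_plainlyRealizable_ex {N : Formula 1} (hN : N.IsNegative)
    (h : ∀ a : Fin 1 → ZFSet.{0}, IsHC (a 0) →
      (Sat HC N a ↔ ∀ c, IsHC c → ¬ ComputationRel (a 0) c)) : ¬ PlainlyRealizable N.ex := by
  rintro ⟨e, -, b, hb, ⟨cs, i, w, hcs, hi, hw, hwb⟩, s, -, hs⟩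
  obtain ⟨e', he'⟩ := hN.exists_realizer (R := Plainly) (fun Q h => h []) fun Q => exists_of_plainly
  have hsat := (h _ hb).1 ((he' _).1 s hs)
  obtain rfl : cs = [] := by simpa using hcs
  obtain rfl : i = inputTape := eq_of_codes_natSet_one hi
  obtain ⟨c, hc⟩ := exists_computationRel hw hwb
  obtain ⟨c', hc', hcb⟩ := delta0_computationRel.exists_isHC hb hc
  exact hsat c' hc' hcb

/-- The realizer copies the oracle on the input `1`, and outputs a realizer of the negative formula
on the input `0`. -/
theorem asRealizable_ex {N : Formula 1} (hN : N.IsNegative)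
    (h : ∀ a : Fin 1 → ZFSet.{0}, IsHC (a 0) →
      (Sat HC N a ↔ ∀ c, IsHC c → ¬ ComputationRel (a 0) c)) : AsRealizable N.ex := by
  obtain ⟨e', he'⟩ := hN.exists_realizer (R := AlmostSurely) (fun Q => almostSurely_of_forall)
    fun Q => exists_of_almostSurely
  obtain ⟨L, hL⟩ := exists_finiteTape_codes (tcSingleton_realizer_finite e')
  obtain ⟨e, he⟩ := exists_program_eq (copyProgram L)
  refine ⟨e, ?_, almostSurely_of_countable (countable_computationRel.preimage realSet_injective)
    fun x hx => ?_⟩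
  · rw [Realizer.Admissible, he]
    exact ⟨copyProgram_safe L, copyProgram_codingStable hL⟩
  obtain ⟨c, hc⟩ := exists_codes (realSet x)
  have hcs : List.Forall₂ Codes [c] [realSet x] := .cons hc .nil
  obtain ⟨i₁, hi₁⟩ := exists_codes (natSet 1)
  obtain ⟨i₀, hi₀⟩ := exists_codes (natSet 0)
  refine ⟨realSet x, isHC_realSet x, ⟨[c], i₁, c, hcs, hi₁, ?_, hc⟩, ⟨e', []⟩,
    ⟨[c], i₀, finiteTape L, hcs, hi₀, ?_, hL⟩, (he' _).2 ((h _ (isHC_realSet x)).2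
      fun c' _ hc' => hx ⟨c', hc'⟩)⟩
  · rw [he]
    refine copyProgram_haltsWith_cons hc (hi₁.two_mem_iff.2 fun h => ?_)
    exact absurd (natSet_injective (a₁ := 1) (a₂ := 0) h) one_ne_zero
  · rw [he]
    exact copyProgram_haltsWith_of_notMem fun h => hi₀.two_mem_iff.1 h rfl

end OTM

theorem mainTheorem1 : ∃ φ : OTM.Formula 0, ¬ OTM.PlainlyRealizable φ ∧ OTM.AsRealizable φ := by
  obtain ⟨N, hN, h⟩ := OTM.exists_negative_not_computationRel
  exact ⟨N.ex, OTM.not_plainlyRealizable_ex hN h, OTM.asRealizable_ex hN h⟩
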